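/- Let $d,n\ge 1$ be integers, $\alpha>-1$, $\kappa\in(0,1]$, $T\in(-\infty,\infty]$, and write $\mathbb R^d_+=\{x\in\mathbb R^d: x_d>0\}$, $\mathbb R_T=(-\infty,T)$, $\Omega_T=\mathbb R_T\times\mathbb R^d_+$, and $d\mu=x_d^\alpha\,dx$ on $\mathbb R^d_+$, $d\mu=x_d^\alpha\,dx\,dt$ on $\Omega_T$. The norm $|\cdot|$ of a vector or matrix is the square root of the sum of the squares of its entries; repeated indices $i,j$ are summed from $1$ to $d$; $Du=(D_1u,\dots,D_du)$ is the weak spatial gradient in $\Omega_T$. Let $A^{ij}=A^{ij}(t,x)$ $(1\le i,j\le d)$, $C_0=C_0(t,x)$ and $a_0=a_0(x)$ be measurable $\mathbb R^{n\times n}$-valued functions on $\Omega_T$, $\Omega_T$ and $\mathbb R^d_+$, respectively, such that for all $\xi,\xi_1,\dots,\xi_d\in\mathbb R^n$ $$\kappa\sum_{i=1}^d|\xi_i|^2\le\sum_{i,j=1}^dA^{ij}\xi_j\cdot\xi_i,\qquad |A^{ij}|\le\kappa^{-1},$$ $$\kappa|\xi|^2\le a_0\xi\cdot\xi,\quad |a_0|\le\kappa^{-1},\quad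 a_0=a_0^{T},\qquad \kappa|\xi|^2\le C_0\xi\cdot\xi,\quad |C_0|\le\kappa^{-1};$$ no regularity of the coefficients is assumed. Let $\mathcal H^1_2(\Omega_T,\mu)$ be the set of $u:\Omega_T\to\mathbb R^n$ with $u,Du\in L_2(\Omega_T,\mu)$ for which there are $G^1,\dots,G^d,g\in L_2(\Omega_T,\mu)$ such that $-\int_{\Omega_T}a_0u\cdot\varphi_t\,d\mu=\int_{\Omega_T}(G^i\cdot D_i\varphi+g\cdot\varphi)\,d\mu$ for all $\varphi\in C_0^\infty((-\infty,T)\times\mathbb R^d)^n$. For $\lambda\ge0$, $F=(F^1,\dots,F^d)\in L_2(\Omega_T,\mu)^d$ and $f\in L_2(\Omega_T,\mu)$ (all $\mathbb R^n$-valued), $u\in\mathcal H^1_2(\Omega_T,\mu)$ is called a weak solution of $$x_d^\alpha a_0u_t-D_i(x_d^\alpha A^{ij}D_ju)+\lambda x_d^\alpha C_0u=-D_i(x_d^\alpha F^i)+\sqrt\lambda\,x_d^\alpha f\ \text{ in }\Omega_T,\qquad \lim_{x_d\to0^+}x_d^\alpha(A^{dj}D_ju-F^d)=0\ \text{ on }\mathbb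 R_T\times\mathbb R^{d-1}$$ if $$\int_{\Omega_T}\bigl(-a_0u\cdot\varphi_t+A^{ij}D_ju\cdot D_i\varphi+\lambda C_0u\cdot\varphi\bigr)\,d\mu=\int_{\Omega_T}\bigl(F^i\cdot D_i\varphi+\sqrt\lambda\,f\cdot\varphi\bigr)\,d\mu$$ for all $\varphi\in C_0^\infty((-\infty,T)\times\mathbb R^d)^n$. Then there is a constant $N=N(d,n,\alpha,\kappa)>0$ such that, for all $T$, $\lambda$, coefficients, $F$ and $f$ as above: 1. If $\lambda\ge0$ and $u\in\mathcal H^1_2(\Omega_T,\mu)$ is a weak solution, then (after modification on a null set) $u\in C_b(\overline{\mathbb R_T};L_2(\mathbb R^d_+,\mu))$, the space of bounded continuous $L_2(\mathbb R^d_+,\mu)$-valued functions on the closure of $\mathbb R_T$ in $\mathbb R$, and $$\sup_{t<T}\int_{\mathbb R^d_+}|u(t,\cdot)|^2\,d\mu+\int_{\Omega_T}|Du|^2\,d\mu+\lambda\int_{\Omega_T}|u|^2\,d\mu\le N\int_{\Omega_T}|F|^2\,d\mu+N\int_{\Omega_T}|f|^2\,d\mu.$$ 2. If $\lambda>0$,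 then there is a weak solution $u\in\mathcal H^1_2(\Omega_T,\mu)$, and it is unique (up to equality almost everywhere). -/

import Mathlib

open MeasureTheory Set Filter Topology
open scoped ContDiff Matrix BoundedContinuousFunction

noncomputable section

namespace WeightedParabolic

/-- The space `ℝ^d` with its Euclidean norm; the dimension is `d = m + 1 ≥ 1`, and the
distinguished coordinate `x_d` is the one with index `Fin.last m`. -/
abbrev Sp (m : ℕ) := EuclideanSpace ℝ (Fin (m + 1))

/-- The space `ℝ^n` of values, with its Euclidean norm. -/
abbrev Val (n : ℕ) := EuclideanSpace ℝ (Fin n)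

/-- `ℝ_T = (-∞, T)`, for `T ∈ (-∞, ∞]`. -/
def timeRay (T : EReal) : Set ℝ := {t | (t : EReal) < T}

/-- The upper half-space `ℝ^d_+ = {x : x_d > 0}`. -/
def halfSpace (m : ℕ) : Set (Sp m) := {x | 0 < x (Fin.last m)}

/-- `Ω_T = (-∞, T) × ℝ^d_+`. -/
def cyl (m : ℕ) (T : EReal) : Set (ℝ × Sp m) := timeRay T ×ˢ halfSpace m

/-- `dμ = x_d^α dx` on `ℝ^d_+`. -/
def muSpace (m : ℕ) (α : ℝ) : Measure (Sp m) :=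
  (volume.restrict (halfSpace m)).withDensity
    fun x => ENNReal.ofReal (x (Fin.last m) ^ α)

/-- `dμ = x_d^α dx dt` on `Ω_T`. -/
def muCyl (m : ℕ) (α : ℝ) (T : EReal) : Measure (ℝ × Sp m) :=
  (volume.restrict (cyl m T)).withDensity
    fun z => ENNReal.ofReal (z.2 (Fin.last m) ^ α)

/-- Time derivative of a (smooth) function of `(t, x)`. -/
def dt {m : ℕ} {V : Type*} [NormedAddCommGroup V] [NormedSpace ℝ V]
    (φ : ℝ × Sp m → V) (z : ℝ × Sp m) : V :=
  fderiv ℝ φ z (1, 0)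

/-- Spatial partial derivative `∂/∂x_i` of a (smooth) function of `(t, x)`. -/
def dx {m : ℕ} {V : Type*} [NormedAddCommGroup V] [NormedSpace ℝ V]
    (i : Fin (m + 1)) (φ : ℝ × Sp m → V) (z : ℝ × Sp m) : V :=
  fderiv ℝ φ z (0, EuclideanSpace.single i 1)

/-- `φ ∈ C_0^∞(O)`: smooth on the whole space, with compact support contained in `O`. -/
def IsTest {m : ℕ} {V : Type*} [NormedAddCommGroup V] [NormedSpace ℝ V]
    (O : Set (ℝ × Sp m)) (φ : ℝ × Sp m → V) : Prop :=
  ContDiff ℝ ∞ φ ∧ HasCompactSupport φ ∧ tsupport φ ⊆ O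

/-- `M v · w` in `ℝ^n`. -/
def mdot {n : ℕ} (M : Matrix (Fin n) (Fin n) ℝ) (v w : Val n) : ℝ :=
  (M *ᵥ v.ofLp) ⬝ᵥ w.ofLp

/-- `|M|`, the square root of the sum of the squares of the entries. -/
def matAbs {n : ℕ} (M : Matrix (Fin n) (Fin n) ℝ) : ℝ :=
  √(∑ k, ∑ l, M k l ^ 2)

/-- The leading coefficients `A^{ij}` are (Lebesgue) measurable on `Ω_T`, bounded, and strongly
elliptic with constant `κ`. -/
structure EllipticCoeff {m n : ℕ} (κ : ℝ) (T : EReal)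
    (A : Fin (m + 1) → Fin (m + 1) → ℝ × Sp m → Matrix (Fin n) (Fin n) ℝ) : Prop where
  meas : ∀ i j k l, AEMeasurable (fun z => A i j z k l) (volume.restrict (cyl m T))
  elliptic : ∀ᵐ z ∂(volume.restrict (cyl m T)), ∀ ξ : Fin (m + 1) → Val n,
    κ * ∑ i, ‖ξ i‖ ^ 2 ≤ ∑ i, ∑ j, mdot (A i j z) (ξ j) (ξ i)
  bounded : ∀ᵐ z ∂(volume.restrict (cyl m T)), ∀ i j, matAbs (A i j z) ≤ κ⁻¹

/-- A matrix-valued function is (Lebesgue) measurable, bounded and positive definite with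
constant `κ` on the set `O`. No symmetry is included. -/
structure NondegCoeff {X : Type*} [MeasureSpace X] {n : ℕ} (κ : ℝ) (O : Set X)
    (M : X → Matrix (Fin n) (Fin n) ℝ) : Prop where
  meas : ∀ k l, AEMeasurable (fun x => M x k l) (volume.restrict O)
  posdef : ∀ᵐ x ∂(volume.restrict O), ∀ ξ : Val n, κ * ‖ξ‖ ^ 2 ≤ mdot (M x) ξ ξ
  bounded : ∀ᵐ x ∂(volume.restrict O), matAbs (M x) ≤ κ⁻¹

/-- `Du = (D_1 u, …, D_d u)` is the weak spatial gradient of `u` in the open set `Ω_T`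
(with respect to Lebesgue measure, tested with scalar functions in `C_0^∞(Ω_T)`). -/
def HasWeakGrad {m n : ℕ} (T : EReal) (u : ℝ × Sp m → Val n)
    (Du : Fin (m + 1) → ℝ × Sp m → Val n) : Prop :=
  ∀ (i : Fin (m + 1)) (ψ : ℝ × Sp m → ℝ), IsTest (cyl m T) ψ →
    ∫ z in cyl m T, dx i ψ z • u z = - ∫ z in cyl m T, ψ z • Du i z

/-- The distribution `x_d^α a_0 u_t` on `(-∞, T) × ℝ^d`, given by
`φ ↦ - ∫_{Ω_T} a_0 u · φ_t dμ`, belongs to `ℍ^{-1}_2(Ω_T, μ)`: it is represented by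
some `G^i, g ∈ L_2(Ω_T, μ)`. -/
def TimeDerivMemHMinusOne {m n : ℕ} (α : ℝ) (T : EReal)
    (a₀ : Sp m → Matrix (Fin n) (Fin n) ℝ) (u : ℝ × Sp m → Val n) : Prop :=
  ∃ (G : Fin (m + 1) → ℝ × Sp m → Val n) (g : ℝ × Sp m → Val n),
    (∀ i, MemLp (G i) 2 (muCyl m α T)) ∧ MemLp g 2 (muCyl m α T) ∧
    ∀ φ : ℝ × Sp m → Val n, IsTest (timeRay T ×ˢ univ) φ →
      - ∫ z, mdot (a₀ z.2) (u z) (dt φ z) ∂(muCyl m α T) =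
        ∫ z, ((∑ i, inner ℝ (G i z) (dx i φ z)) + inner ℝ (g z) (φ z)) ∂(muCyl m α T)

/-- `u ∈ 𝓗^1_2(Ω_T, μ)`, with weak spatial gradient `Du`. -/
structure MemH1 {m n : ℕ} (α : ℝ) (T : EReal) (a₀ : Sp m → Matrix (Fin n) (Fin n) ℝ)
    (u : ℝ × Sp m → Val n) (Du : Fin (m + 1) → ℝ × Sp m → Val n) : Prop where
  memLp : MemLp u 2 (muCyl m α T)
  grad_memLp : ∀ i, MemLp (Du i) 2 (muCyl m α T)
  weakGrad : HasWeakGrad T u Du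
  timeDeriv : TimeDerivMemHMinusOne α T a₀ u

/-- `u`, with weak spatial gradient `Du`, satisfies the variational identity that defines weak
solutions of
`x_d^α a_0 u_t - D_i (x_d^α A^{ij} D_j u) + λ x_d^α C_0 u = - D_i (x_d^α F^i) + √λ x_d^α f`
in `Ω_T` with the conormal condition `lim_{x_d → 0+} x_d^α (A^{dj} D_j u - F^d) = 0`.
The test functions need not vanish at `x_d = 0`. It is used only for `u, Du, F, f` in
`L_2(Ω_T, μ)`, where all the integrals converge absolutely. -/
def IsWeakSol {m n : ℕ} (α : ℝ) (T : EReal) (lam : ℝ)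
    (a₀ : Sp m → Matrix (Fin n) (Fin n) ℝ)
    (A : Fin (m + 1) → Fin (m + 1) → ℝ × Sp m → Matrix (Fin n) (Fin n) ℝ)
    (C₀ : ℝ × Sp m → Matrix (Fin n) (Fin n) ℝ)
    (F : Fin (m + 1) → ℝ × Sp m → Val n) (f : ℝ × Sp m → Val n)
    (u : ℝ × Sp m → Val n) (Du : Fin (m + 1) → ℝ × Sp m → Val n) : Prop :=
  ∀ φ : ℝ × Sp m → Val n, IsTest (timeRay T ×ˢ univ) φ →
    ∫ z, (- mdot (a₀ z.2) (u z) (dt φ z)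
        + (∑ i, ∑ j, mdot (A i j z) (Du j z) (dx i φ z))
        + lam * mdot (C₀ z) (u z) (φ z)) ∂(muCyl m α T) =
      ∫ z, ((∑ i, inner ℝ (F i z) (dx i φ z)) + √lam * inner ℝ (f z) (φ z)) ∂(muCyl m α T)

/-- The bounded continuous function `U` on the closure of `(-∞, T)`, with values in
`L_2(ℝ^d_+, μ)`, is a version of `u`: `U(t) = u(t, ·)` for almost every `t < T`. -/
def IsVersion {m n : ℕ} (α : ℝ) (T : EReal) (u : ℝ × Sp m → Val n)
    (U : closure (timeRay T) →ᵇ Lp (Val n) 2 (muSpace m α)) : Prop :=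
  ∀ᵐ t : ℝ, ∀ ht : t ∈ timeRay T,
    U ⟨t, subset_closure ht⟩ =ᵐ[muSpace m α] fun x => u (t, x)

end WeightedParabolic

end

open MeasureTheory Set Filter Topology
open scoped ContDiff Matrix BoundedContinuousFunction ENNReal NNReal

noncomputable section

namespace WeightedParabolic

/-! ### The weighted measures -/

section Measures

variable {m : ℕ} {α : ℝ} {T : EReal}

/-! The proof is an energy method. Since `u_t` exists only as a functional, `u` cannot be tested
with itself; time translation takes the place of that step.

Write `w = (u, Du)` for the jet of a weak solution and `L = (√λ f - λ C₀ u, F^i - A^{ij} D_j u)` for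
the `L_2` field that represents `x_d^α a₀ u_t` on test functions. If `φ` is a test function and `s ≥
0`, so is `φ(t + s, x)`, and the derivative in `s` of `∫ a₀ u · φ(t + s)` is minus the pairing of
`L` with the jet of `φ(t + s)`. Integrated in `s`, this identity is continuous in the `L_2` norm of
the jet of `φ`, so it holds on the closure of the test jets. That closure contains `w`, extended by
zero for `t ≥ T` (`exists_test_eLpNorm_sub_le`, `extZero_jet_mem_closure`). Hence `∫ a₀ u · u(t +
s)` has right derivative `-∫ L · w` at `s = 0` (`hasDerivWithinAt_inner_shiftL2`). As `a₀` is
symmetric and independent of `t`, polarization shows that the nonnegative quantity `∫ a₀ (u - u(t +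
s)) · (u - u(t + s))` has right derivative `2 ∫ L · w`.

Two inequalities follow. First, `∫ L · w ≥ 0` (`EnergyData.integral_nonneg`). Secondly, cut
everything off at a time `τ`: on the last slab of width `h` the translate vanishes, so the increment
there is `u` itself, and `∫ a₀ u · u` at time `τ` is at most `2 ∫ L · w` over `t < τ`
(`EnergyData.ae_energy_le`). Ellipticity and Young's inequality bound `L · w` from above; this gives
the estimate, and with `λ > 0` uniqueness. The second inequality, applied to `u(t) - u(t - h)`,
yields a modulus of continuity in time and with it the continuous version.

Density rests on a mollifier that samples only earlier times and larger `x_d`, so it needs no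
extension of `u` across `t = T` or `x_d = 0`. It is bounded on `L_2(μ)` uniformly in its scale for
every `α > -1` (`exists_lintegral_weight_le`).

Existence comes from Lions' form of the Lax–Milgram lemma. The adjoint operator is coercive on test
functions because `∫ a₀ φ · φ_t = 0`, and the solution is found inside the closure of the test jets,
so that its last components are the weak gradient of its first. -/

lemma isOpen_timeRay (T : EReal) : IsOpen (timeRay T) :=
  isOpen_lt continuous_coe_real_ereal continuous_const

lemma timeRay_mono {S T : EReal} (h : S ≤ T) : timeRay S ⊆ timeRay T :=
  fun _ ht => lt_of_lt_of_le ht h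

@[simp] lemma timeRay_top : timeRay ⊤ = univ := by
  ext t; simp [timeRay]

@[simp] lemma timeRay_coe (τ : ℝ) : timeRay (τ : EReal) = Iio τ := by
  ext t; simp [timeRay]

lemma isOpen_halfSpace (m : ℕ) : IsOpen (halfSpace m) :=
  isOpen_lt continuous_const (by fun_prop)

lemma isOpen_cyl (m : ℕ) (T : EReal) : IsOpen (cyl m T) :=
  (isOpen_timeRay T).prod (isOpen_halfSpace m)

lemma measurable_weight (m : ℕ) (α : ℝ) :
    Measurable fun x : Sp m => ENNReal.ofReal (x (Fin.last m) ^ α) := by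
  have : Measurable fun x : Sp m => x (Fin.last m) := by fun_prop
  fun_prop

instance instSFiniteMuSpace (m : ℕ) (α : ℝ) : SFinite (muSpace m α) := by
  unfold muSpace; infer_instance

lemma muCyl_eq_prod (m : ℕ) (α : ℝ) (T : EReal) :
    muCyl m α T = (volume.restrict (timeRay T)).prod (muSpace m α) := by
  unfold muSpace muCyl cyl
  rw [prod_withDensity_right (measurable_weight m α), Measure.prod_restrict]
  rfl

lemma muCyl_eq_restrict (m : ℕ) (α : ℝ) (T : EReal) :
    muCyl m α T = (muCyl m α ⊤).restrict (timeRay T ×ˢ univ) := by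
  rw [muCyl_eq_prod, muCyl_eq_prod, timeRay_top, Measure.restrict_univ]
  conv_rhs => rw [← Measure.prod_restrict, Measure.restrict_univ]

lemma muCyl_restrict_of_le {S T : EReal} (h : S ≤ T) :
    (muCyl m α T).restrict (timeRay S ×ˢ univ) = muCyl m α S := by
  rw [muCyl_eq_restrict m α T, muCyl_eq_restrict m α S,
    Measure.restrict_restrict ((isOpen_timeRay S).prod isOpen_univ).measurableSet]
  congr 1
  ext z
  simpa using fun hz => timeRay_mono h hz

lemma measurableSet_ray (m : ℕ) (T : EReal) :
    MeasurableSet (timeRay T ×ˢ (univ : Set (Sp m))) :=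
  ((isOpen_timeRay T).prod isOpen_univ).measurableSet

lemma muCyl_absolutelyContinuous (m : ℕ) (α : ℝ) (T : EReal) :
    muCyl m α T ≪ volume.restrict (cyl m T) :=
  withDensity_absolutelyContinuous _ _

lemma muSpace_absolutelyContinuous (m : ℕ) (α : ℝ) :
    muSpace m α ≪ volume.restrict (halfSpace m) :=
  withDensity_absolutelyContinuous _ _

lemma measurable_weight_cyl (m : ℕ) (α : ℝ) :
    Measurable fun z : ℝ × Sp m => ENNReal.ofReal (z.2 (Fin.last m) ^ α) :=
  (measurable_weight m α).comp measurable_snd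

lemma volume_absolutelyContinuous_muCyl (m : ℕ) (α : ℝ) (T : EReal) :
    volume.restrict (cyl m T) ≪ muCyl m α T := by
  refine withDensity_absolutelyContinuous' (measurable_weight_cyl m α).aemeasurable ?_
  filter_upwards [ae_restrict_mem (isOpen_cyl m T).measurableSet] with z hz
  have : 0 < z.2 (Fin.last m) := hz.2
  simpa using Real.rpow_pos_of_pos this α

lemma ae_mem_cyl (m : ℕ) (α : ℝ) (T : EReal) : ∀ᵐ z ∂(muCyl m α T), z ∈ cyl m T :=
  (muCyl_absolutelyContinuous m α T).ae_le (ae_restrict_mem (isOpen_cyl m T).measurableSet)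

/-- The density is dominated by a product of functions of one variable, and `s ^ α` is integrable at
`0` because `α > -1`. That assumption enters the theorem only through this bound and the local
finiteness it implies. -/
lemma muSpace_box_lt_top (hα : -1 < α) (R : ℝ) :
    muSpace m α {x | ∀ i, |x i| ≤ R} < ⊤ := by
  let g : Fin (m + 1) → ℝ → ℝ := fun i =>
    if i = Fin.last m then (Ioc 0 R).indicator (fun s => s ^ α)
    else (Icc (-R) R).indicator (fun _ => 1)
  have hg : ∀ i, Integrable (g i) volume := by
    intro i
    by_cases hi : i = Fin.last m
    · simp only [g, hi, if_true]
      rw [integrable_indicator_iff measurableSet_Ioc]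
      rcases le_or_gt 0 R with hR | hR
      · exact (intervalIntegrable_iff_integrableOn_Ioc_of_le hR).1
          (intervalIntegral.intervalIntegrable_rpow' hα)
      · simp [Ioc_eq_empty (not_lt.2 hR.le)]
    · simp only [g, hi, if_false]
      rw [integrable_indicator_iff measurableSet_Icc]
      exact integrableOn_const (by simp)
  have hG : Integrable (fun x : Fin (m + 1) → ℝ => ∏ i, g i (x i)) :=
    Integrable.fintype_prod hg
  have hG' : Integrable (fun x : Sp m => ∏ i, g i (x i)) :=
    (EuclideanSpace.volume_preserving_symm_measurableEquiv_toLp (Fin (m + 1))).integrable_comp_of_integrable hG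
  have hS : MeasurableSet {x : Sp m | ∀ i, |x i| ≤ R} := by
    have : {x : Sp m | ∀ i, |x i| ≤ R} = ⋂ i, {x : Sp m | |x i| ≤ R} := by ext; simp
    rw [this]
    exact MeasurableSet.iInter fun i =>
      (isClosed_le (f := fun x : Sp m => |x i|) (by fun_prop) continuous_const).measurableSet
  unfold muSpace
  rw [withDensity_apply _ hS, Measure.restrict_restrict hS]
  refine lt_of_le_of_lt ?_ hG'.lintegral_lt_top
  refine (setLIntegral_mono' (hS.inter (isOpen_halfSpace m).measurableSet)
    (g := fun x : Sp m => ENNReal.ofReal (∏ i, g i (x i))) ?_).trans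
      (setLIntegral_le_lintegral _ _)
  rintro x ⟨hx, hx0⟩
  have hx0 : 0 < x (Fin.last m) := hx0
  refine le_of_eq (congrArg _ ?_)
  rw [Finset.prod_eq_single (Fin.last m)]
  · simp only [g, if_true]
    rw [indicator_of_mem]
    exact ⟨hx0, (le_abs_self _).trans (hx _)⟩
  · intro i _ hi
    simp only [g, hi, if_false]
    rw [indicator_of_mem]
    exact abs_le.1 (hx i)
  · simp

lemma isLocallyFinite_muSpace (hα : -1 < α) : IsLocallyFiniteMeasure (muSpace m α) := by
  refine ⟨fun x => ⟨Metric.ball x 1, Metric.ball_mem_nhds x one_pos, ?_⟩⟩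
  refine lt_of_le_of_lt (measure_mono ?_) (muSpace_box_lt_top hα (‖x‖ + 1))
  intro y hy i
  have h1 : |y i| ≤ ‖y‖ := by simpa using PiLp.norm_apply_le y i
  have h2 : ‖y‖ ≤ ‖x‖ + 1 := by
    have := norm_le_norm_add_norm_sub' y x
    have h3 : ‖y - x‖ < 1 := by simpa [dist_eq_norm] using hy
    linarith
  exact h1.trans h2

lemma isLocallyFinite_muCyl (hα : -1 < α) (T : EReal) : IsLocallyFiniteMeasure (muCyl m α T) := by
  have := isLocallyFinite_muSpace (m := m) hα
  rw [muCyl_eq_prod]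
  infer_instance

instance instIsLocallyFiniteMeasureMuCyl [IsLocallyFiniteMeasure (muCyl m α ⊤)] :
    IsLocallyFiniteMeasure (muCyl m α T) := by
  rw [muCyl_eq_restrict]
  infer_instance

/-- Translation by `s` in the time variable. -/
def shift (m : ℕ) (s : ℝ) (z : ℝ × Sp m) : ℝ × Sp m := (z.1 + s, z.2)

lemma continuous_shift (s : ℝ) : Continuous (shift m s) := by
  unfold shift; fun_prop

/-- The weight depends on `x` alone. Invariance needs the whole time axis, which is why fields on
`Ω_T` are later extended by zero. -/
lemma measurePreserving_shift (α : ℝ) (s : ℝ) :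
    MeasurePreserving (shift m s) (muCyl m α ⊤) (muCyl m α ⊤) := by
  rw [muCyl_eq_prod, timeRay_top, Measure.restrict_univ]
  exact (measurePreserving_add_right volume s).prod (MeasurePreserving.id _)

end Measures

/-! ### Jets and test functions -/

/-- Values of `(u, D_1 u, …, D_d u)`, with the Euclidean norm; the index `none` stands for `u`. -/
abbrev Jet (m n : ℕ) := PiLp 2 fun _ : Option (Fin (m + 1)) => Val n

/-- The field `z ↦ (u z, Du z)`. -/
def mkJet {m n : ℕ} (u : ℝ × Sp m → Val n) (Du : Fin (m + 1) → ℝ × Sp m → Val n)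
    (z : ℝ × Sp m) : Jet m n :=
  WithLp.toLp 2 fun o => o.elim (u z) fun i => Du i z

/-- The field `z ↦ (φ z, Dφ z)` of a smooth function. -/
def jet {m n : ℕ} (φ : ℝ × Sp m → Val n) : ℝ × Sp m → Jet m n :=
  mkJet φ fun i => dx i φ

section Algebra

variable {m n : ℕ}

@[simp] lemma mkJet_none (u : ℝ × Sp m → Val n) (Du : Fin (m + 1) → ℝ × Sp m → Val n)
    (z : ℝ × Sp m) : mkJet u Du z none = u z := rfl

@[simp] lemma mkJet_some (u : ℝ × Sp m → Val n) (Du : Fin (m + 1) → ℝ × Sp m → Val n)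
    (z : ℝ × Sp m) (i : Fin (m + 1)) : mkJet u Du z (some i) = Du i z := rfl

@[simp] lemma jet_none (φ : ℝ × Sp m → Val n) (z : ℝ × Sp m) : jet φ z none = φ z := rfl

@[simp] lemma jet_some (φ : ℝ × Sp m → Val n) (z : ℝ × Sp m) (i : Fin (m + 1)) :
    jet φ z (some i) = dx i φ z := rfl

lemma jet_inner (v w : Jet m n) :
    inner ℝ v w = (∑ i : Fin (m + 1), inner ℝ (v (some i)) (w (some i)))
      + inner ℝ (v none) (w none) := by
  rw [PiLp.inner_apply, Fintype.sum_option, add_comm]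

lemma jet_norm_sq (v : Jet m n) :
    ‖v‖ ^ 2 = (∑ i : Fin (m + 1), ‖v (some i)‖ ^ 2) + ‖v none‖ ^ 2 := by
  rw [PiLp.norm_sq_eq_of_L2, Fintype.sum_option, add_comm]

lemma memLp_mkJet {μ : Measure (ℝ × Sp m)} {p : ℝ≥0∞} {u : ℝ × Sp m → Val n}
    {Du : Fin (m + 1) → ℝ × Sp m → Val n} (hu : MemLp u p μ) (hDu : ∀ i, MemLp (Du i) p μ) :
    MemLp (mkJet u Du) p μ := by
  refine MemLp.of_eval_piLp fun o => ?_
  cases o with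
  | none => exact hu
  | some i => exact hDu i

lemma memLp_jet_apply {μ : Measure (ℝ × Sp m)} {p : ℝ≥0∞} {w : ℝ × Sp m → Jet m n}
    (hw : MemLp w p μ) (o : Option (Fin (m + 1))) : MemLp (fun z => w z o) p μ :=
  MemLp.eval_piLp hw o

end Algebra

/-! ### Test functions, their time translates and their jets. -/

section Tests

variable {m n : ℕ} {V : Type*} [NormedAddCommGroup V] [NormedSpace ℝ V]
  {O : Set (ℝ × Sp m)} {φ ψ : ℝ × Sp m → V}

lemma IsTest.mono {O' : Set (ℝ × Sp m)} (h : IsTest O φ) (hO : O ⊆ O') : IsTest O' φ :=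
  ⟨h.1, h.2.1, h.2.2.trans hO⟩

lemma IsTest.add (hφ : IsTest O φ) (hψ : IsTest O ψ) : IsTest O (φ + ψ) :=
  ⟨hφ.1.add hψ.1, hφ.2.1.add hψ.2.1,
    (tsupport_add φ ψ).trans (union_subset hφ.2.2 hψ.2.2)⟩

lemma IsTest.const_smul (c : ℝ) (hφ : IsTest O φ) : IsTest O (c • φ) :=
  ⟨hφ.1.const_smul c, hφ.2.1.smul_left (f := fun _ => c),
    (tsupport_smul_subset_right (fun _ => c) φ).trans hφ.2.2⟩

lemma isTest_zero : IsTest O (0 : ℝ × Sp m → V) :=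
  ⟨contDiff_const, HasCompactSupport.zero, by simp [tsupport]⟩

lemma IsTest.differentiable (hφ : IsTest O φ) : Differentiable ℝ φ :=
  hφ.1.differentiable (by simp)

lemma IsTest.continuous_fderiv_apply (hφ : IsTest O φ) (v : ℝ × Sp m) :
    Continuous fun z => fderiv ℝ φ z v :=
  (hφ.1.continuous_fderiv (by simp)).clm_apply continuous_const

lemma support_fderiv_apply_subset (v : ℝ × Sp m) :
    Function.support (fun z => fderiv ℝ φ z v) ⊆ tsupport φ := by
  intro z hz
  refine support_fderiv_subset ℝ (f := φ) ?_
  intro h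
  exact hz (by simp [h])

lemma IsTest.hasCompactSupport_fderiv_apply (hφ : IsTest O φ) (v : ℝ × Sp m) :
    HasCompactSupport fun z => fderiv ℝ φ z v :=
  hφ.2.1.mono' (support_fderiv_apply_subset v)

lemma IsTest.eq_zero_of_notMem (hφ : IsTest O φ) {z : ℝ × Sp m} (hz : z ∉ O) : φ z = 0 :=
  image_eq_zero_of_notMem_tsupport fun h => hz (hφ.2.2 h)

lemma IsTest.fderiv_apply_eq_zero (hφ : IsTest O φ) (v : ℝ × Sp m) {z : ℝ × Sp m}
    (hz : z ∉ O) : fderiv ℝ φ z v = 0 := by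
  by_contra h
  exact hz (hφ.2.2 (support_fderiv_apply_subset v h))

lemma fderiv_comp_shift (s : ℝ) (z v : ℝ × Sp m) :
    fderiv ℝ (φ ∘ shift m s) z v = fderiv ℝ φ (shift m s z) v := by
  have : φ ∘ shift m s = fun z => φ (z + (s, 0)) := by
    ext z; simp [shift, Prod.add_def]
  rw [this, fderiv_comp_add_right]
  simp [shift, Prod.add_def]

/-- For `s ≥ 0` the support moves into the past and stays below `T`. Negative `s` may push it past
`T`, so derivatives along translations are one-sided. -/
lemma IsTest.shift {T : EReal} (hφ : IsTest (timeRay T ×ˢ univ) φ) {s : ℝ} (hs : 0 ≤ s) :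
    IsTest (timeRay T ×ˢ univ) (φ ∘ shift m s) := by
  have hsh : ContDiff ℝ ∞ (WeightedParabolic.shift m s) := by
    unfold WeightedParabolic.shift; fun_prop
  have heq : WeightedParabolic.shift m s = Homeomorph.addRight ((s, 0) : ℝ × Sp m) := by
    ext z <;> simp [WeightedParabolic.shift]
  refine ⟨hφ.1.comp hsh, ?_, ?_⟩
  · rw [heq]; exact hφ.2.1.comp_homeomorph _
  · intro z hz
    have h1 : WeightedParabolic.shift m s z ∈ tsupport φ :=
      tsupport_comp_subset_preimage φ hsh.continuous hz
    have h2 : (((WeightedParabolic.shift m s z).1 : ℝ) : EReal) < T := (hφ.2.2 h1).1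
    refine ⟨lt_of_le_of_lt ?_ h2, mem_univ _⟩
    exact EReal.coe_le_coe_iff.2 (by simpa [WeightedParabolic.shift] using hs)

lemma dx_comp_shift (i : Fin (m + 1)) (s : ℝ) (z : ℝ × Sp m) :
    dx i (φ ∘ shift m s) z = dx i φ (shift m s z) :=
  fderiv_comp_shift s z _

lemma dt_comp_shift (s : ℝ) (z : ℝ × Sp m) :
    dt (φ ∘ shift m s) z = dt φ (shift m s z) :=
  fderiv_comp_shift s z _

lemma jet_comp_shift {φ : ℝ × Sp m → Val n} (s : ℝ) :
    jet (φ ∘ shift m s) = jet φ ∘ shift m s := by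
  ext z o
  cases o with
  | none => rfl
  | some i => simp [dx_comp_shift]

lemma jet_eq_zero_of_notMem {φ : ℝ × Sp m → Val n} (hφ : IsTest O φ) {z : ℝ × Sp m}
    (hz : z ∉ O) : jet φ z = 0 := by
  ext1 o
  cases o with
  | none => exact hφ.eq_zero_of_notMem hz
  | some i => exact hφ.fderiv_apply_eq_zero _ hz

lemma IsTest.memLp_fderiv_apply (hφ : IsTest O φ) (μ : Measure (ℝ × Sp m))
    [IsFiniteMeasureOnCompacts μ] (v : ℝ × Sp m) :
    MemLp (fun z => fderiv ℝ φ z v) 2 μ :=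
  (hφ.continuous_fderiv_apply v).memLp_of_hasCompactSupport (hφ.hasCompactSupport_fderiv_apply v)

lemma IsTest.memLp (hφ : IsTest O φ) (μ : Measure (ℝ × Sp m))
    [IsFiniteMeasureOnCompacts μ] : MemLp φ 2 μ :=
  hφ.1.continuous.memLp_of_hasCompactSupport hφ.2.1

lemma IsTest.memLp_jet {φ : ℝ × Sp m → Val n} (hφ : IsTest O φ) (μ : Measure (ℝ × Sp m))
    [IsFiniteMeasureOnCompacts μ] : MemLp (jet φ) 2 μ :=
  memLp_mkJet (hφ.memLp μ) fun _ => hφ.memLp_fderiv_apply μ _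

/-- The space `C_0^∞((-∞, T) × ℝ^d)^n`. -/
def testSpace (m n : ℕ) (T : EReal) : Submodule ℝ (ℝ × Sp m → Val n) where
  carrier := {φ | IsTest (timeRay T ×ˢ univ) φ}
  add_mem' := IsTest.add
  zero_mem' := isTest_zero
  smul_mem' c _ h := h.const_smul c

lemma jet_add {φ ψ : ℝ × Sp m → Val n} (hφ : Differentiable ℝ φ) (hψ : Differentiable ℝ ψ) :
    jet (φ + ψ) = jet φ + jet ψ := by
  ext z o
  cases o with
  | none => rfl
  | some i => simp [dx, fderiv_add (hφ z) (hψ z)]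

lemma jet_const_smul {φ : ℝ × Sp m → Val n} (hφ : Differentiable ℝ φ) (c : ℝ) :
    jet (c • φ) = c • jet φ := by
  ext z o
  cases o with
  | none => rfl
  | some i => simp [dx, fderiv_const_smul (hφ z)]

end Tests

section Hilbert

variable {X : Type*} [MeasurableSpace X] {μ : Measure X} {E : Type*} [NormedAddCommGroup E]
  [InnerProductSpace ℝ E]

lemma inner_toLp {f g : X → E} (hf : MemLp f 2 μ) (hg : MemLp g 2 μ) :
    inner ℝ (hf.toLp f) (hg.toLp g) = ∫ x, inner ℝ (f x) (g x) ∂μ := by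
  rw [L2.inner_def]
  refine integral_congr_ae ?_
  filter_upwards [hf.coeFn_toLp, hg.coeFn_toLp] with x h1 h2
  rw [h1, h2]

lemma integrable_inner_of_memLp {f g : X → E} (hf : MemLp f 2 μ) (hg : MemLp g 2 μ) :
    Integrable (fun x => inner ℝ (f x) (g x)) μ := by
  refine (L2.integrable_inner (𝕜 := ℝ) (hf.toLp f) (hg.toLp g)).congr ?_
  filter_upwards [hf.coeFn_toLp, hg.coeFn_toLp] with x h1 h2
  rw [h1, h2]

lemma norm_sq_toLp {f : X → E} (hf : MemLp f 2 μ) :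
    ‖hf.toLp f‖ ^ 2 = ∫ x, ‖f x‖ ^ 2 ∂μ := by
  rw [← real_inner_self_eq_norm_sq, inner_toLp]
  simp

end Hilbert

/-- The Hilbert space `L_2(ℝ × ℝ^d_+, μ)` of jet fields. -/
abbrev JetL2 (m n : ℕ) (α : ℝ) := Lp (Jet m n) 2 (muCyl m α ⊤)

section TestJets

variable {m n : ℕ} {α : ℝ} {T : EReal}

/-- The map `φ ↦ (φ, Dφ)` from test functions to `L_2`. -/
def testJet (m n : ℕ) (α : ℝ) (T : EReal) [IsLocallyFiniteMeasure (muCyl m α ⊤)] :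
    testSpace m n T →ₗ[ℝ] JetL2 m n α where
  toFun φ := (IsTest.memLp_jet φ.2 (muCyl m α ⊤)).toLp _
  map_add' φ ψ := by
    rw [← MemLp.toLp_add]
    exact MemLp.toLp_congr _ _ (by
      rw [Submodule.coe_add, jet_add (IsTest.differentiable φ.2) (IsTest.differentiable ψ.2)])
  map_smul' c φ := by
    rw [RingHom.id_apply, ← MemLp.toLp_const_smul]
    exact MemLp.toLp_congr _ _ (by
      rw [Submodule.coe_smul, jet_const_smul (IsTest.differentiable φ.2)])

lemma testJet_apply [IsLocallyFiniteMeasure (muCyl m α ⊤)] (φ : testSpace m n T) :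
    testJet m n α T φ = (IsTest.memLp_jet φ.2 (muCyl m α ⊤)).toLp _ := rfl

/-- Translation in time, as an isometry of `L_2`. -/
def shiftL2 (m n : ℕ) (α : ℝ) (s : ℝ) : JetL2 m n α →ₗᵢ[ℝ] JetL2 m n α :=
  Lp.compMeasurePreservingₗᵢ ℝ (shift m s) (measurePreserving_shift α s)

lemma shiftL2_toLp {w : ℝ × Sp m → Jet m n} (hw : MemLp w 2 (muCyl m α ⊤)) (s : ℝ) :
    shiftL2 m n α s (hw.toLp w)
      = (hw.comp_measurePreserving (measurePreserving_shift α s)).toLp _ := rfl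

/-- Joint continuity lets time integrals of translates pass to limits in the jet. -/
lemma continuous_shiftL2 [IsLocallyFiniteMeasure (muCyl m α ⊤)] :
    Continuous fun p : JetL2 m n α × ℝ => shiftL2 m n α p.2 p.1 := by
  refine Continuous.compMeasurePreservingLp (μ := muCyl m α ⊤) (ν := muCyl m α ⊤)
    (f := fun p : JetL2 m n α × ℝ => p.1)
    (g := fun p : JetL2 m n α × ℝ => (⟨shift m p.2, continuous_shift p.2⟩ : C(ℝ × Sp m, ℝ × Sp m)))
    continuous_fst ?_ (fun p => measurePreserving_shift α p.2) (by simp)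
  refine ContinuousMap.continuous_of_continuous_uncurry _ ?_
  simp only [Function.uncurry_def, ContinuousMap.coe_mk, shift]
  fun_prop

lemma continuous_inner_shiftL2 [IsLocallyFiniteMeasure (muCyl m α ⊤)] (v : JetL2 m n α) :
    Continuous fun p : JetL2 m n α × ℝ => inner ℝ v (shiftL2 m n α p.2 p.1) := by
  exact Continuous.inner (𝕜 := ℝ) (f := fun _ => v)
    (g := fun p : JetL2 m n α × ℝ => shiftL2 m n α p.2 p.1) continuous_const continuous_shiftL2

lemma shiftL2_zero (w : JetL2 m n α) : shiftL2 m n α 0 w = w := by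
  have h : shift m 0 = id := by ext z <;> simp [shift]
  have h2 : w = (Lp.memLp w).toLp _ := (Lp.toLp_coeFn w _).symm
  rw [h2, shiftL2_toLp]
  exact MemLp.toLp_congr _ _ (by rw [h]; rfl)

end TestJets

/-! ### Differentiating along time translations -/

/-- The jet field with zeroth component `b` and vanishing gradient components. -/
def liftJet {m n : ℕ} (b : ℝ × Sp m → Val n) : ℝ × Sp m → Jet m n :=
  mkJet b fun _ _ => 0

section TimeDerivative

variable {m n : ℕ} {α : ℝ} {T : EReal}

lemma memLp_liftJet {μ : Measure (ℝ × Sp m)} {b : ℝ × Sp m → Val n} (hb : MemLp b 2 μ) :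
    MemLp (liftJet b) 2 μ :=
  memLp_mkJet hb fun _ => MemLp.zero

@[simp] lemma inner_liftJet (b : ℝ × Sp m → Val n) (z : ℝ × Sp m) (w : Jet m n) :
    inner ℝ (liftJet b z) w = inner ℝ (b z) (w none) := by
  simp [jet_inner, liftJet]

lemma hasDerivAt_comp_shift {φ : ℝ × Sp m → Val n} (hφ : Differentiable ℝ φ) (z : ℝ × Sp m)
    (s : ℝ) : HasDerivAt (fun s => φ (shift m s z)) (dt φ (shift m s z)) s := by
  have h1 : HasDerivAt (fun s => shift m s z) ((1 : ℝ), (0 : Sp m)) s :=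
    ((hasDerivAt_id s).const_add z.1).prodMk (hasDerivAt_const s z.2)
  exact (hφ (shift m s z)).hasFDerivAt.comp_hasDerivAt s h1

lemma hasDerivAt_integral_shift [IsLocallyFiniteMeasure (muCyl m α ⊤)]
    {b : ℝ × Sp m → Val n} (hb : MemLp b 2 (muCyl m α ⊤))
    {O : Set (ℝ × Sp m)} {φ : ℝ × Sp m → Val n} (hφ : IsTest O φ) (s₀ : ℝ) :
    HasDerivAt (fun s => ∫ z, inner ℝ (b z) (φ (shift m s z)) ∂(muCyl m α ⊤))
      (∫ z, inner ℝ (b z) (dt φ (shift m s₀ z)) ∂(muCyl m α ⊤)) s₀ := by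
  obtain ⟨C, hC⟩ := (hφ.continuous_fderiv_apply (1, 0)).bounded_above_of_compact_support
    (hφ.hasCompactSupport_fderiv_apply (1, 0))
  -- A compact set that contains the supports of all translates with `|s - s₀| ≤ 1`, so that one
  -- function `‖b‖ · C 1_K` dominates the derivatives.
  let K : Set (ℝ × Sp m) :=
    (fun p : (ℝ × Sp m) × ℝ => shift m (-p.2) p.1) '' (tsupport φ ×ˢ Icc (s₀ - 1) (s₀ + 1))
  have hK : IsCompact K := (hφ.2.1.isCompact.prod isCompact_Icc).image (by unfold shift; fun_prop)
  have hmem : ∀ z s, s ∈ Metric.ball s₀ 1 → z ∉ K → dt φ (shift m s z) = 0 := by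
    intro z s hs hz
    by_contra h
    refine hz ⟨(shift m s z, s), ⟨support_fderiv_apply_subset (1, 0) h, ?_⟩, ?_⟩
    · rw [Real.ball_eq_Ioo] at hs; exact ⟨hs.1.le, hs.2.le⟩
    · simp [shift]
  have hCK : MemLp (K.indicator fun _ : ℝ × Sp m => C) 2 (muCyl m α ⊤) :=
    memLp_indicator_const 2 hK.measurableSet C (Or.inr hK.measure_lt_top.ne)
  have hsh : ∀ s, MemLp (fun z => φ (shift m s z)) 2 (muCyl m α ⊤) := fun s =>
    (hφ.memLp (muCyl m α ⊤)).comp_measurePreserving (measurePreserving_shift α s)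
  have hsh' : ∀ s, MemLp (fun z => dt φ (shift m s z)) 2 (muCyl m α ⊤) := fun s =>
    (hφ.memLp_fderiv_apply (muCyl m α ⊤) (1, 0)).comp_measurePreserving (measurePreserving_shift α s)
  refine (hasDerivAt_integral_of_dominated_loc_of_deriv_le
    (F := fun s z => inner ℝ (b z) (φ (shift m s z)))
    (F' := fun s z => inner ℝ (b z) (dt φ (shift m s z)))
    (bound := fun z => ‖b z‖ * K.indicator (fun _ => C) z)
    (Metric.ball_mem_nhds s₀ one_pos) (.of_forall fun s => ?_) ?_ ?_ ?_ ?_ ?_).2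
  · exact (integrable_inner_of_memLp hb (hsh s)).aestronglyMeasurable
  · exact integrable_inner_of_memLp hb (hsh s₀)
  · exact (integrable_inner_of_memLp hb (hsh' s₀)).aestronglyMeasurable
  · refine .of_forall fun z s hs => ?_
    refine (norm_inner_le_norm _ _).trans ?_
    refine mul_le_mul_of_nonneg_left ?_ (norm_nonneg _)
    by_cases hz : z ∈ K
    · rw [indicator_of_mem hz]; exact hC _
    · rw [indicator_of_notMem hz, hmem z s hs hz, norm_zero]
  · exact hb.norm.integrable_mul hCK
  · refine .of_forall fun z s hs => ?_
    exact (innerSL ℝ (b z)).hasFDerivAt.comp_hasDerivAt s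
      (hasDerivAt_comp_shift hφ.differentiable z s)

variable [IsLocallyFiniteMeasure (muCyl m α ⊤)]

lemma inner_liftJet_shiftL2 {b : ℝ × Sp m → Val n} (hb : MemLp b 2 (muCyl m α ⊤))
    (φ : testSpace m n T) (s : ℝ) :
    inner ℝ ((memLp_liftJet hb).toLp _) (shiftL2 m n α s (testJet m n α T φ))
      = ∫ z, inner ℝ (b z) ((φ : ℝ × Sp m → Val n) (shift m s z)) ∂(muCyl m α ⊤) := by
  rw [testJet_apply, shiftL2_toLp, inner_toLp]
  simp

/-- If `L` represents the time derivative of `b`, then pairing `b` with the translates of a jet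
field in the closure of the test functions is differentiable from the right at `0`. -/
theorem hasDerivWithinAt_inner_shiftL2 {b : ℝ × Sp m → Val n} (hb : MemLp b 2 (muCyl m α ⊤))
    {L : ℝ × Sp m → Jet m n} (hL : MemLp L 2 (muCyl m α ⊤))
    (hbL : ∀ φ : ℝ × Sp m → Val n, IsTest (timeRay T ×ˢ univ) φ →
      - ∫ z, inner ℝ (b z) (dt φ z) ∂(muCyl m α ⊤) = ∫ z, inner ℝ (L z) (jet φ z) ∂(muCyl m α ⊤))
    {w : JetL2 m n α} (hw : w ∈ closure (range (testJet m n α T))) :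
    HasDerivWithinAt (fun s => inner ℝ ((memLp_liftJet hb).toLp _) (shiftL2 m n α s w))
      (- inner ℝ (hL.toLp L) w) (Ici 0) 0 := by
  have hcont : Continuous fun p : JetL2 m n α × ℝ =>
      inner ℝ (hL.toLp L) (shiftL2 m n α p.2 p.1) :=
    continuous_inner_shiftL2 _
  have hcont' : ∀ v, Continuous fun s => inner ℝ (hL.toLp L) (shiftL2 m n α s v) := fun v =>
    Continuous.comp (g := fun p : JetL2 m n α × ℝ => inner ℝ (hL.toLp L) (shiftL2 m n α p.2 p.1))
      (f := fun s : ℝ => (v, s)) hcont (by fun_prop)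
  -- Both sides of the integrated identity are continuous in `w`, so it passes from test jets to
  -- their closure; the differential identity would not.
  have key : ∀ h : ℝ, 0 ≤ h →
      inner ℝ ((memLp_liftJet hb).toLp _) (shiftL2 m n α h w)
        = inner ℝ ((memLp_liftJet hb).toLp _) w
          - ∫ s in (0 : ℝ)..h, inner ℝ (hL.toLp L) (shiftL2 m n α s w) := by
    intro h hh
    have hclosed : IsClosed {v : JetL2 m n α |
        inner ℝ ((memLp_liftJet hb).toLp _) (shiftL2 m n α h v)
        = inner ℝ ((memLp_liftJet hb).toLp _) v
          - ∫ s in (0 : ℝ)..h, inner ℝ (hL.toLp L) (shiftL2 m n α s v)} := by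
      refine isClosed_eq ?_ ?_
      · exact (innerSL ℝ ((memLp_liftJet hb).toLp _)).continuous.comp (shiftL2 m n α h).continuous
      · exact (innerSL ℝ ((memLp_liftJet hb).toLp _)).continuous.sub
          (intervalIntegral.continuous_parametric_intervalIntegral_of_continuous' hcont 0 h)
    refine closure_minimal ?_ hclosed hw
    rintro _ ⟨φ, rfl⟩
    have hφ : IsTest (timeRay T ×ˢ univ) (φ : ℝ × Sp m → Val n) := φ.2
    have hder : ∀ s ∈ uIcc 0 h, HasDerivAt
        (fun s => ∫ z, inner ℝ (b z) ((φ : ℝ × Sp m → Val n) (shift m s z)) ∂(muCyl m α ⊤))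
        (- inner ℝ (hL.toLp L) (shiftL2 m n α s (testJet m n α T φ))) s := by
      intro s hs
      rw [uIcc_of_le hh] at hs
      convert hasDerivAt_integral_shift hb hφ s using 1
      -- The representation of the time derivative is applied to the translate, a legitimate test
      -- function because `s ≥ 0`.
      have h1 := hbL _ (hφ.shift hs.1)
      simp only [dt_comp_shift] at h1
      rw [testJet_apply, shiftL2_toLp, inner_toLp, ← neg_eq_iff_eq_neg.2 h1.symm]
      simp [jet_comp_shift]
    have hintg := intervalIntegral.integral_eq_sub_of_hasDerivAt hder
      ((hcont' _).neg.intervalIntegrable 0 h)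
    rw [intervalIntegral.integral_neg] at hintg
    rw [mem_ofPred_eq, inner_liftJet_shiftL2 hb φ h]
    have h0 := inner_liftJet_shiftL2 hb φ 0
    rw [shiftL2_zero] at h0
    rw [h0]
    linarith
  have hftc : HasDerivAt (fun h => inner ℝ ((memLp_liftJet hb).toLp _) w
      - ∫ s in (0 : ℝ)..h, inner ℝ (hL.toLp L) (shiftL2 m n α s w))
      (- inner ℝ (hL.toLp L) w) 0 := by
    have := intervalIntegral.integral_hasDerivAt_right ((hcont' w).intervalIntegrable 0 0)
      ((hcont' w).stronglyMeasurableAtFilter _ _) (hcont' w).continuousAt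
    simpa [shiftL2_zero] using this.const_sub (inner ℝ ((memLp_liftJet hb).toLp _) w)
  refine hftc.hasDerivWithinAt.congr (fun s hs => key s hs) (key 0 le_rfl)

end TimeDerivative

/-! ### One-sided mollification -/

/-- The centre of the mollification kernel: convolution looks into the past and away from the
boundary of the half-space. -/
def kernelCenter (m : ℕ) : ℝ × Sp m := (2, EuclideanSpace.single (Fin.last m) (-2))

/-- The bump function that underlies the mollification kernel. -/
def kernelBump (m : ℕ) : ContDiffBump (kernelCenter m) := ⟨1 / 2, 1, by norm_num, by norm_num⟩

/-- A smooth probability density supported in the unit ball about `kernelCenter`. -/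
def kernel (m : ℕ) : ℝ × Sp m → ℝ := (kernelBump m).normed volume

/-- The probability measure with density `kernel`. -/
def kernelMeasure (m : ℕ) : Measure (ℝ × Sp m) :=
  volume.withDensity fun η => ENNReal.ofReal (kernel m η)

/-- The density of `muCyl` on the whole of space-time. -/
def weight (m : ℕ) (α : ℝ) (T : EReal) : ℝ × Sp m → ℝ≥0∞ :=
  (cyl m T).indicator fun z => ENNReal.ofReal (z.2 (Fin.last m) ^ α)

/-- One-sided mollification at scale `ε`. -/
def mollify {m : ℕ} {E : Type*} [NormedAddCommGroup E] [NormedSpace ℝ E] (ε : ℝ)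
    (v : ℝ × Sp m → E) (z : ℝ × Sp m) : E :=
  ∫ η, v (z - ε • η) ∂(kernelMeasure m)

section Kernel

variable {m : ℕ} {α : ℝ}

instance instIsAddHaarMeasureVolume (m : ℕ) :
    (volume : Measure (ℝ × Sp m)).IsAddHaarMeasure := by
  rw [Measure.volume_eq_prod]
  infer_instance

lemma continuous_kernel : Continuous (kernel m) := (kernelBump m).continuous_normed

lemma kernel_nonneg (η : ℝ × Sp m) : 0 ≤ kernel m η := (kernelBump m).nonneg_normed η

lemma measurable_ofReal_kernel : Measurable fun η => ENNReal.ofReal (kernel m η) :=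
  (continuous_kernel.measurable).ennreal_ofReal

instance instIsProbabilityMeasureKernel (m : ℕ) : IsProbabilityMeasure (kernelMeasure m) := by
  refine ⟨?_⟩
  rw [kernelMeasure, withDensity_apply _ MeasurableSet.univ, Measure.restrict_univ,
    ← ofReal_integral_eq_lintegral_ofReal (f := kernel m) (kernelBump m).integrable_normed
      (.of_forall kernel_nonneg)]
  simp [kernel, (kernelBump m).integral_normed]

lemma support_kernel : Function.support (kernel m) = Metric.ball (kernelCenter m) 1 :=
  (kernelBump m).support_normed_eq

lemma ae_kernelMeasure_mem_ball : ∀ᵐ η ∂(kernelMeasure m), η ∈ Metric.ball (kernelCenter m) 1 := by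
  rw [kernelMeasure, ae_withDensity_iff measurable_ofReal_kernel]
  refine .of_forall fun η hη => ?_
  rw [← support_kernel]
  intro h
  simp [h] at hη

lemma fst_mem_of_mem_ball {η : ℝ × Sp m} (h : η ∈ Metric.ball (kernelCenter m) 1) :
    1 < η.1 ∧ η.1 < 3 := by
  rw [Metric.mem_ball, Prod.dist_eq, max_lt_iff] at h
  have := h.1
  rw [Real.dist_eq, abs_lt] at this
  simp only [kernelCenter] at this
  constructor <;> linarith

lemma last_mem_of_mem_ball {η : ℝ × Sp m} (h : η ∈ Metric.ball (kernelCenter m) 1) :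
    -3 < η.2 (Fin.last m) ∧ η.2 (Fin.last m) < -1 := by
  rw [Metric.mem_ball, Prod.dist_eq, max_lt_iff] at h
  have h1 := PiLp.norm_apply_le (η.2 - (kernelCenter m).2) (Fin.last m)
  have h2 := h.2
  rw [dist_eq_norm] at h2
  have h3 := lt_of_le_of_lt h1 h2
  rw [Real.norm_eq_abs, abs_lt] at h3
  simp [kernelCenter] at h3
  constructor <;> linarith

lemma norm_lt_of_mem_ball {η : ℝ × Sp m} (h : η ∈ Metric.ball (kernelCenter m) 1) :
    ‖η‖ < 3 := by
  have h1 : ‖kernelCenter m‖ ≤ 2 := by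
    simp [kernelCenter, Prod.norm_def]
  have h2 : ‖η - kernelCenter m‖ < 1 := by simpa [dist_eq_norm] using h
  have := norm_le_norm_add_norm_sub' η (kernelCenter m)
  linarith

lemma measurable_weight_indicator (T : EReal) : Measurable (weight m α T) :=
  (measurable_weight_cyl m α).indicator (isOpen_cyl m T).measurableSet

lemma muCyl_eq_withDensity (T : EReal) : muCyl m α T = volume.withDensity (weight m α T) := by
  rw [weight, withDensity_indicator (isOpen_cyl m T).measurableSet]
  rfl

/-- The ratio `6` matches the threshold `6 ε` in `exists_lintegral_weight_le`; the sign of `α`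
decides which of the two comparisons is used. -/
lemma rpow_le_of_comparable {a b : ℝ} (ha : 0 < a) (hb : 0 < b) (hab : a ≤ 6 * b)
    (hba : b ≤ 6 * a) : a ^ α ≤ 6 ^ |α| * b ^ α := by
  rcases le_or_gt 0 α with h | h
  · rw [abs_of_nonneg h, ← Real.mul_rpow (by norm_num) hb.le]
    exact Real.rpow_le_rpow ha.le hab h
  · rw [abs_of_neg h, Real.rpow_neg (by norm_num), ← Real.inv_rpow (by norm_num),
      ← Real.mul_rpow (by norm_num) hb.le]
    exact Real.rpow_le_rpow_of_nonpos (by positivity) (by linarith) h.le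

/-- By Tonelli this is the uniform `L_2(μ)` bound for the mollifier. Let `s` be the height of `y`.
For `s ≥ 6 ε` the weight is comparable at all sampled points; for `s ≤ ε` all of them lie outside
the half-space; in between, rescaling by `ε` leaves the mass of the weight on a fixed ball, finite
by local finiteness. -/
lemma exists_lintegral_weight_le [IsLocallyFiniteMeasure (muCyl m α ⊤)] :
    ∃ C : ℝ≥0∞, C ≠ ⊤ ∧ ∀ (ε : ℝ) (_ : 0 < ε) (T : EReal) (y : ℝ × Sp m),
      ∫⁻ η, weight m α T (y + ε • η) ∂(kernelMeasure m) ≤ C * weight m α T y := by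
  obtain ⟨C₀, hC₀⟩ := (continuous_kernel (m := m)).bounded_above_of_compact_support
    (kernelBump m).hasCompactSupport_normed
  -- The rescaled points have norm below `3 + 6 = 9`; radius `20` is ample.
  set B : ℝ≥0∞ := muCyl m α ⊤ (Metric.closedBall 0 20)
  have hB : B ≠ ⊤ := (isCompact_closedBall _ _).measure_lt_top.ne
  refine ⟨ENNReal.ofReal (6 ^ |α|) * (1 + ENNReal.ofReal C₀ * B), ?_, ?_⟩
  · exact ENNReal.mul_ne_top (by simp) (by simp [ENNReal.mul_eq_top, hB])
  intro ε hε T y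
  -- On the support of the kernel `η` has positive time component and negative last component, so
  -- `y` is earlier and higher than `y + ε • η`.
  have hcyl : ∀ η ∈ Metric.ball (kernelCenter m) 1, y + ε • η ∈ cyl m T → y ∈ cyl m T := by
    rintro η hη ⟨h1, h2⟩
    have h3 := fst_mem_of_mem_ball hη
    have h4 := last_mem_of_mem_ball hη
    constructor
    · refine lt_of_le_of_lt (EReal.coe_le_coe_iff.2 ?_) h1
      simp only [Prod.fst_add, Prod.smul_fst, smul_eq_mul]
      nlinarith
    · have h2 : 0 < y.2 (Fin.last m) + ε * η.2 (Fin.last m) := h2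
      change 0 < y.2 (Fin.last m)
      nlinarith
  by_cases hy : y ∈ cyl m T
  swap
  · have : ∀ᵐ η ∂(kernelMeasure m), weight m α T (y + ε • η) = 0 := by
      filter_upwards [ae_kernelMeasure_mem_ball] with η hη
      exact indicator_of_notMem (fun h => hy (hcyl η hη h)) _
    rw [lintegral_congr_ae this]
    simp
  have hs : 0 < y.2 (Fin.last m) := hy.2
  have hwy : weight m α T y = ENNReal.ofReal (y.2 (Fin.last m) ^ α) := indicator_of_mem hy _
  set s := y.2 (Fin.last m) with hs_def
  have hws : ∀ a, 0 < a → a ≤ 6 * s → s ≤ 6 * a →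
      ENNReal.ofReal (a ^ α) ≤ ENNReal.ofReal (6 ^ |α|) * weight m α T y := by
    intro a ha h1 h2
    rw [hwy, ← ENNReal.ofReal_mul (by positivity)]
    exact ENNReal.ofReal_le_ofReal (rpow_le_of_comparable ha hs h1 h2)
  have hlast : ∀ η : ℝ × Sp m, (y + ε • η).2 (Fin.last m) = s + ε * η.2 (Fin.last m) := by
    intro η; simp [hs_def]
  -- Since `-3 < η_d < -1`, the bound `6 ε ≤ s` keeps the height `s + ε η_d` between `s / 2` and
  -- `s`.
  rcases le_or_gt (6 * ε) s with h6 | h6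
  · calc ∫⁻ η, weight m α T (y + ε • η) ∂(kernelMeasure m)
        ≤ ∫⁻ η, ENNReal.ofReal (6 ^ |α|) * weight m α T y ∂(kernelMeasure m) := by
          refine lintegral_mono_ae ?_
          filter_upwards [ae_kernelMeasure_mem_ball] with η hη
          have h4 := last_mem_of_mem_ball hη
          refine (indicator_le_self _ _ _).trans ?_
          rw [hlast]
          refine hws _ ?_ ?_ ?_ <;> nlinarith
      _ = ENNReal.ofReal (6 ^ |α|) * 1 * weight m α T y := by simp
      _ ≤ _ := by gcongr; exact le_self_add
  · rcases le_or_gt s ε with h1 | h1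
    · have : ∀ᵐ η ∂(kernelMeasure m), weight m α T (y + ε • η) = 0 := by
        filter_upwards [ae_kernelMeasure_mem_ball] with η hη
        refine indicator_of_notMem (fun h => ?_) _
        have h2 : 0 < (y + ε • η).2 (Fin.last m) := h.2
        have h4 := last_mem_of_mem_ball hη
        rw [hlast] at h2
        nlinarith
      rw [lintegral_congr_ae this]
      simp
    -- With this shift the height of `y + ε • η` is `ε` times that of `η + p`, so the power weight
    -- splits off the factor `ε ^ α`, itself comparable to `s ^ α`.
    let p : ℝ × Sp m := (0, EuclideanSpace.single (Fin.last m) (s / ε))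
    have hp : ‖p‖ ≤ 6 := by
      have : s / ε ≤ 6 := by rw [div_le_iff₀ hε]; exact h6.le
      have h0 : 0 ≤ s / ε := by positivity
      simp [p, Prod.norm_def, abs_of_pos hs, abs_of_pos hε]
      exact this
    have hpt : ∀ η : ℝ × Sp m, η ∈ Metric.ball (kernelCenter m) 1 →
        weight m α T (y + ε • η) ≤ ENNReal.ofReal (ε ^ α) *
          (Metric.closedBall (0 : ℝ × Sp m) 20).indicator (weight m α ⊤) (η + p) := by
      intro η hη
      by_cases hc : y + ε • η ∈ cyl m T
      swap
      · rw [weight, indicator_of_notMem hc]; exact zero_le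
      have h2 : 0 < s + ε * η.2 (Fin.last m) := by rw [← hlast]; exact hc.2
      have h3 : (η + p).2 (Fin.last m) = (s + ε * η.2 (Fin.last m)) / ε := by
        simp [p]; field_simp; ring
      have h4 : η + p ∈ cyl m ⊤ := by
        refine ⟨by simp, ?_⟩
        change 0 < (η + p).2 (Fin.last m)
        rw [h3]; positivity
      have h5 : η + p ∈ Metric.closedBall (0 : ℝ × Sp m) 20 := by
        have := norm_add_le η p
        have := norm_lt_of_mem_ball hη
        simp only [mem_closedBall_zero_iff]
        linarith
      rw [indicator_of_mem h5, weight, weight, indicator_of_mem hc, indicator_of_mem h4, h3, hlast,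
        ← ENNReal.ofReal_mul (by positivity), ← Real.mul_rpow hε.le (by positivity)]
      refine le_of_eq ?_
      congr 2
      field_simp
    have hmeas : Measurable fun η : ℝ × Sp m =>
        (Metric.closedBall (0 : ℝ × Sp m) 20).indicator (weight m α ⊤) (η + p) :=
      ((measurable_weight_indicator ⊤).indicator Metric.isClosed_closedBall.measurableSet).comp
        (measurable_add_const p)
    calc ∫⁻ η, weight m α T (y + ε • η) ∂(kernelMeasure m)
        ≤ ∫⁻ η, ENNReal.ofReal (ε ^ α) *
          (Metric.closedBall (0 : ℝ × Sp m) 20).indicator (weight m α ⊤) (η + p)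
            ∂(kernelMeasure m) := by
          refine lintegral_mono_ae ?_
          filter_upwards [ae_kernelMeasure_mem_ball] with η hη using hpt η hη
      _ = ENNReal.ofReal (ε ^ α) * ∫⁻ η, ENNReal.ofReal (kernel m η) *
          (Metric.closedBall (0 : ℝ × Sp m) 20).indicator (weight m α ⊤) (η + p) := by
          rw [lintegral_const_mul _ hmeas, kernelMeasure,
            lintegral_withDensity_eq_lintegral_mul _ measurable_ofReal_kernel hmeas]
          rfl
      _ ≤ ENNReal.ofReal (ε ^ α) * ∫⁻ η, ENNReal.ofReal C₀ *
          (Metric.closedBall (0 : ℝ × Sp m) 20).indicator (weight m α ⊤) (η + p) := by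
          gcongr with η
          exact (le_abs_self _).trans (hC₀ η)
      _ = ENNReal.ofReal (ε ^ α) * (ENNReal.ofReal C₀ * B) := by
          rw [lintegral_const_mul _ hmeas,
            lintegral_add_right_eq_self (fun η => (Metric.closedBall (0 : ℝ × Sp m) 20).indicator
              (weight m α ⊤) η) p, lintegral_indicator Metric.isClosed_closedBall.measurableSet]
          simp only [B]
          rw [muCyl_eq_withDensity, withDensity_apply _ Metric.isClosed_closedBall.measurableSet]
      _ ≤ (ENNReal.ofReal (6 ^ |α|) * weight m α T y) * (ENNReal.ofReal C₀ * B) := by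
          gcongr
          exact hws ε hε (by linarith) h6.le
      _ = ENNReal.ofReal (6 ^ |α|) * (ENNReal.ofReal C₀ * B) * weight m α T y := by ring
      _ ≤ _ := by gcongr; exact le_add_self

end Kernel

/-! ### Boundedness and convergence of the mollifier in `L_2(μ)`. -/

section MollifyL2

variable {m : ℕ} {α : ℝ} {T : EReal} {E : Type*} [NormedAddCommGroup E]

lemma lintegral_sq_le {X : Type*} [MeasurableSpace X] {P : Measure X} [IsProbabilityMeasure P]
    {f : X → ℝ≥0∞} (hf : AEMeasurable f P) : (∫⁻ x, f x ∂P) ^ 2 ≤ ∫⁻ x, f x ^ 2 ∂P := by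
  have h := eLpNorm_le_eLpNorm_of_exponent_le (p := 1) (q := 2) (μ := P) (f := f) (by norm_num)
    hf.aestronglyMeasurable
  rw [eLpNorm_one_eq_lintegral_enorm, eLpNorm_eq_lintegral_rpow_enorm_toReal (by simp) (by simp)] at h
  simp only [enorm_eq_self, ENNReal.toReal_ofNat, ENNReal.rpow_ofNat] at h
  calc (∫⁻ x, f x ∂P) ^ 2 ≤ ((∫⁻ x, f x ^ 2 ∂P) ^ ((1 : ℝ) / 2)) ^ 2 := by gcongr
    _ = _ := by rw [← ENNReal.rpow_natCast, ← ENNReal.rpow_mul]; simp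

lemma measurable_translate_enorm {v : ℝ × Sp m → E} (hv : StronglyMeasurable v) (ε : ℝ) :
    Measurable fun p : (ℝ × Sp m) × (ℝ × Sp m) => ‖v (p.1 - ε • p.2)‖ₑ :=
  hv.enorm.comp (by fun_prop)

/-- The constant of `exists_lintegral_weight_le`. -/
def mollifyConst (m : ℕ) (α : ℝ) [IsLocallyFiniteMeasure (muCyl m α ⊤)] : ℝ≥0∞ :=
  (exists_lintegral_weight_le (m := m) (α := α)).choose

variable [IsLocallyFiniteMeasure (muCyl m α ⊤)]

/-- Tonelli and the substitution `z = y + ε • η` move the translation from `v` onto the weight. -/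
lemma lintegral_lintegral_translate_le {v : ℝ × Sp m → E} (hv : StronglyMeasurable v) {ε : ℝ}
    (hε : 0 < ε) :
    ∫⁻ z, ∫⁻ η, ‖v (z - ε • η)‖ₑ ^ 2 ∂(kernelMeasure m) ∂(muCyl m α T)
      ≤ mollifyConst m α * ∫⁻ z, ‖v z‖ₑ ^ 2 ∂(muCyl m α T) := by
  have hC := (exists_lintegral_weight_le (m := m) (α := α)).choose_spec.2 ε hε T
  have hw := measurable_weight_indicator (m := m) (α := α) T
  have h2 : Measurable fun p : (ℝ × Sp m) × (ℝ × Sp m) => ‖v (p.1 - ε • p.2)‖ₑ ^ 2 :=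
    (measurable_translate_enorm hv ε).pow_const 2
  have hvm : Measurable fun z => ‖v z‖ₑ ^ 2 := hv.enorm.pow_const 2
  calc ∫⁻ z, ∫⁻ η, ‖v (z - ε • η)‖ₑ ^ 2 ∂(kernelMeasure m) ∂(muCyl m α T)
      = ∫⁻ z, ∫⁻ η, weight m α T z * ‖v (z - ε • η)‖ₑ ^ 2 ∂(kernelMeasure m) := by
        rw [muCyl_eq_withDensity, lintegral_withDensity_eq_lintegral_mul _ hw h2.lintegral_prod_right']
        refine lintegral_congr fun z => ?_
        exact (lintegral_const_mul _ (h2.comp measurable_prodMk_left)).symm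
    _ = ∫⁻ η, ∫⁻ z, weight m α T z * ‖v (z - ε • η)‖ₑ ^ 2 ∂volume ∂(kernelMeasure m) := by
        refine lintegral_lintegral_swap (Measurable.aemeasurable ?_)
        exact (hw.comp measurable_fst).mul h2
    _ = ∫⁻ η, ∫⁻ y, weight m α T (y + ε • η) * ‖v y‖ₑ ^ 2 ∂volume ∂(kernelMeasure m) := by
        refine lintegral_congr fun η => ?_
        rw [← lintegral_add_right_eq_self _ (ε • η)]
        simp
    _ = ∫⁻ y, ∫⁻ η, weight m α T (y + ε • η) * ‖v y‖ₑ ^ 2 ∂(kernelMeasure m) := by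
        refine lintegral_lintegral_swap (Measurable.aemeasurable ?_)
        refine Measurable.mul (hw.comp ?_) (hvm.comp measurable_snd)
        fun_prop
    _ ≤ ∫⁻ y, mollifyConst m α * (weight m α T y * ‖v y‖ₑ ^ 2) := by
        refine lintegral_mono fun y => ?_
        have hwy : Measurable fun η => weight m α T (y + ε • η) := hw.comp (by fun_prop)
        rw [lintegral_mul_const _ hwy, ← mul_assoc]
        gcongr
        exact hC y
    _ = _ := by
        rw [muCyl_eq_withDensity, lintegral_withDensity_eq_lintegral_mul _ hw hvm]
        exact lintegral_const_mul _ (hw.mul hvm)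

lemma mollifyConst_ne_top : mollifyConst m α ≠ ⊤ :=
  (exists_lintegral_weight_le (m := m) (α := α)).choose_spec.1

lemma lintegral_sq_lt_top {X : Type*} [MeasurableSpace X] {μ : Measure X} {v : X → E}
    (hv : MemLp v 2 μ) : ∫⁻ x, ‖v x‖ₑ ^ 2 ∂μ < ⊤ := by
  have := lintegral_rpow_enorm_lt_top_of_eLpNorm_lt_top (p := 2) (by simp) (by simp) hv.2
  simpa using this

lemma eLpNorm_two_eq {X : Type*} [MeasurableSpace X] {μ : Measure X} (v : X → E) :
    eLpNorm v 2 μ = (∫⁻ x, ‖v x‖ₑ ^ 2 ∂μ) ^ ((1 : ℝ) / 2) := by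
  rw [eLpNorm_eq_lintegral_rpow_enorm_toReal (by simp) (by simp)]
  simp

/-- The Bochner integral that defines `mollify` is zero where the integrand is not integrable; this
rules that out almost everywhere, as linearity and evaluation of components require. -/
lemma ae_memLp_translate {v : ℝ × Sp m → E} (hv : StronglyMeasurable v)
    (hv2 : MemLp v 2 (muCyl m α T)) {ε : ℝ} (hε : 0 < ε) :
    ∀ᵐ z ∂(muCyl m α T), Integrable (fun η => v (z - ε • η)) (kernelMeasure m) := by
  have h2 : Measurable fun p : (ℝ × Sp m) × (ℝ × Sp m) => ‖v (p.1 - ε • p.2)‖ₑ ^ 2 :=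
    (measurable_translate_enorm hv ε).pow_const 2
  have hlt : ∫⁻ z, ∫⁻ η, ‖v (z - ε • η)‖ₑ ^ 2 ∂(kernelMeasure m) ∂(muCyl m α T) < ⊤ :=
    lt_of_le_of_lt (lintegral_lintegral_translate_le hv hε)
      (ENNReal.mul_lt_top mollifyConst_ne_top.lt_top (lintegral_sq_lt_top hv2))
  filter_upwards [ae_lt_top h2.lintegral_prod_right' hlt.ne] with z hz
  have hm : AEStronglyMeasurable (fun η => v (z - ε • η)) (kernelMeasure m) :=
    (hv.comp_measurable (by fun_prop)).aestronglyMeasurable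
  refine MemLp.integrable (q := 2) (by norm_num) ⟨hm, ?_⟩
  rw [eLpNorm_two_eq]
  exact ENNReal.rpow_lt_top_of_nonneg (by norm_num) hz.ne

variable [NormedSpace ℝ E]

lemma eLpNorm_mollify_le {v : ℝ × Sp m → E} (hv : StronglyMeasurable v) {ε : ℝ} (hε : 0 < ε) :
    eLpNorm (mollify ε v) 2 (muCyl m α T)
      ≤ mollifyConst m α ^ ((1 : ℝ) / 2) * eLpNorm v 2 (muCyl m α T) := by
  rw [eLpNorm_two_eq, eLpNorm_two_eq, ← ENNReal.mul_rpow_of_nonneg _ _ (by norm_num)]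
  refine ENNReal.rpow_le_rpow ?_ (by norm_num)
  refine le_trans (lintegral_mono fun z => ?_) (lintegral_lintegral_translate_le hv hε)
  calc ‖mollify ε v z‖ₑ ^ 2 ≤ (∫⁻ η, ‖v (z - ε • η)‖ₑ ∂(kernelMeasure m)) ^ 2 := by
        gcongr; exact enorm_integral_le_lintegral_enorm _
    _ ≤ _ := lintegral_sq_le
      ((measurable_translate_enorm hv ε).comp measurable_prodMk_left).aemeasurable

lemma stronglyMeasurable_mollify {v : ℝ × Sp m → E} (hv : StronglyMeasurable v) (ε : ℝ) :
    StronglyMeasurable (mollify ε v) := by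
  refine StronglyMeasurable.integral_prod_right'
    (f := fun p : (ℝ × Sp m) × (ℝ × Sp m) => v (p.1 - ε • p.2)) ?_
  exact hv.comp_measurable (by fun_prop)

lemma tendsto_mollify_of_continuous [CompleteSpace E]
    {g : ℝ × Sp m → E} (hg : Continuous g) (hgc : HasCompactSupport g) :
    Tendsto (fun ε => eLpNorm (mollify ε g - g) 2 (muCyl m α T)) (𝓝[>] 0) (𝓝 0) := by
  -- For `ε < 1` the kernel displaces points by less than `3`, so all mollifications vanish outside
  -- this compact set.
  let K : Set (ℝ × Sp m) := Metric.cthickening 3 (tsupport g)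
  have hK : IsCompact K := hgc.isCompact.cthickening
  have hKm : muCyl m α T K < ⊤ := hK.measure_lt_top
  have hunif := hgc.uniformContinuous_of_continuous hg
  rw [ENNReal.tendsto_nhds_zero]
  intro δ hδ
  obtain ⟨c, hc, hcδ⟩ : ∃ c : ℝ, 0 < c ∧
      ENNReal.ofReal c * (muCyl m α T K) ^ ((1 : ℝ) / 2) ≤ δ := by
    have ht : Tendsto (fun c : ℝ => ENNReal.ofReal c * (muCyl m α T K) ^ ((1 : ℝ) / 2))
        (𝓝[>] 0) (𝓝 0) := by
      have h1 : Tendsto (fun c : ℝ => ENNReal.ofReal c) (𝓝[>] 0) (𝓝 0) := by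
        have := (ENNReal.continuous_ofReal.tendsto (0 : ℝ)).mono_left
          (nhdsWithin_le_nhds (s := Ioi 0))
        simpa using this
      have := ENNReal.Tendsto.mul_const h1 (b := (muCyl m α T K) ^ ((1 : ℝ) / 2))
        (Or.inr (ENNReal.rpow_lt_top_of_nonneg (by norm_num) hKm.ne).ne)
      simpa using this
    obtain ⟨c, h1, h2⟩ := ((ENNReal.tendsto_nhds_zero.1 ht δ hδ).and self_mem_nhdsWithin).exists
    exact ⟨c, h2, h1⟩
  obtain ⟨r, hr, hrc⟩ := Metric.uniformContinuous_iff.1 hunif c hc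
  have hev : ∀ᶠ ε : ℝ in 𝓝[>] 0, 0 < ε ∧ ε < 1 ∧ ε * 3 < r := by
    refine (eventually_mem_nhdsWithin (a := (0 : ℝ)) (s := Ioi 0)).and
      (eventually_nhdsWithin_of_eventually_nhds ?_)
    refine (eventually_lt_nhds one_pos).and ?_
    exact (eventually_lt_nhds (b := r / 3) (by positivity)).mono fun ε h => by linarith
  filter_upwards [hev] with ε ⟨hε, hε1, hεr⟩
  have hpt : ∀ z, ‖(mollify ε g - g) z‖ ≤ c := by
    intro z
    have h1 : (mollify ε g - g) z = ∫ η, (g (z - ε • η) - g z) ∂(kernelMeasure m) := by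
      rw [integral_sub]
      · simp [mollify]
      · obtain ⟨B, hB⟩ := hg.bounded_above_of_compact_support hgc
        exact Integrable.of_bound (hg.comp (by fun_prop)).aestronglyMeasurable B
          (.of_forall fun η => hB _)
      · exact integrable_const _
    rw [h1]
    refine (norm_integral_le_of_norm_le_const (C := c) ?_).trans (by simp)
    filter_upwards [ae_kernelMeasure_mem_ball] with η hη
    rw [← dist_eq_norm]
    refine (hrc ?_).le
    rw [dist_eq_norm, sub_sub_cancel_left, norm_neg, norm_smul, Real.norm_of_nonneg hε.le]
    have := norm_lt_of_mem_ball hη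
    nlinarith
  have hout : ∀ z, z ∉ K → (mollify ε g - g) z = 0 := by
    intro z hz
    have h0 : g z = 0 := image_eq_zero_of_notMem_tsupport fun h =>
      hz (Metric.self_subset_cthickening _ h)
    have h1 : mollify ε g z = 0 := by
      refine integral_eq_zero_of_ae ?_
      filter_upwards [ae_kernelMeasure_mem_ball] with η hη
      by_contra h
      refine hz (Metric.mem_cthickening_of_dist_le z (z - ε • η) 3 _ (subset_tsupport _ h) ?_)
      rw [dist_eq_norm, sub_sub_cancel, norm_smul, Real.norm_of_nonneg hε.le]
      have := norm_lt_of_mem_ball hη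
      nlinarith [norm_nonneg η]
    simp [h0, h1]
  refine le_trans ?_ hcδ
  calc eLpNorm (mollify ε g - g) 2 (muCyl m α T)
      ≤ eLpNorm (K.indicator fun _ => c) 2 (muCyl m α T) := by
        refine eLpNorm_mono fun z => ?_
        by_cases hz : z ∈ K
        · rw [indicator_of_mem hz]; exact (hpt z).trans (le_abs_self c)
        · rw [hout z hz]; simp
    _ = _ := by
        rw [eLpNorm_indicator_const hK.measurableSet (by simp) (by simp), Real.enorm_of_nonneg hc.le]
        simp

lemma tendsto_mollify [CompleteSpace E]
    {v : ℝ × Sp m → E} (hv : StronglyMeasurable v) (hv2 : MemLp v 2 (muCyl m α T)) :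
    Tendsto (fun ε => eLpNorm (mollify ε v - v) 2 (muCyl m α T)) (𝓝[>] 0) (𝓝 0) := by
  set C : ℝ≥0∞ := mollifyConst m α ^ ((1 : ℝ) / 2)
  have hC : C ≠ ⊤ := (ENNReal.rpow_lt_top_of_nonneg (by norm_num) mollifyConst_ne_top).ne
  rw [ENNReal.tendsto_nhds_zero]
  intro δ hδ
  -- The tolerance for the approximation by `g`: `C` pays for mollifying `v - g`, and `1` for `v -
  -- g` itself.
  have hδ' : δ / 2 / (C + 1) ≠ 0 := by
    simp [ENNReal.div_eq_zero_iff, hδ.ne', hC]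
  obtain ⟨g, hgc, hgv, hg, hg2⟩ := hv2.exists_hasCompactSupport_eLpNorm_sub_le (by simp) hδ'
  filter_upwards [ENNReal.tendsto_nhds_zero.1 (tendsto_mollify_of_continuous (α := α) (T := T) hg hgc)
    (δ / 2) (ENNReal.half_pos hδ.ne'), self_mem_nhdsWithin] with ε h1 (hε : 0 < ε)
  have hvg : StronglyMeasurable (v - g) := hv.sub hg.stronglyMeasurable
  have hae : mollify ε v - v =ᵐ[muCyl m α T]
      (mollify ε (v - g) - (v - g)) + (mollify ε g - g) := by
    filter_upwards [ae_memLp_translate hv hv2 hε, ae_memLp_translate hg.stronglyMeasurable hg2 hε]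
      with z h3 h4
    have : mollify ε (v - g) z = mollify ε v z - mollify ε g z := by
      simp only [mollify, Pi.sub_apply]
      exact integral_sub h3 h4
    simp only [Pi.add_apply, Pi.sub_apply, this]
    abel
  rw [eLpNorm_congr_ae hae]
  have hm := fun w : ℝ × Sp m → E => fun hw : StronglyMeasurable w =>
    (stronglyMeasurable_mollify hw ε).aestronglyMeasurable (μ := muCyl m α T)
  calc eLpNorm ((mollify ε (v - g) - (v - g)) + (mollify ε g - g)) 2 (muCyl m α T)
      ≤ (eLpNorm (mollify ε (v - g)) 2 (muCyl m α T) + eLpNorm (v - g) 2 (muCyl m α T))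
        + eLpNorm (mollify ε g - g) 2 (muCyl m α T) := by
        refine (eLpNorm_add_le ((hm _ hvg).sub hvg.aestronglyMeasurable)
          ((hm _ hg.stronglyMeasurable).sub hg.aestronglyMeasurable) (by norm_num)).trans ?_
        gcongr
        exact eLpNorm_sub_le (hm _ hvg) hvg.aestronglyMeasurable (by norm_num)
    _ ≤ (C * eLpNorm (v - g) 2 (muCyl m α T) + eLpNorm (v - g) 2 (muCyl m α T)) + δ / 2 := by
        gcongr
        exact eLpNorm_mollify_le hvg hε
    _ = (C + 1) * eLpNorm (v - g) 2 (muCyl m α T) + δ / 2 := by ring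
    _ ≤ (C + 1) * (δ / 2 / (C + 1)) + δ / 2 := by gcongr
    _ ≤ δ / 2 + δ / 2 := by gcongr; exact ENNReal.mul_div_le
    _ = δ := ENNReal.add_halves δ

end MollifyL2

/-- The mollification kernel at scale `ε`. -/
def scaledKernel (m : ℕ) (ε : ℝ) (ζ : ℝ × Sp m) : ℝ :=
  |(ε ^ Module.finrank ℝ (ℝ × Sp m))⁻¹| * kernel m (ε⁻¹ • ζ)

/-! ### Mollified jets are jets of smooth functions. -/

section Smoothness

variable {m n : ℕ} {α : ℝ} {T : EReal} {ε : ℝ}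

lemma contDiff_scaledKernel : ContDiff ℝ ∞ (scaledKernel m ε) :=
  contDiff_const.mul ((kernelBump m).contDiff_normed.comp (contDiff_const_smul _))

lemma tsupport_scaledKernel_subset :
    tsupport (scaledKernel m ε) ⊆ (fun ζ => ε⁻¹ • ζ) ⁻¹' Metric.closedBall (kernelCenter m) 1 := by
  refine closure_minimal ?_ (Metric.isClosed_closedBall.preimage (continuous_const_smul _))
  intro ζ hζ
  refine Metric.ball_subset_closedBall ?_
  rw [← support_kernel]
  exact right_ne_zero_of_mul hζ

lemma hasCompactSupport_scaledKernel (hε : 0 < ε) : HasCompactSupport (scaledKernel m ε) := by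
  have h : IsCompact ((fun ζ : ℝ × Sp m => ε⁻¹ • ζ) ⁻¹' Metric.closedBall (kernelCenter m) 1) :=
    (Homeomorph.smulOfNeZero ε⁻¹ (inv_ne_zero hε.ne')).isCompact_preimage.2
      (isCompact_closedBall _ _)
  exact h.of_isClosed_subset (isClosed_tsupport _) tsupport_scaledKernel_subset

lemma mollify_eq_integral_scaledKernel {E : Type*} [NormedAddCommGroup E] [NormedSpace ℝ E]
    (hε : 0 < ε) (v : ℝ × Sp m → E) (z : ℝ × Sp m) :
    mollify ε v z = ∫ t, scaledKernel m ε (z - t) • v t := by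
  have h1 : mollify ε v z = ∫ η, kernel m η • v (z - ε • η) := by
    rw [mollify, kernelMeasure, integral_withDensity_eq_integral_toReal_smul
      measurable_ofReal_kernel (.of_forall fun _ => ENNReal.ofReal_lt_top)]
    simp [ENNReal.toReal_ofReal (kernel_nonneg _)]
  have h2 := Measure.integral_comp_smul (volume : Measure (ℝ × Sp m))
    (fun ζ => kernel m (ε⁻¹ • ζ) • v (z - ζ)) ε
  simp only [inv_smul_smul₀ hε.ne'] at h2
  rw [h1, h2, ← integral_smul,
    ← integral_sub_left_eq_self (fun t => scaledKernel m ε (z - t) • v t) volume z]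
  simp [scaledKernel, mul_smul]

/-- The part of the cylinder at height more than `ε`. -/
def innerCyl (m : ℕ) (T : EReal) (ε : ℝ) : Set (ℝ × Sp m) :=
  cyl m T ∩ {z | ε < z.2 (Fin.last m)}

lemma isOpen_innerCyl : IsOpen (innerCyl m T ε) :=
  (isOpen_cyl m T).inter (isOpen_lt continuous_const (by fun_prop))

/-- This is the gain from the off-centre kernel: over `Ω_T` the convolution sees only points of
`Ω_T` at height above `ε`. There the weight causes no trouble, and the kernel is itself a test
function for the weak gradient. -/
lemma sub_mem_innerCyl (hε : 0 < ε) {z ζ : ℝ × Sp m} (hz : z ∈ cyl m T)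
    (hζ : ζ ∈ tsupport (scaledKernel m ε)) : z - ζ ∈ innerCyl m T ε := by
  have h := tsupport_scaledKernel_subset hζ
  rw [mem_preimage, Metric.mem_closedBall, Prod.dist_eq, max_le_iff] at h
  have h1 : ε ≤ ζ.1 := by
    have := h.1
    rw [Real.dist_eq, abs_le] at this
    simp only [kernelCenter, Prod.smul_fst, smul_eq_mul] at this
    have h3 : 1 ≤ ε⁻¹ * ζ.1 := by linarith
    rwa [inv_mul_eq_div, le_div_iff₀ hε, one_mul] at h3
  have h2 : ζ.2 (Fin.last m) ≤ -ε := by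
    have h3 := (PiLp.norm_apply_le ((ε⁻¹ • ζ).2 - (kernelCenter m).2) (Fin.last m)).trans
      ((dist_eq_norm _ _).symm.le.trans h.2)
    rw [Real.norm_eq_abs, abs_le] at h3
    simp [kernelCenter] at h3
    have h4 : ε⁻¹ * ζ.2 (Fin.last m) ≤ -1 := by linarith
    rw [inv_mul_eq_div, div_le_iff₀ hε] at h4
    linarith
  have hz2 : 0 < z.2 (Fin.last m) := hz.2
  have h5 : ε < (z - ζ).2 (Fin.last m) := by
    simp only [Prod.snd_sub, PiLp.sub_apply]; linarith
  refine ⟨⟨?_, hε.trans h5⟩, h5⟩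
  refine lt_of_le_of_lt (EReal.coe_le_coe_iff.2 ?_) hz.1
  simp only [Prod.fst_sub]; linarith

/-- Between the heights `ε` and `R` the weight is at least `min (ε ^ α) (R ^ α)`, whatever the sign
of `α`. -/
lemma restrict_innerCyl_le (hε : 0 < ε) (R : ℝ) :
    ∃ c : ℝ≥0∞, c ≠ ⊤ ∧
      volume.restrict (innerCyl m T ε ∩ {z | z.2 (Fin.last m) ≤ R}) ≤ c • muCyl m α T := by
  set S := innerCyl m T ε ∩ {z : ℝ × Sp m | z.2 (Fin.last m) ≤ R}
  have hS : MeasurableSet S := isOpen_innerCyl.measurableSet.inter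
    (isClosed_le (by fun_prop) continuous_const).measurableSet
  rcases le_or_gt R ε with hR | hR
  · refine ⟨0, by simp, ?_⟩
    have : S = ∅ := by
      ext z
      simp only [S, innerCyl, mem_inter_iff, mem_ofPred_eq, mem_empty_iff_false, iff_false, not_and,
        not_le]
      intro h; linarith [h.2]
    simp [this]
  set a : ℝ := min (ε ^ α) (R ^ α)
  have hR0 : 0 < R := hε.trans hR
  have ha : 0 < a := lt_min (by positivity) (by positivity)
  have hle : ∀ z ∈ S, ENNReal.ofReal a ≤ weight m α T z := by
    intro z hz
    rw [weight, indicator_of_mem hz.1.1]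
    refine ENNReal.ofReal_le_ofReal ?_
    have h1 : ε < z.2 (Fin.last m) := hz.1.2
    have h2 : z.2 (Fin.last m) ≤ R := hz.2
    rcases le_or_gt 0 α with h | h
    · exact (min_le_left _ _).trans (Real.rpow_le_rpow hε.le h1.le h)
    · exact (min_le_right _ _).trans (Real.rpow_le_rpow_of_nonpos (hε.trans h1) h2 h.le)
  refine ⟨(ENNReal.ofReal a)⁻¹, by simpa using ha, ?_⟩
  refine Measure.le_iff.2 fun A hA => ?_
  rw [Measure.restrict_apply hA, Measure.smul_apply, smul_eq_mul, mul_comm, ← div_eq_mul_inv,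
    ENNReal.le_div_iff_mul_le (by simp [ha]) (by simp), mul_comm, muCyl_eq_withDensity,
    withDensity_apply _ hA]
  calc ENNReal.ofReal a * volume (A ∩ S) = ∫⁻ z in A ∩ S, ENNReal.ofReal a := by
        rw [setLIntegral_const]
    _ ≤ ∫⁻ z in A ∩ S, weight m α T z :=
        setLIntegral_mono (measurable_weight_indicator T) fun z hz => hle z hz.2
    _ ≤ _ := lintegral_mono_set inter_subset_left

lemma locallyIntegrable_indicator_innerCyl {E : Type*} [NormedAddCommGroup E] (hε : 0 < ε)
    {v : ℝ × Sp m → E} (hv : MemLp v 2 (muCyl m α T)) :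
    LocallyIntegrable ((innerCyl m T ε).indicator v) volume := by
  rw [locallyIntegrable_iff]
  intro K hK
  obtain ⟨R, hR⟩ := hK.isBounded.exists_norm_le
  obtain ⟨c, hc, hle⟩ := restrict_innerCyl_le (m := m) (T := T) (α := α) hε R
  have h1 : MemLp v 2 (volume.restrict (innerCyl m T ε ∩ {z | z.2 (Fin.last m) ≤ R})) :=
    hv.of_measure_le_smul hc hle
  rw [IntegrableOn, integrable_indicator_iff isOpen_innerCyl.measurableSet, IntegrableOn,
    Measure.restrict_restrict isOpen_innerCyl.measurableSet]
  have h2 : innerCyl m T ε ∩ K ⊆ innerCyl m T ε ∩ {z | z.2 (Fin.last m) ≤ R} := by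
    rintro z ⟨hz, hzK⟩
    refine ⟨hz, ?_⟩
    have h3 : |z.2 (Fin.last m)| ≤ ‖z.2‖ := by simpa using PiLp.norm_apply_le z.2 (Fin.last m)
    exact (le_abs_self _).trans (h3.trans ((norm_snd_le z).trans (hR z hzK)))
  have h3 : volume (innerCyl m T ε ∩ K) < ⊤ :=
    (measure_mono inter_subset_right).trans_lt hK.measure_lt_top
  have : IsFiniteMeasure (volume.restrict (innerCyl m T ε ∩ K)) := ⟨by simpa using h3⟩
  exact (h1.mono_measure (Measure.restrict_mono h2 le_rfl)).integrable (by norm_num)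

/-- The mollification of a jet field with a weak gradient is the jet of a smooth function. -/
lemma exists_jet_eq_mollify [IsLocallyFiniteMeasure (muCyl m α ⊤)] {w : ℝ × Sp m → Jet m n}
    (hwm : StronglyMeasurable w) (hw : MemLp w 2 (muCyl m α T))
    (hgrad : HasWeakGrad T (fun z => w z none) fun i z => w z (some i)) (hε : 0 < ε) :
    ∃ φ : ℝ × Sp m → Val n, ContDiff ℝ ∞ φ ∧ jet φ =ᵐ[muCyl m α T] mollify ε w := by
  -- Discarding the values near `x_d = 0` and outside `Ω_T` makes `v` locally integrable on all of
  -- space-time, so the convolution is smooth across the boundary; on `Ω_T` it is unchanged.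
  set v : ℝ × Sp m → Val n := (innerCyl m T ε).indicator fun z => w z none
  have hv : LocallyIntegrable v volume :=
    locallyIntegrable_indicator_innerCyl hε (memLp_jet_apply hw none)
  set k := scaledKernel m ε
  have hk : ContDiff ℝ ∞ k := contDiff_scaledKernel
  have hkc : HasCompactSupport k := hasCompactSupport_scaledKernel hε
  let B : Val n →L[ℝ] ℝ →L[ℝ] Val n := (ContinuousLinearMap.lsmul ℝ ℝ).flip
  let φ : ℝ × Sp m → Val n := convolution v k B volume
  have hφ : ContDiff ℝ ∞ φ := hkc.contDiff_convolution_right B hv hk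
  have hφ0 : ∀ z ∈ cyl m T, φ z = mollify ε (fun z => w z none) z := by
    intro z hz
    rw [mollify_eq_integral_scaledKernel hε]
    refine integral_congr_ae (.of_forall fun t => ?_)
    change k (z - t) • v t = k (z - t) • w t none
    by_cases ht : z - t ∈ tsupport k
    · have := sub_mem_innerCyl hε hz ht
      rw [sub_sub_cancel] at this
      rw [show v t = w t none from indicator_of_mem this _]
    · rw [image_eq_zero_of_notMem_tsupport ht]; simp
  have hφ1 : ∀ z ∈ cyl m T, ∀ i, dx i φ z = mollify ε (fun z => w z (some i)) z := by
    intro z hz i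
    set e : ℝ × Sp m := (0, EuclideanSpace.single i 1)
    have h1 : dx i φ z = ∫ t, fderiv ℝ k (z - t) e • v t := by
      rw [dx, (hkc.hasFDerivAt_convolution_right B hv (hk.of_le (by simp)) z).fderiv,
        convolution_precompR_apply B hv (hkc.fderiv ℝ) (hk.continuous_fderiv (by simp))]
      rfl
    -- The reflected kernel is supported in `Ω_T`, so the weak gradient can be tested with it and
    -- the derivative passes from the kernel to `u`.
    let ψ : ℝ × Sp m → ℝ := fun t => k (z - t)
    have hψts : ∀ t, t ∈ tsupport ψ → z - t ∈ tsupport k := fun t ht =>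
      tsupport_comp_subset_preimage k (f := fun t => z - t) (by fun_prop) ht
    have hψ : IsTest (cyl m T) ψ := by
      refine ⟨hk.comp (contDiff_const.sub contDiff_id), ?_, ?_⟩
      · exact hkc.comp_homeomorph (Homeomorph.subLeft z)
      · intro t ht
        have := sub_mem_innerCyl hε hz (hψts t ht)
        rw [sub_sub_cancel] at this
        exact this.1
    have hdψ : ∀ t, dx i ψ t = - fderiv ℝ k (z - t) e := by
      intro t
      have h3 : HasFDerivAt (fun t => z - t) (-ContinuousLinearMap.id ℝ (ℝ × Sp m)) t := by
        simpa using (hasFDerivAt_id t).const_sub z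
      have h4 := ((hk.differentiable (by simp)) (z - t)).hasFDerivAt.comp t h3
      rw [dx, show ψ = k ∘ fun t => z - t from rfl, h4.fderiv]
      simp [e]
    have h2 := hgrad i ψ hψ
    rw [setIntegral_eq_integral_of_forall_compl_eq_zero (fun t ht => by
        rw [show dx i ψ t = 0 from hψ.fderiv_apply_eq_zero _ ht, zero_smul]),
      setIntegral_eq_integral_of_forall_compl_eq_zero (fun t ht => by
        rw [hψ.eq_zero_of_notMem ht, zero_smul])] at h2
    simp only [hdψ, neg_smul, integral_neg, neg_inj] at h2
    rw [h1, mollify_eq_integral_scaledKernel hε, ← h2]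
    refine integral_congr_ae (.of_forall fun t => ?_)
    change fderiv ℝ k (z - t) e • v t = fderiv ℝ k (z - t) e • w t none
    by_cases ht : z - t ∈ tsupport k
    · have := sub_mem_innerCyl hε hz ht
      rw [sub_sub_cancel] at this
      rw [show v t = w t none from indicator_of_mem this _]
    · have : fderiv ℝ k (z - t) e = 0 := by
        by_contra h
        exact ht (support_fderiv_apply_subset e h)
      simp [this]
  refine ⟨φ, hφ, ?_⟩
  filter_upwards [ae_mem_cyl m α T, ae_memLp_translate hwm hw hε] with z hz hintg
  ext1 o
  have h5 : mollify ε w z o = mollify ε (fun z => w z o) z :=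
    eval_integral_piLp (fun o => hintg.eval_piLp o) o
  rw [h5]
  cases o with
  | none => exact hφ0 z hz
  | some i => exact hφ1 z hz i

end Smoothness

/-! ### Density of test functions -/

section Cutoff

variable {m n : ℕ} {α : ℝ} {T : EReal}

/-- For finite `T` the cutoffs become arbitrarily steep near `T`. This is harmless: jets contain no
time derivative, so only spatial derivatives of cutoffs must be small. -/
lemma exists_timeCutoff (hT : ⊥ < T) : ∃ θ : ℕ → ℝ → ℝ, (∀ k, ContDiff ℝ ∞ (θ k)) ∧
    (∀ k t, 0 ≤ θ k t ∧ θ k t ≤ 1) ∧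
    (∀ k, ∃ a b : ℝ, b ∈ timeRay T ∧ tsupport (θ k) ⊆ Icc a b) ∧
    ∀ t ∈ timeRay T, ∀ᶠ k in atTop, θ k t = 1 := by
  obtain ⟨b, c, hb, hc, hbc⟩ : ∃ b c : ℕ → ℝ, (∀ k, b k ∈ timeRay T) ∧ (∀ k, 0 < c k) ∧
      ∀ t ∈ timeRay T, ∀ᶠ k in atTop, 1 ≤ c k * (b k - t) := by
    induction T with
    | bot => exact absurd hT (lt_irrefl _)
    | top =>
      refine ⟨fun k => k, fun _ => 1, by simp, by simp, fun t _ => ?_⟩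
      filter_upwards [eventually_ge_atTop ⌈t + 1⌉₊] with k hk
      have := Nat.ceil_le.1 hk
      linarith
    | coe τ =>
      refine ⟨fun k => τ - 1 / (k + 1), fun k => k + 1, fun k => ?_, fun k => by positivity,
        fun t ht => ?_⟩
      · rw [timeRay_coe, mem_Iio]
        have : (0 : ℝ) < 1 / (k + 1) := by positivity
        linarith
      · rw [timeRay_coe, mem_Iio] at ht
        filter_upwards [eventually_ge_atTop ⌈2 / (τ - t)⌉₊] with k hk
        have h1 := Nat.ceil_le.1 hk
        rw [div_le_iff₀ (by linarith)] at h1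
        have h2 : ((k : ℝ) + 1) * (τ - 1 / (k + 1) - t) = (k + 1) * (τ - t) - 1 := by
          field_simp
          ring
        rw [h2]
        nlinarith
  refine ⟨fun k t => Real.smoothTransition (c k * (b k - t)) * Real.smoothTransition (k + t),
    fun k => ?_, fun k t => ?_, fun k => ?_, fun t ht => ?_⟩
  · exact (Real.smoothTransition.contDiff.comp (by fun_prop)).mul
      (Real.smoothTransition.contDiff.comp (by fun_prop))
  · have h1 := Real.smoothTransition.nonneg (c k * (b k - t))
    have h2 := Real.smoothTransition.nonneg (k + t)
    have h3 := Real.smoothTransition.le_one (c k * (b k - t))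
    have h4 := Real.smoothTransition.le_one (k + t)
    exact ⟨by positivity, by nlinarith⟩
  · refine ⟨-k, b k, hb k, closure_minimal ?_ isClosed_Icc⟩
    intro t ht
    constructor
    · by_contra h
      push Not at h
      exact ht (by simp [Real.smoothTransition.zero_of_nonpos (by linarith : (k : ℝ) + t ≤ 0)])
    · by_contra h
      push Not at h
      refine ht ?_
      simp only
      rw [Real.smoothTransition.zero_of_nonpos (x := c k * (b k - t)), zero_mul]
      exact mul_nonpos_of_nonneg_of_nonpos (hc k).le (by linarith)
  · filter_upwards [hbc t ht, eventually_ge_atTop ⌈1 - t⌉₊] with k h1 h2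
    have h3 := Nat.ceil_le.1 h2
    rw [Real.smoothTransition.one_of_one_le h1, Real.smoothTransition.one_of_one_le (by linarith),
      one_mul]

lemma exists_cutoff (m : ℕ) (hT : ⊥ < T) : ∃ (χ : ℕ → ℝ × Sp m → ℝ) (D : ℝ), 0 ≤ D ∧
    (∀ k, IsTest (timeRay T ×ˢ univ) (χ k)) ∧ (∀ k z, 0 ≤ χ k z ∧ χ k z ≤ 1) ∧
    (∀ k i z, |dx i (χ k) z| ≤ D / (k + 1)) ∧
    ∀ z ∈ timeRay T ×ˢ univ, ∀ᶠ k in atTop, χ k z = 1 := by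
  obtain ⟨θ, hθ, hθ01, hθs, hθ1⟩ := exists_timeCutoff hT
  let β : ContDiffBump (0 : Sp m) := ⟨1, 2, by norm_num, by norm_num⟩
  have hβ : ContDiff ℝ ∞ β := β.contDiff
  obtain ⟨D, hD⟩ := (hβ.continuous_fderiv (by simp)).bounded_above_of_compact_support
    (β.hasCompactSupport.fderiv ℝ)
  have hD0 : 0 ≤ D := (norm_nonneg _).trans (hD 0)
  let c : ℕ → ℝ := fun k => ((k : ℝ) + 1)⁻¹
  have hc : ∀ k, 0 < c k := fun k => by positivity
  let χ : ℕ → ℝ × Sp m → ℝ := fun k z => θ k z.1 * β (c k • z.2)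
  have hβk : ∀ k, ContDiff ℝ ∞ fun z : ℝ × Sp m => β (c k • z.2) := fun k =>
    hβ.comp (by fun_prop)
  have hθk : ∀ k, ContDiff ℝ ∞ fun z : ℝ × Sp m => θ k z.1 := fun k =>
    (hθ k).comp contDiff_fst
  refine ⟨χ, D, hD0, fun k => ?_, fun k z => ?_, fun k i z => ?_, fun z hz => ?_⟩
  · obtain ⟨a, b, hb, hab⟩ := hθs k
    have hsub : tsupport (χ k) ⊆ Icc a b ×ˢ Metric.closedBall 0 (2 * (k + 1)) := by
      refine closure_minimal ?_ (isClosed_Icc.prod Metric.isClosed_closedBall)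
      intro z hz
      refine ⟨hab (subset_tsupport _ (left_ne_zero_of_mul hz)), ?_⟩
      have h1 : c k • z.2 ∈ Function.support β := right_ne_zero_of_mul hz
      rw [β.support_eq, mem_ball_zero_iff, norm_smul, Real.norm_of_nonneg (hc k).le] at h1
      rw [mem_closedBall_zero_iff]
      have h2 : ((k : ℝ) + 1)⁻¹ * ‖z.2‖ < 2 := h1
      rw [inv_mul_lt_iff₀ (by positivity)] at h2
      linarith
    refine ⟨(hθk k).mul (hβk k), ?_, ?_⟩
    · exact (isCompact_Icc.prod (isCompact_closedBall _ _)).of_isClosed_subset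
        (isClosed_tsupport _) hsub
    · intro z hz
      refine ⟨lt_of_le_of_lt (EReal.coe_le_coe_iff.2 (hsub hz).1.2) hb, mem_univ _⟩
  · have h1 := hθ01 k z.1
    have h2 := β.nonneg (x := c k • z.2)
    have h3 := β.le_one (x := c k • z.2)
    exact ⟨mul_nonneg h1.1 h2, mul_le_one₀ h1.2 h2 h3⟩
  · have h1 : HasFDerivAt (fun z : ℝ × Sp m => θ k z.1)
        ((fderiv ℝ (θ k) z.1).comp (ContinuousLinearMap.fst ℝ ℝ (Sp m))) z :=
      ((hθ k).differentiable (by simp) z.1).hasFDerivAt.comp z hasFDerivAt_fst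
    have h2 : HasFDerivAt (fun z : ℝ × Sp m => β (c k • z.2))
        ((fderiv ℝ β (c k • z.2)).comp (c k • ContinuousLinearMap.snd ℝ ℝ (Sp m))) z :=
      HasFDerivAt.comp (g := β) (f := fun z : ℝ × Sp m => c k • z.2) z
        (hβ.differentiable (by simp) (c k • z.2)).hasFDerivAt (hasFDerivAt_snd.const_smul (c k))
    have h3 : dx i (χ k) z
        = θ k z.1 * (c k * fderiv ℝ β (c k • z.2) (EuclideanSpace.single i 1)) := by
      rw [dx, show χ k = (fun z => θ k z.1) * fun z => β (c k • z.2) from rfl, (h1.mul h2).fderiv]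
      simp
    have h4 : |fderiv ℝ β (c k • z.2) (EuclideanSpace.single i 1)| ≤ D := by
      have := (fderiv ℝ β (c k • z.2)).le_of_opNorm_le (hD _) (EuclideanSpace.single i (1 : ℝ))
      simpa using this
    rw [h3, abs_mul, abs_mul, abs_of_nonneg (hθ01 k z.1).1, abs_of_pos (hc k), div_eq_inv_mul]
    calc θ k z.1 * (c k * |fderiv ℝ β (c k • z.2) (EuclideanSpace.single i 1)|)
        ≤ 1 * (c k * D) := by
          have := hc k
          gcongr
          exact (hθ01 k z.1).2
      _ = _ := one_mul _
  · filter_upwards [hθ1 z.1 hz.1, eventually_ge_atTop ⌈‖z.2‖⌉₊] with k h1 h2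
    have h3 := Nat.ceil_le.1 h2
    have h4 : β (c k • z.2) = 1 := by
      refine β.one_of_mem_closedBall ?_
      rw [mem_closedBall_zero_iff, norm_smul, Real.norm_of_nonneg (hc k).le]
      change ((k : ℝ) + 1)⁻¹ * ‖z.2‖ ≤ 1
      rw [inv_mul_le_iff₀ (by positivity)]
      linarith
    simp [χ, h1, h4]

lemma isTest_smul {O : Set (ℝ × Sp m)} {χ : ℝ × Sp m → ℝ} {φ : ℝ × Sp m → Val n}
    (hχ : IsTest O χ) (hφ : ContDiff ℝ ∞ φ) : IsTest O fun z => χ z • φ z :=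
  ⟨hχ.1.smul hφ, hχ.2.1.smul_right, (tsupport_smul_subset_left χ φ).trans hχ.2.2⟩

/-- By the product rule the error is `(χ - 1)` times the jet plus `φ Dχ`. The first part tends to
zero by dominated convergence, the second is of order `1 / k`. -/
lemma tendsto_cutoff {χ : ℕ → ℝ × Sp m → ℝ} {D : ℝ}
    (hχ : ∀ k, IsTest (timeRay T ×ˢ univ) (χ k)) (hχ01 : ∀ k z, 0 ≤ χ k z ∧ χ k z ≤ 1)
    (hD : ∀ k i z, |dx i (χ k) z| ≤ D / (k + 1))
    (hχ1 : ∀ z ∈ timeRay T ×ˢ univ, ∀ᶠ k in atTop, χ k z = 1)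
    {φ : ℝ × Sp m → Val n} (hφ : ContDiff ℝ ∞ φ) (hφ2 : MemLp (jet φ) 2 (muCyl m α T)) :
    Tendsto (fun k => eLpNorm (jet (fun z => χ k z • φ z) - jet φ) 2 (muCyl m α T))
      atTop (𝓝 0) := by
  have hcontj : ∀ ψ : ℝ × Sp m → Val n, ContDiff ℝ ∞ ψ → Continuous (jet ψ) := by
    intro ψ hψ
    refine (PiLp.continuous_toLp 2 _).comp (continuous_pi fun o => ?_)
    cases o with
    | none => exact hψ.continuous
    | some i => exact (hψ.continuous_fderiv (by simp)).clm_apply continuous_const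
  -- The Euclidean norm of the gradient needs only `√(m + 1) D`; the larger factor avoids the root.
  let R : ℝ := (m + 1) * D
  have hD0 : 0 ≤ D := by
    have := (abs_nonneg _).trans (hD 0 0 0)
    simpa using this
  have hbound : ∀ k z, ‖jet (fun z => χ k z • φ z) z - jet φ z‖
      ≤ (|χ k z - 1| + R / (k + 1)) * ‖jet φ z‖ := by
    intro k z
    set r : Jet m n := mkJet (fun _ => 0) (fun i z => dx i (χ k) z • φ z) z
    have h1 : jet (fun z => χ k z • φ z) z - jet φ z = (χ k z - 1) • jet φ z + r := by
      ext1 o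
      cases o with
      | none => simp [r, sub_smul]
      | some i =>
        have h2 : dx i (fun z => χ k z • φ z) z = χ k z • dx i φ z + dx i (χ k) z • φ z := by
          rw [dx, fderiv_fun_smul ((hχ k).differentiable z) (hφ.differentiable (by simp) z)]
          simp [dx]
        simp [r, sub_smul, h2]
        abel
    have h3 : ‖φ z‖ ≤ ‖jet φ z‖ := PiLp.norm_apply_le (jet φ z) none
    have h4 : ‖r‖ ≤ R / (k + 1) * ‖φ z‖ := by
      refine le_of_sq_le_sq ?_ (by positivity)
      rw [jet_norm_sq]
      simp only [r, mkJet_some, mkJet_none, norm_zero, ne_eq, OfNat.ofNat_ne_zero,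
        not_false_eq_true, zero_pow, add_zero, norm_smul, Real.norm_eq_abs]
      calc ∑ i : Fin (m + 1), (|dx i (χ k) z| * ‖φ z‖) ^ 2
          ≤ ∑ i : Fin (m + 1), (D / (k + 1) * ‖φ z‖) ^ 2 := by
            gcongr with i
            exact hD k i z
        _ = (m + 1) * (D / (k + 1) * ‖φ z‖) ^ 2 := by simp
        _ ≤ (m + 1) ^ 2 * (D / (k + 1) * ‖φ z‖) ^ 2 := by
            gcongr
            nlinarith [(Nat.cast_nonneg m : (0 : ℝ) ≤ m)]
        _ = _ := by simp only [R]; ring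
    rw [h1]
    calc ‖(χ k z - 1) • jet φ z + r‖ ≤ |χ k z - 1| * ‖jet φ z‖ + R / (k + 1) * ‖φ z‖ := by
          refine (norm_add_le _ _).trans (add_le_add ?_ h4)
          rw [norm_smul, Real.norm_eq_abs]
      _ ≤ |χ k z - 1| * ‖jet φ z‖ + R / (k + 1) * ‖jet φ z‖ := by gcongr
      _ = _ := by ring
  have hlim : Tendsto (fun k => ∫⁻ z, ‖(jet (fun z => χ k z • φ z) - jet φ) z‖ₑ ^ 2
      ∂(muCyl m α T)) atTop (𝓝 (∫⁻ _, 0 ∂(muCyl m α T))) := by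
    refine tendsto_lintegral_of_dominated_convergence
      (fun z => (ENNReal.ofReal (1 + R) * ‖jet φ z‖ₑ) ^ 2) (fun k => ?_) (fun k => ?_) ?_ ?_
    · exact (((hcontj _ (isTest_smul (hχ k) hφ).1).sub (hcontj φ hφ)).enorm.measurable).pow_const 2
    · refine .of_forall fun z => ?_
      simp only
      gcongr
      rw [← ofReal_norm, ← ofReal_norm, ← ENNReal.ofReal_mul (by positivity)]
      refine ENNReal.ofReal_le_ofReal ((hbound k z).trans ?_)
      gcongr
      · have := hχ01 k z
        rw [abs_le]; constructor <;> linarith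
      · refine div_le_self (by positivity) ?_
        have : (0 : ℝ) ≤ k := Nat.cast_nonneg k
        linarith
    · simp_rw [mul_pow]
      rw [lintegral_const_mul _ ((hcontj φ hφ).enorm.measurable.pow_const 2)]
      exact (ENNReal.mul_lt_top (by simp) (lintegral_sq_lt_top hφ2)).ne
    · filter_upwards [ae_mem_cyl m α T] with z hz
      have h1 : Tendsto (fun k : ℕ => (|χ k z - 1| + R / (k + 1)) * ‖jet φ z‖) atTop (𝓝 0) := by
        have h2 : Tendsto (fun k : ℕ => |χ k z - 1|) atTop (𝓝 0) := by
          refine tendsto_const_nhds.congr' ?_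
          filter_upwards [hχ1 z ⟨hz.1, mem_univ _⟩] with k hk
          simp [hk]
        have h3 : Tendsto (fun k : ℕ => R / ((k : ℝ) + 1)) atTop (𝓝 0) :=
          tendsto_const_nhds.div_atTop
            (tendsto_natCast_atTop_atTop.atTop_add tendsto_const_nhds)
        simpa using (h2.add h3).mul_const ‖jet φ z‖
      have h4 : Tendsto (fun k => ‖jet (fun z => χ k z • φ z) z - jet φ z‖) atTop (𝓝 0) :=
        squeeze_zero (fun k => norm_nonneg _) (fun k => hbound k z) h1
      have h5 : Tendsto (fun k => ‖jet (fun z => χ k z • φ z) z - jet φ z‖ₑ) atTop (𝓝 0) := by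
        have := (ENNReal.continuous_ofReal.tendsto 0).comp h4
        simpa [Function.comp_def, ofReal_norm] using this
      simpa [Function.comp_def] using ((ENNReal.continuous_pow 2).tendsto 0).comp h5
  have h6 := ((ENNReal.continuous_rpow_const (y := (1 : ℝ) / 2)).tendsto _).comp hlim
  simpa [eLpNorm_two_eq, Function.comp_def] using h6

end Cutoff

section Density

variable {m n : ℕ} {α : ℝ} {T : EReal} [IsLocallyFiniteMeasure (muCyl m α ⊤)]

/-- Jet fields with a weak gradient are limits of jets of test functions. -/
theorem exists_test_eLpNorm_sub_le (hT : ⊥ < T) {w : ℝ × Sp m → Jet m n}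
    (hw : MemLp w 2 (muCyl m α T))
    (hgrad : HasWeakGrad T (fun z => w z none) fun i z => w z (some i)) {δ : ℝ≥0∞} (hδ : δ ≠ 0) :
    ∃ φ : ℝ × Sp m → Val n, IsTest (timeRay T ×ˢ univ) φ ∧
      eLpNorm (jet φ - w) 2 (muCyl m α T) ≤ δ := by
  -- Tonelli for translates requires a strongly measurable representative. The weak gradient
  -- survives the change because Lebesgue measure on `Ω_T` is absolutely continuous with respect to
  -- `μ`.
  obtain ⟨w', hw'm, hww'⟩ := hw.1
  have hw' : MemLp w' 2 (muCyl m α T) := hw.ae_eq hww'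
  have hgrad' : HasWeakGrad T (fun z => w' z none) fun i z => w' z (some i) := by
    have hae := (volume_absolutelyContinuous_muCyl m α T).ae_le hww'
    intro i ψ hψ
    rw [integral_congr_ae (g := fun z => dx i ψ z • w z none), hgrad i ψ hψ,
      integral_congr_ae (g := fun z => ψ z • w' z (some i))]
    · filter_upwards [hae] with z hz; rw [hz]
    · filter_upwards [hae] with z hz; rw [hz]
  have hδ2 : 0 < δ / 2 := ENNReal.half_pos hδ
  obtain ⟨ε, h1, hε⟩ := ((ENNReal.tendsto_nhds_zero.1 (tendsto_mollify hw'm hw') _ hδ2).and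
    eventually_mem_nhdsWithin).exists
  obtain ⟨φ, hφ, hφw⟩ := exists_jet_eq_mollify hw'm hw' hgrad' hε
  have hmφ : AEStronglyMeasurable (jet φ) (muCyl m α T) :=
    (stronglyMeasurable_mollify hw'm ε).aestronglyMeasurable.congr hφw.symm
  have h2 : eLpNorm (jet φ - w) 2 (muCyl m α T) ≤ δ / 2 := by
    rwa [eLpNorm_congr_ae (hφw.sub hww')]
  have hφ2 : MemLp (jet φ) 2 (muCyl m α T) := by
    refine MemLp.ae_eq hφw.symm ⟨(stronglyMeasurable_mollify hw'm ε).aestronglyMeasurable, ?_⟩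
    refine (eLpNorm_mollify_le hw'm hε).trans_lt (ENNReal.mul_lt_top ?_ hw'.2)
    exact ENNReal.rpow_lt_top_of_nonneg (by norm_num) mollifyConst_ne_top
  obtain ⟨χ, D, hD0, hχ, hχ01, hD, hχ1⟩ := exists_cutoff m hT
  obtain ⟨k, hk⟩ := (ENNReal.tendsto_nhds_zero.1
    (tendsto_cutoff (α := α) hχ hχ01 hD hχ1 hφ hφ2) _ hδ2).exists
  have hψ := isTest_smul (hχ k) hφ
  refine ⟨fun z => χ k z • φ z, hψ, ?_⟩
  calc eLpNorm (jet (fun z => χ k z • φ z) - w) 2 (muCyl m α T)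
      = eLpNorm ((jet (fun z => χ k z • φ z) - jet φ) + (jet φ - w)) 2 (muCyl m α T) := by
        rw [sub_add_sub_cancel]
    _ ≤ δ / 2 + δ / 2 := (eLpNorm_add_le ((hψ.memLp_jet _).1.sub hmφ) (hmφ.sub hw.1)
        (by norm_num)).trans (add_le_add hk h2)
    _ = δ := ENNReal.add_halves δ

end Density

/-! ### Multiplication by matrix fields -/

/-- `M v`, as a vector of the Euclidean space. -/
def mv {n : ℕ} (M : Matrix (Fin n) (Fin n) ℝ) (v : Val n) : Val n :=
  WithLp.toLp 2 (M *ᵥ v.ofLp)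

section Matrices

variable {n : ℕ} (M : Matrix (Fin n) (Fin n) ℝ) (u v w : Val n)

lemma mdot_eq_inner : mdot M v w = inner ℝ (mv M v) w := by
  rw [EuclideanSpace.inner_eq_star_dotProduct, mdot, dotProduct_comm]
  simp [mv]

lemma mdot_comm (h : Mᵀ = M) : mdot M v w = mdot M w v := by
  rw [mdot, mdot, ← Matrix.vecMul_transpose, h, ← Matrix.dotProduct_mulVec, dotProduct_comm]

lemma mv_sub : mv M (u - v) = mv M u - mv M v := by
  simp [mv, Matrix.mulVec_sub]

lemma mv_add : mv M (u + v) = mv M u + mv M v := by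
  simp [mv, Matrix.mulVec_add]

lemma mv_smul (c : ℝ) : mv M (c • v) = c • mv M v := by
  simp [mv, Matrix.mulVec_smul]

lemma norm_mv_le : ‖mv M v‖ ≤ matAbs M * ‖v‖ := by
  rw [EuclideanSpace.norm_eq, EuclideanSpace.norm_eq, matAbs, ← Real.sqrt_mul (by positivity)]
  refine Real.sqrt_le_sqrt ?_
  rw [Finset.sum_mul]
  refine Finset.sum_le_sum fun k _ => ?_
  simp only [mv, Matrix.mulVec, dotProduct, Real.norm_eq_abs, sq_abs]
  exact Finset.sum_mul_sq_le_sq_mul_sq _ _ _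

end Matrices

section MatrixFields

variable {X : Type*} [MeasurableSpace X] {μ : Measure X} {n : ℕ} {K : ℝ}
  {M : X → Matrix (Fin n) (Fin n) ℝ} {u : X → Val n}

lemma aestronglyMeasurable_mv (hM : ∀ k l, AEMeasurable (fun x => M x k l) μ)
    (hu : AEStronglyMeasurable u μ) : AEStronglyMeasurable (fun x => mv (M x) (u x)) μ := by
  refine (PiLp.continuous_toLp 2 _).comp_aestronglyMeasurable
    (AEMeasurable.aestronglyMeasurable (aemeasurable_pi_lambda _ fun k => ?_))
  simp only [Matrix.mulVec, dotProduct]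
  refine Finset.aemeasurable_fun_sum _ fun l _ => (hM k l).mul ?_
  have : Continuous fun v : Val n => v l := by fun_prop
  exact (this.comp_aestronglyMeasurable hu).aemeasurable

lemma memLp_mv (hM : ∀ k l, AEMeasurable (fun x => M x k l) μ) (hK : ∀ᵐ x ∂μ, matAbs (M x) ≤ K)
    (hu : MemLp u 2 μ) : MemLp (fun x => mv (M x) (u x)) 2 μ := by
  refine MemLp.of_le_mul hu (aestronglyMeasurable_mv hM hu.1) (c := K) ?_
  filter_upwards [hK] with x hx
  exact (norm_mv_le _ _).trans (by gcongr)

end MatrixFields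

/-- A time independent coefficient matrix: measurable, bounded, symmetric and uniformly positive,
up to null sets of the weighted measure. -/
structure SymCoeff {m n : ℕ} (α κ : ℝ) (a₀ : Sp m → Matrix (Fin n) (Fin n) ℝ) : Prop where
  meas : ∀ k l, AEMeasurable (fun x => a₀ x k l) (muSpace m α)
  posdef : ∀ᵐ x ∂(muSpace m α), ∀ ξ : Val n, κ * ‖ξ‖ ^ 2 ≤ mdot (a₀ x) ξ ξ
  bounded : ∀ᵐ x ∂(muSpace m α), matAbs (a₀ x) ≤ κ⁻¹
  symm : ∀ᵐ x ∂(muSpace m α), (a₀ x)ᵀ = a₀ x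

section SymCoeff

variable {m n : ℕ} {α κ : ℝ} {T : EReal} {a₀ : Sp m → Matrix (Fin n) (Fin n) ℝ}

lemma NondegCoeff.symCoeff (h : NondegCoeff κ (halfSpace m) a₀)
    (hs : ∀ᵐ x ∂(volume.restrict (halfSpace m)), (a₀ x)ᵀ = a₀ x) : SymCoeff α κ a₀ where
  meas k l := (h.meas k l).mono_ac (muSpace_absolutelyContinuous m α)
  posdef := (muSpace_absolutelyContinuous m α).ae_le h.posdef
  bounded := (muSpace_absolutelyContinuous m α).ae_le h.bounded
  symm := (muSpace_absolutelyContinuous m α).ae_le hs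

lemma quasiMeasurePreserving_snd (m : ℕ) (α : ℝ) (T : EReal) :
    Measure.QuasiMeasurePreserving (Prod.snd : ℝ × Sp m → Sp m) (muCyl m α T) (muSpace m α) := by
  rw [muCyl_eq_prod]
  exact Measure.quasiMeasurePreserving_snd

lemma SymCoeff.meas_cyl (h : SymCoeff α κ a₀) (k l : Fin n) :
    AEMeasurable (fun z : ℝ × Sp m => a₀ z.2 k l) (muCyl m α T) :=
  (h.meas k l).comp_quasiMeasurePreserving (quasiMeasurePreserving_snd m α T)

lemma SymCoeff.posdef_cyl (h : SymCoeff α κ a₀) :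
    ∀ᵐ z ∂(muCyl m α T), ∀ ξ : Val n, κ * ‖ξ‖ ^ 2 ≤ mdot (a₀ z.2) ξ ξ :=
  (quasiMeasurePreserving_snd m α T).ae h.posdef

lemma SymCoeff.bounded_cyl (h : SymCoeff α κ a₀) :
    ∀ᵐ z ∂(muCyl m α T), matAbs (a₀ z.2) ≤ κ⁻¹ :=
  (quasiMeasurePreserving_snd m α T).ae h.bounded

lemma SymCoeff.symm_cyl (h : SymCoeff α κ a₀) : ∀ᵐ z ∂(muCyl m α T), (a₀ z.2)ᵀ = a₀ z.2 :=
  (quasiMeasurePreserving_snd m α T).ae h.symm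

lemma SymCoeff.memLp_mv (h : SymCoeff α κ a₀) {u : ℝ × Sp m → Val n}
    (hu : MemLp u 2 (muCyl m α T)) : MemLp (fun z => mv (a₀ z.2) (u z)) 2 (muCyl m α T) :=
  WeightedParabolic.memLp_mv h.meas_cyl h.bounded_cyl hu

lemma SymCoeff.integrable_mdot (h : SymCoeff α κ a₀) {u v : ℝ × Sp m → Val n}
    (hu : MemLp u 2 (muCyl m α T)) (hv : MemLp v 2 (muCyl m α T)) :
    Integrable (fun z => mdot (a₀ z.2) (u z) (v z)) (muCyl m α T) := by
  simp_rw [mdot_eq_inner]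
  exact integrable_inner_of_memLp (h.memLp_mv hu) hv

/-- The quadratic form of `a₀` evaluated on a time increment. -/
lemma SymCoeff.two_mul_integral_sub (h : SymCoeff α κ a₀) {u : ℝ × Sp m → Val n}
    (hu : MemLp u 2 (muCyl m α ⊤)) (s : ℝ) :
    2 * (∫ z, mdot (a₀ z.2) (u z) (u z) ∂(muCyl m α ⊤)
        - ∫ z, mdot (a₀ z.2) (u z) (u (shift m s z)) ∂(muCyl m α ⊤))
      = ∫ z, mdot (a₀ z.2) (u z - u (shift m s z)) (u z - u (shift m s z)) ∂(muCyl m α ⊤) := by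
  have hsp := measurePreserving_shift (m := m) α s
  have hus : MemLp (fun z => u (shift m s z)) 2 (muCyl m α ⊤) := hu.comp_measurePreserving hsp
  -- Here `a₀` must not depend on `t`: the translate of `u` then has the same energy as `u`.
  have h1 : ∫ z, mdot (a₀ z.2) (u (shift m s z)) (u (shift m s z)) ∂(muCyl m α ⊤)
      = ∫ z, mdot (a₀ z.2) (u z) (u z) ∂(muCyl m α ⊤) := by
    have := integral_map (μ := muCyl m α ⊤) hsp.measurable.aemeasurable
      (f := fun z => mdot (a₀ z.2) (u z) (u z))
      (by rw [hsp.map_eq]; exact (h.integrable_mdot hu hu).aestronglyMeasurable)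
    rw [hsp.map_eq] at this
    exact this.symm
  have h2 : ∫ z, mdot (a₀ z.2) (u z - u (shift m s z)) (u z - u (shift m s z)) ∂(muCyl m α ⊤)
      = ∫ z, ((mdot (a₀ z.2) (u z) (u z) + mdot (a₀ z.2) (u (shift m s z)) (u (shift m s z)))
        - 2 * mdot (a₀ z.2) (u z) (u (shift m s z))) ∂(muCyl m α ⊤) := by
    refine integral_congr_ae ?_
    filter_upwards [h.symm_cyl] with z hz
    -- Symmetry of `a₀` makes the two cross terms equal.
    have := mdot_comm _ (u z) (u (shift m s z)) hz
    simp only [mdot_eq_inner, mv_sub, inner_sub_left, inner_sub_right] at this ⊢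
    linarith
  have h3 : Integrable (fun z => mdot (a₀ z.2) (u z) (u z)
      + mdot (a₀ z.2) (u (shift m s z)) (u (shift m s z))) (muCyl m α ⊤) :=
    (h.integrable_mdot hu hu).add (h.integrable_mdot hus hus)
  rw [h2, integral_sub h3 ((h.integrable_mdot hu hus).const_mul 2), integral_add (h.integrable_mdot hu hu)
    (h.integrable_mdot hus hus), integral_const_mul, h1]
  ring

end SymCoeff

/-! ### Extension by zero in time -/

/-- The field `w`, set to zero for `t ≥ T`. -/
def extZero {m : ℕ} {E : Type*} [Zero E] (T : EReal) (w : ℝ × Sp m → E) : ℝ × Sp m → E :=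
  (timeRay T ×ˢ univ).indicator w

section ExtZero

variable {m n : ℕ} {α κ : ℝ} {T : EReal} {E : Type*} [NormedAddCommGroup E]

lemma extZero_of_mem {w : ℝ × Sp m → E} {z : ℝ × Sp m} (h : z.1 ∈ timeRay T) :
    extZero T w z = w z :=
  indicator_of_mem (s := timeRay T ×ˢ univ) ⟨h, mem_univ _⟩ w

lemma extZero_of_notMem {w : ℝ × Sp m → E} {z : ℝ × Sp m} (h : z.1 ∉ timeRay T) :
    extZero T w z = 0 :=
  indicator_of_notMem (fun h' => h h'.1) w

lemma memLp_extZero {w : ℝ × Sp m → E} (hw : MemLp w 2 (muCyl m α T)) :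
    MemLp (extZero T w) 2 (muCyl m α ⊤) := by
  rw [muCyl_eq_restrict] at hw
  exact (memLp_indicator_iff_restrict (measurableSet_ray m T)).2 hw

lemma extZero_ae_eq (w : ℝ × Sp m → E) : extZero T w =ᵐ[muCyl m α T] w := by
  rw [muCyl_eq_restrict]
  exact indicator_ae_eq_restrict (measurableSet_ray m T)

lemma integral_muCyl_eq {f : ℝ × Sp m → ℝ} (hf : ∀ z, z.1 ∉ timeRay T → f z = 0) :
    ∫ z, f z ∂(muCyl m α ⊤) = ∫ z, f z ∂(muCyl m α T) := by
  rw [muCyl_eq_restrict m α T, setIntegral_eq_integral_of_forall_compl_eq_zero]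
  intro z hz
  exact hf z fun h => hz ⟨h, mem_univ _⟩

lemma integral_inner_extZero [InnerProductSpace ℝ E] (f g : ℝ × Sp m → E) :
    ∫ z, inner ℝ (extZero T f z) (g z) ∂(muCyl m α ⊤)
      = ∫ z, inner ℝ (f z) (g z) ∂(muCyl m α T) := by
  rw [integral_muCyl_eq (T := T) fun z hz => by rw [extZero_of_notMem hz, inner_zero_left]]
  refine integral_congr_ae ?_
  filter_upwards [extZero_ae_eq (α := α) (T := T) f] with z hz
  rw [hz]

/-- The extension may jump at `t = T`, yet it is a limit of test jets, since the norm involves no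
time derivative. Test functions are free at `x_d = 0`, so no boundary condition arises there either.
-/
lemma extZero_jet_mem_closure [IsLocallyFiniteMeasure (muCyl m α ⊤)] (hT : ⊥ < T)
    {w : ℝ × Sp m → Jet m n} (hw : MemLp w 2 (muCyl m α T))
    (hgrad : HasWeakGrad T (fun z => w z none) fun i z => w z (some i)) :
    (memLp_extZero hw).toLp _ ∈ closure (range (testJet m n α T)) := by
  rw [EMetric.mem_closure_iff]
  intro δ hδ
  obtain ⟨φ, hφ, hφw⟩ := exists_test_eLpNorm_sub_le hT hw hgrad (ENNReal.half_pos hδ.ne').ne'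
  by_cases hδt : δ = ⊤
  · exact ⟨_, ⟨⟨φ, hφ⟩, rfl⟩, by rw [hδt]; exact edist_lt_top _ _⟩
  refine ⟨_, ⟨⟨φ, hφ⟩, rfl⟩, ?_⟩
  rw [testJet_apply, edist_comm, Lp.edist_toLp_toLp]
  refine lt_of_eq_of_lt ?_ (hφw.trans_lt (ENNReal.half_lt_self hδ.ne' hδt))
  rw [muCyl_eq_restrict m α T, ← eLpNorm_indicator_eq_eLpNorm_restrict (measurableSet_ray m T)]
  congr 1
  ext1 z
  by_cases hz : z.1 ∈ timeRay T
  · have hz' : z ∈ timeRay T ×ˢ (univ : Set (Sp m)) := ⟨hz, mem_univ _⟩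
    rw [indicator_of_mem hz', Pi.sub_apply,
      extZero_of_mem hz]
    rfl
  · have hz' : z ∉ timeRay T ×ˢ (univ : Set (Sp m)) := fun h => hz h.1
    rw [indicator_of_notMem hz', Pi.sub_apply, extZero_of_notMem hz,
      jet_eq_zero_of_notMem hφ hz', sub_zero]

end ExtZero

/-! ### The energy inequality -/

/-- The jet field `w = (u, Du)` is square integrable on `Ω_T`, `Du` is the weak gradient of `u`, and
`L ∈ L_2` represents the distribution `x_d^α a_0 u_t`. -/
structure EnergyData {m n : ℕ} (α : ℝ) (T : EReal) (a₀ : Sp m → Matrix (Fin n) (Fin n) ℝ)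
    (w L : ℝ × Sp m → Jet m n) : Prop where
  memLp : MemLp w 2 (muCyl m α T)
  memLp' : MemLp L 2 (muCyl m α T)
  weakGrad : HasWeakGrad T (fun z => w z none) fun i z => w z (some i)
  timeDeriv : ∀ φ : ℝ × Sp m → Val n, IsTest (timeRay T ×ˢ univ) φ →
    - ∫ z, mdot (a₀ z.2) (w z none) (dt φ z) ∂(muCyl m α T)
      = ∫ z, inner ℝ (L z) (jet φ z) ∂(muCyl m α T)

section Energy

variable {m n : ℕ} {α κ : ℝ} {S T : EReal} {a₀ : Sp m → Matrix (Fin n) (Fin n) ℝ}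
  {w L : ℝ × Sp m → Jet m n}

lemma cyl_mono (h : S ≤ T) : cyl m S ⊆ cyl m T := prod_mono (timeRay_mono h) subset_rfl

lemma integral_muCyl_of_le {f : ℝ × Sp m → ℝ} (h : S ≤ T) (hf : ∀ z, z.1 ∉ timeRay S → f z = 0) :
    ∫ z, f z ∂(muCyl m α T) = ∫ z, f z ∂(muCyl m α S) := by
  rw [← integral_muCyl_eq hf, ← integral_muCyl_eq fun z hz => hf z fun h' => hz (timeRay_mono h h')]

lemma muCyl_mono (h : S ≤ T) : muCyl m α S ≤ muCyl m α T := by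
  rw [← muCyl_restrict_of_le h]
  exact Measure.restrict_le_self

lemma HasWeakGrad.restrict {u : ℝ × Sp m → Val n} {Du : Fin (m + 1) → ℝ × Sp m → Val n}
    (hu : HasWeakGrad T u Du) (h : S ≤ T) : HasWeakGrad S u Du := by
  intro i ψ hψ
  have h1 := hu i ψ (hψ.mono (cyl_mono h))
  have hψT := hψ.mono (cyl_mono h)
  rw [setIntegral_eq_integral_of_forall_compl_eq_zero (fun t ht => by
      rw [show dx i ψ t = 0 from hψT.fderiv_apply_eq_zero _ ht, zero_smul]),
    setIntegral_eq_integral_of_forall_compl_eq_zero (fun t ht => by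
      rw [hψT.eq_zero_of_notMem ht, zero_smul])] at h1
  rwa [setIntegral_eq_integral_of_forall_compl_eq_zero (fun t ht => by
      rw [show dx i ψ t = 0 from hψ.fderiv_apply_eq_zero _ ht, zero_smul]),
    setIntegral_eq_integral_of_forall_compl_eq_zero (fun t ht => by
      rw [hψ.eq_zero_of_notMem ht, zero_smul])]

lemma mdot_zero_right (M : Matrix (Fin n) (Fin n) ℝ) (v : Val n) : mdot M v 0 = 0 := by
  simp [mdot_eq_inner]

lemma IsTest.dt_eq_zero {φ : ℝ × Sp m → Val n} (hφ : IsTest (timeRay T ×ˢ univ) φ)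
    {z : ℝ × Sp m} (hz : z.1 ∉ timeRay T) : dt φ z = 0 :=
  hφ.fderiv_apply_eq_zero _ fun h => hz h.1

lemma IsTest.jet_eq_zero {φ : ℝ × Sp m → Val n} (hφ : IsTest (timeRay T ×ˢ univ) φ)
    {z : ℝ × Sp m} (hz : z.1 ∉ timeRay T) : jet φ z = 0 :=
  jet_eq_zero_of_notMem hφ fun h => hz h.1

lemma EnergyData.restrict (hd : EnergyData α T a₀ w L) (h : S ≤ T) : EnergyData α S a₀ w L where
  memLp := hd.memLp.mono_measure (muCyl_mono h)
  memLp' := hd.memLp'.mono_measure (muCyl_mono h)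
  weakGrad := hd.weakGrad.restrict h
  timeDeriv φ hφ := by
    have h1 := hd.timeDeriv φ (hφ.mono (prod_mono (timeRay_mono h) subset_rfl))
    rwa [integral_muCyl_of_le h fun z hz => by rw [hφ.dt_eq_zero hz, mdot_zero_right],
      integral_muCyl_of_le h fun z hz => by rw [hφ.jet_eq_zero hz, inner_zero_right]] at h1

lemma SymCoeff.mdot_nonneg_ae (ha : SymCoeff α κ a₀) (hκ : 0 ≤ κ) :
    ∀ᵐ z ∂(muCyl m α T), ∀ ξ : Val n, 0 ≤ mdot (a₀ z.2) ξ ξ := by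
  filter_upwards [ha.posdef_cyl] with z hz ξ
  exact le_trans (by positivity) (hz ξ)

variable [IsLocallyFiniteMeasure (muCyl m α ⊤)]

/-- This is `hasDerivWithinAt_inner_shiftL2` with `b = a₀ u` and the extended jet of `u` itself as
the element of the closure: `u` is paired with its own translates. -/
lemma EnergyData.hasDerivWithinAt (hd : EnergyData α T a₀ w L) (ha : SymCoeff α κ a₀)
    (hT : ⊥ < T) :
    HasDerivWithinAt (fun s => ∫ z, mdot (a₀ z.2) (extZero T (fun z => w z none) z)
        (extZero T (fun z => w z none) (shift m s z)) ∂(muCyl m α ⊤))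
      (- ∫ z, inner ℝ (L z) (w z) ∂(muCyl m α T)) (Ici 0) 0 := by
  have hu : MemLp (extZero T fun z => w z none) 2 (muCyl m α ⊤) :=
    memLp_extZero (memLp_jet_apply hd.memLp none)
  have hb := ha.memLp_mv hu
  have key := hasDerivWithinAt_inner_shiftL2 (T := T) hb (memLp_extZero hd.memLp') ?_
    (extZero_jet_mem_closure hT hd.memLp hd.weakGrad)
  · rw [inner_toLp, integral_inner_extZero] at key
    have h1 : ∫ z, inner ℝ (L z) (extZero T w z) ∂(muCyl m α T)
        = ∫ z, inner ℝ (L z) (w z) ∂(muCyl m α T) := by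
      refine integral_congr_ae ?_
      filter_upwards [extZero_ae_eq (α := α) (T := T) w] with z hz
      rw [hz]
    rw [h1] at key
    refine key.congr_of_eventuallyEq (.of_forall fun s => ?_) ?_ <;>
    · simp only
      rw [shiftL2_toLp, inner_toLp]
      refine integral_congr_ae (.of_forall fun z => ?_)
      simp only [inner_liftJet, mdot_eq_inner, Function.comp_apply]
      congr 1
      simp only [extZero, indicator]
      split_ifs <;> rfl
  · intro φ hφ
    rw [integral_inner_extZero, ← hd.timeDeriv φ hφ,
      integral_muCyl_eq (T := T) fun z hz => by rw [hφ.dt_eq_zero hz, inner_zero_right]]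
    congr 1
    refine integral_congr_ae ?_
    filter_upwards [extZero_ae_eq (α := α) (T := T) fun z => w z none] with z hz
    rw [hz, mdot_eq_inner]

lemma le_of_hasDerivWithinAt_of_le {f g : ℝ → ℝ} {a b : ℝ} (hf : HasDerivWithinAt f a (Ici 0) 0)
    (hg : HasDerivWithinAt g b (Ici 0) 0) (h0 : f 0 = g 0) (hfg : ∀ h > 0, f h ≤ g h) : a ≤ b := by
  have hf' := (hasDerivWithinAt_iff_tendsto_slope' (by simp)).1 (hf.mono Ioi_subset_Ici_self)
  have hg' := (hasDerivWithinAt_iff_tendsto_slope' (by simp)).1 (hg.mono Ioi_subset_Ici_self)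
  refine le_of_tendsto_of_tendsto hf' hg' ?_
  filter_upwards [self_mem_nhdsWithin] with h hh
  have hh : 0 < h := hh
  simp only [slope_def_field, h0]
  gcongr
  exact hfg h hh

/-- A quadratic increment grows only to first order because of the jump of the extension at `t = T`.
For smooth `u` and finite `T` the derivative is the energy at time `T`. -/
lemma EnergyData.hasDerivWithinAt_increment (hd : EnergyData α T a₀ w L) (ha : SymCoeff α κ a₀)
    (hT : ⊥ < T) :
    HasDerivWithinAt (fun s => ∫ z, mdot (a₀ z.2)
        (extZero T (fun z => w z none) z - extZero T (fun z => w z none) (shift m s z))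
        (extZero T (fun z => w z none) z - extZero T (fun z => w z none) (shift m s z))
          ∂(muCyl m α ⊤))
      (2 * ∫ z, inner ℝ (L z) (w z) ∂(muCyl m α T)) (Ici 0) 0 := by
  have hu : MemLp (extZero T fun z => w z none) 2 (muCyl m α ⊤) :=
    memLp_extZero (memLp_jet_apply hd.memLp none)
  simp_rw [← ha.two_mul_integral_sub hu]
  simpa using ((hd.hasDerivWithinAt ha hT).const_sub _).const_mul 2

/-- The pairing of `u` with its time derivative is nonnegative. -/
theorem EnergyData.integral_nonneg (hd : EnergyData α T a₀ w L) (ha : SymCoeff α κ a₀)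
    (hκ : 0 ≤ κ) (hT : ⊥ < T) : 0 ≤ ∫ z, inner ℝ (L z) (w z) ∂(muCyl m α T) := by
  have h := le_of_hasDerivWithinAt_of_le (hasDerivWithinAt_const 0 (Ici 0) (0 : ℝ))
    (hd.hasDerivWithinAt_increment ha hT) ?_ ?_
  · linarith
  · have : shift m 0 = id := by ext z <;> simp [shift]
    simp [this, mdot_eq_inner]
  · intro s _
    refine integral_nonneg_of_ae ?_
    filter_upwards [ha.mdot_nonneg_ae hκ] with z hz
    exact hz _

/-- The energy `∫ a₀ u · u` at time `τ` is bounded by the pairing of `u` with its time derivative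
on `(-∞, τ)`. -/
theorem EnergyData.ae_energy_le (hd : EnergyData α T a₀ w L) (ha : SymCoeff α κ a₀)
    (hκ : 0 ≤ κ) :
    ∀ᵐ τ : ℝ, τ ∈ timeRay T →
      ∫ x, mdot (a₀ x) (w (τ, x) none) (w (τ, x) none) ∂(muSpace m α)
        ≤ 2 * ∫ z, inner ℝ (L z) (w z) ∂(muCyl m α (τ : EReal)) := by
  set u : ℝ × Sp m → Val n := extZero T fun z => w z none with hu_def
  have hu : MemLp u 2 (muCyl m α ⊤) := memLp_extZero (memLp_jet_apply hd.memLp none)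
  have hprod : muCyl m α ⊤ = volume.prod (muSpace m α) := by
    rw [muCyl_eq_prod, timeRay_top, Measure.restrict_univ]
  have hintg : Integrable (fun z : ℝ × Sp m => mdot (a₀ z.2) (u z) (u z))
      (volume.prod (muSpace m α)) := by
    rw [← hprod]; exact ha.integrable_mdot hu hu
  set Q : ℝ → ℝ := fun t => ∫ x, mdot (a₀ x) (u (t, x)) (u (t, x)) ∂(muSpace m α) with hQ_def
  have hQ : Integrable Q volume := hintg.integral_prod_left
  -- At a Lebesgue point `τ` of `Q`, the mean of `Q` over `(τ - h, τ)` tends to `Q τ`.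
  filter_upwards [LocallyIntegrable.ae_hasDerivAt_integral hQ.locallyIntegrable] with τ hτ hτT
  have hτT' : (τ : EReal) ≤ T := le_of_lt hτT
  have hder : HasDerivWithinAt (fun h => ∫ t in (τ - h)..τ, Q t) (Q τ) (Ici 0) 0 := by
    have h1 : HasDerivAt (fun h : ℝ => τ - h) (-1) 0 := by
      simpa using (hasDerivAt_id (0 : ℝ)).const_sub τ
    have h2 : HasDerivAt (fun h : ℝ => ∫ t in τ..(τ - h), Q t) (Q τ * -1) 0 := by
      refine HasDerivAt.comp (h₂ := fun x => ∫ t in τ..x, Q t) (h := fun h : ℝ => τ - h) 0 ?_ h1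
      simpa using hτ τ
    have h3 := h2.neg
    have h4 : (fun h : ℝ => ∫ t in (τ - h)..τ, Q t) = -fun h : ℝ => ∫ t in τ..(τ - h), Q t := by
      ext h; rw [Pi.neg_apply, intervalIntegral.integral_symm]
    rw [h4]
    simpa using h3.hasDerivWithinAt
  have hQτ : Q τ = ∫ x, mdot (a₀ x) (w (τ, x) none) (w (τ, x) none) ∂(muSpace m α) := by
    simp only [hQ_def, hu_def]
    refine integral_congr_ae (.of_forall fun x => ?_)
    simp only
    rw [extZero_of_mem hτT]
  rw [← hQτ]
  -- Restriction to `t < τ` creates the jump at `τ` that the increment detects.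
  have hd' := hd.restrict hτT'
  have hu' : MemLp (extZero (τ : EReal) fun z => w z none) 2 (muCyl m α ⊤) :=
    memLp_extZero (memLp_jet_apply hd'.memLp none)
  refine le_of_hasDerivWithinAt_of_le hder
    (hd'.hasDerivWithinAt_increment ha (EReal.bot_lt_coe τ)) ?_ ?_
  · have : shift m 0 = id := by ext z <;> simp [shift]
    simp [this, mdot_eq_inner]
  · intro h hh
    set v : ℝ × Sp m → Val n := extZero (τ : EReal) fun z => w z none with hv_def
    have hvs : MemLp (fun z => v z - v (shift m h z)) 2 (muCyl m α ⊤) :=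
      hu'.sub (hu'.comp_measurePreserving (measurePreserving_shift α h))
    have hslab : MeasurableSet (Ioo (τ - h) τ ×ˢ (univ : Set (Sp m))) :=
      measurableSet_Ioo.prod MeasurableSet.univ
    have e1 : ∫ t in (τ - h)..τ, Q t
        = ∫ z in Ioo (τ - h) τ ×ˢ univ, mdot (a₀ z.2) (u z) (u z) ∂(muCyl m α ⊤) := by
      rw [intervalIntegral.integral_of_le (by linarith), integral_Ioc_eq_integral_Ioo, hprod,
        setIntegral_prod _ hintg.integrableOn]
      simp [hQ_def]
    rw [e1]
    calc ∫ z in Ioo (τ - h) τ ×ˢ univ, mdot (a₀ z.2) (u z) (u z) ∂(muCyl m α ⊤)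
        = ∫ z in Ioo (τ - h) τ ×ˢ univ, mdot (a₀ z.2) (v z - v (shift m h z))
            (v z - v (shift m h z)) ∂(muCyl m α ⊤) := by
          refine setIntegral_congr_fun hslab fun z hz => ?_
          have hz1 : τ - h < z.1 ∧ z.1 < τ := hz.1
          have h1 : v z = w z none := extZero_of_mem (by simpa using hz1.2)
          have h2 : u z = w z none :=
            extZero_of_mem (timeRay_mono hτT' (by simpa using hz1.2))
          -- On the last slab the translate by `h` lies past `τ`. The rest of the increment integral
          -- is dropped by positivity.
          have h3 : v (shift m h z) = 0 :=
            extZero_of_notMem (by simp only [shift, timeRay_coe, mem_Iio, not_lt]; linarith)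
          simp only [h1, h2, h3, sub_zero]
      _ ≤ _ := by
          refine setIntegral_le_integral (ha.integrable_mdot hvs hvs) ?_
          filter_upwards [ha.mdot_nonneg_ae hκ] with z hz
          exact hz _

end Energy

/-! ### Differences and translates -/

section LocalPairing

variable {m n : ℕ} {α : ℝ} {T : EReal}

/-- The density of Lebesgue measure with respect to the weighted measure. -/
def invWeight (m : ℕ) (α : ℝ) (z : ℝ × Sp m) : ℝ := z.2 (Fin.last m) ^ (-α)

/-- Weak gradients are defined with Lebesgue measure, all norms with `μ`. A function with compact
support in `Ω_T` stays away from `x_d = 0`, so `x_d ^ (-α) g` is bounded and mediates between the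
two. -/
lemma memLp_invWeight_mul [IsLocallyFiniteMeasure (muCyl m α ⊤)] {g : ℝ × Sp m → ℝ}
    (hg : Continuous g) (hgc : HasCompactSupport g) (hgT : tsupport g ⊆ cyl m T) :
    MemLp (fun z => invWeight m α z * g z) 2 (muCyl m α T) := by
  have hcont : ContinuousOn (fun z => invWeight m α z * g z) (tsupport g) := by
    refine ContinuousOn.mul ?_ hg.continuousOn
    refine ContinuousOn.rpow_const (by fun_prop) fun z hz => Or.inl ?_
    exact ne_of_gt (hgT hz).2
  obtain ⟨C, hC⟩ := hgc.isCompact.exists_bound_of_continuousOn hcont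
  have hmeas : Measurable fun z => invWeight m α z * g z := by
    have : Measurable fun z : ℝ × Sp m => z.2 (Fin.last m) := by fun_prop
    exact (this.pow_const _).mul hg.measurable
  refine MemLp.of_le (memLp_indicator_const 2 hgc.isCompact.measurableSet C
    (Or.inr hgc.isCompact.measure_lt_top.ne)) hmeas.aestronglyMeasurable (.of_forall fun z => ?_)
  by_cases hz : z ∈ tsupport g
  · rw [indicator_of_mem hz]; exact (hC z hz).trans (le_abs_self C)
  · rw [image_eq_zero_of_notMem_tsupport hz]; simp

variable {E : Type*} [NormedAddCommGroup E] [InnerProductSpace ℝ E] {g : ℝ × Sp m → ℝ}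
  {y : ℝ × Sp m → E}

lemma weight_smul_ae (g : ℝ × Sp m → ℝ) (y : ℝ × Sp m → E) :
    (fun z : ℝ × Sp m => (ENNReal.ofReal (z.2 (Fin.last m) ^ α)).toReal •
      ((invWeight m α z * g z) • y z)) =ᵐ[volume.restrict (cyl m T)] fun z => g z • y z := by
  filter_upwards [ae_restrict_mem (isOpen_cyl m T).measurableSet] with z hz
  have hz : 0 < z.2 (Fin.last m) := hz.2
  rw [ENNReal.toReal_ofReal (by positivity), smul_smul, invWeight, Real.rpow_neg hz.le,
    ← mul_assoc, mul_inv_cancel₀ (by positivity), one_mul]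

lemma integrable_invWeight_smul [IsLocallyFiniteMeasure (muCyl m α ⊤)]
    (hg : Continuous g) (hgc : HasCompactSupport g) (hgT : tsupport g ⊆ cyl m T)
    (hy : MemLp y 2 (muCyl m α T)) :
    Integrable (fun z => (invWeight m α z * g z) • y z) (muCyl m α T) := by
  have := (memLp_invWeight_mul (α := α) hg hgc hgT)
  exact memLp_one_iff_integrable.1 (hy.smul this)

lemma integrable_smul_of_memLp [IsLocallyFiniteMeasure (muCyl m α ⊤)]
    (hg : Continuous g) (hgc : HasCompactSupport g) (hgT : tsupport g ⊆ cyl m T)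
    (hy : MemLp y 2 (muCyl m α T)) : IntegrableOn (fun z => g z • y z) (cyl m T) := by
  have h1 := integrable_invWeight_smul hg hgc hgT hy
  rw [muCyl, integrable_withDensity_iff_integrable_smul' (measurable_weight_cyl m α)
    (.of_forall fun _ => ENNReal.ofReal_lt_top)] at h1
  exact h1.congr (weight_smul_ae g y)

lemma setIntegral_smul_eq (g : ℝ × Sp m → ℝ) (y : ℝ × Sp m → E) :
    ∫ z in cyl m T, g z • y z = ∫ z, (invWeight m α z * g z) • y z ∂(muCyl m α T) := by
  rw [muCyl, integral_withDensity_eq_integral_toReal_smul (measurable_weight_cyl m α)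
    (.of_forall fun _ => ENNReal.ofReal_lt_top), integral_congr_ae (weight_smul_ae g y)]

lemma HasWeakGrad.sub [IsLocallyFiniteMeasure (muCyl m α ⊤)] {u v : ℝ × Sp m → Val n}
    {Du Dv : Fin (m + 1) → ℝ × Sp m → Val n} (hu : HasWeakGrad T u Du) (hv : HasWeakGrad T v Dv)
    (hu2 : MemLp u 2 (muCyl m α T)) (hv2 : MemLp v 2 (muCyl m α T))
    (hDu : ∀ i, MemLp (Du i) 2 (muCyl m α T)) (hDv : ∀ i, MemLp (Dv i) 2 (muCyl m α T)) :
    HasWeakGrad T (fun z => u z - v z) fun i z => Du i z - Dv i z := by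
  intro i ψ hψ
  have h1 : ∀ y : ℝ × Sp m → Val n, MemLp y 2 (muCyl m α T) →
      IntegrableOn (fun z => ψ z • y z) (cyl m T) := fun y hy =>
    integrable_smul_of_memLp hψ.1.continuous hψ.2.1 hψ.2.2 hy
  have h2 : ∀ y : ℝ × Sp m → Val n, MemLp y 2 (muCyl m α T) →
      IntegrableOn (fun z => dx i ψ z • y z) (cyl m T) := fun y hy =>
    integrable_smul_of_memLp (hψ.continuous_fderiv_apply _) (hψ.hasCompactSupport_fderiv_apply _)
      ((closure_minimal (support_fderiv_apply_subset _) (isClosed_tsupport ψ)).trans hψ.2.2) hy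
  simp_rw [smul_sub]
  rw [integral_sub (h2 u hu2) (h2 v hv2), integral_sub (h1 _ (hDu i)) (h1 _ (hDv i)), hu i ψ hψ,
    hv i ψ hψ]
  abel

end LocalPairing

section Translates

variable {m n : ℕ} {α κ : ℝ} {T : EReal} {a₀ : Sp m → Matrix (Fin n) (Fin n) ℝ}
  {w w' L L' : ℝ × Sp m → Jet m n}

lemma EnergyData.sub [IsLocallyFiniteMeasure (muCyl m α ⊤)] (ha : SymCoeff α κ a₀)
    (hd : EnergyData α T a₀ w L) (hd' : EnergyData α T a₀ w' L') :
    EnergyData α T a₀ (fun z => w z - w' z) fun z => L z - L' z where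
  memLp := hd.memLp.sub hd'.memLp
  memLp' := hd.memLp'.sub hd'.memLp'
  weakGrad := hd.weakGrad.sub hd'.weakGrad (memLp_jet_apply hd.memLp _)
    (memLp_jet_apply hd'.memLp _) (fun _ => memLp_jet_apply hd.memLp _)
    fun _ => memLp_jet_apply hd'.memLp _
  timeDeriv φ hφ := by
    have h1 : MemLp (dt φ) 2 (muCyl m α T) := hφ.memLp_fderiv_apply (muCyl m α T) (1, 0)
    have h2 := hφ.memLp_jet (muCyl m α T)
    have e1 : ∀ z, mdot (a₀ z.2) ((w z - w' z) none) (dt φ z)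
        = mdot (a₀ z.2) (w z none) (dt φ z) - mdot (a₀ z.2) (w' z none) (dt φ z) := fun z => by
      simp [mdot_eq_inner, mv_sub, inner_sub_left]
    simp_rw [e1, inner_sub_left]
    rw [integral_sub (ha.integrable_mdot (memLp_jet_apply hd.memLp none) h1)
      (ha.integrable_mdot (memLp_jet_apply hd'.memLp none) h1),
      integral_sub (integrable_inner_of_memLp hd.memLp' h2)
        (integrable_inner_of_memLp hd'.memLp' h2), ← hd.timeDeriv φ hφ, ← hd'.timeDeriv φ hφ]
    ring

lemma shift_eq_add (s : ℝ) (z : ℝ × Sp m) : shift m s z = z + (s, 0) := by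
  simp [shift, Prod.add_def]

lemma measurableEmbedding_shift (s : ℝ) : MeasurableEmbedding (shift m s) := by
  have : shift m s = Homeomorph.addRight ((s, 0) : ℝ × Sp m) := by
    ext z <;> simp [shift]
  rw [this]
  exact (Homeomorph.addRight _).measurableEmbedding

lemma integral_comp_shift {E : Type*} [NormedAddCommGroup E] [NormedSpace ℝ E] (s : ℝ)
    (f : ℝ × Sp m → E) : ∫ z, f (shift m s z) ∂(muCyl m α ⊤) = ∫ z, f z ∂(muCyl m α ⊤) :=
  (measurePreserving_shift α s).integral_comp (measurableEmbedding_shift s) f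

@[simp] lemma shift_shift_neg (s : ℝ) (z : ℝ × Sp m) : shift m (-s) (shift m s z) = z := by
  simp [shift]

lemma shift_snd (s : ℝ) (z : ℝ × Sp m) : (shift m s z).2 = z.2 := rfl

lemma shift_neg_mem {z : ℝ × Sp m} {s : ℝ} (hs : 0 ≤ s) (hz : z.1 ∈ timeRay T) :
    (shift m (-s) z).1 ∈ timeRay T := by
  refine lt_of_le_of_lt (EReal.coe_le_coe_iff.2 ?_) hz
  simp only [shift]; linarith

lemma memLp_comp_shift_neg {E : Type*} [NormedAddCommGroup E] {f : ℝ × Sp m → E} {s : ℝ}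
    (hs : 0 ≤ s) (hf : MemLp f 2 (muCyl m α T)) :
    MemLp (fun z => f (shift m (-s) z)) 2 (muCyl m α T) := by
  have h1 := ((memLp_extZero hf).comp_measurePreserving
    (measurePreserving_shift α (-s))).mono_measure (muCyl_mono (m := m) (α := α) (le_top (a := T)))
  refine h1.ae_eq ?_
  filter_upwards [ae_mem_cyl m α T] with z hz
  exact extZero_of_mem (shift_neg_mem hs hz.1)

lemma IsTest.shift_cyl {V : Type*} [NormedAddCommGroup V] [NormedSpace ℝ V] {ψ : ℝ × Sp m → V}
    (hψ : IsTest (cyl m T) ψ) {s : ℝ} (hs : 0 ≤ s) : IsTest (cyl m T) (ψ ∘ WeightedParabolic.shift m s) := by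
  have h1 : IsTest (timeRay T ×ˢ univ) (ψ ∘ WeightedParabolic.shift m s) :=
    (hψ.mono (prod_mono subset_rfl (subset_univ _))).shift hs
  refine ⟨h1.1, h1.2.1, fun z hz => ⟨(h1.2.2 hz).1, ?_⟩⟩
  exact (hψ.2.2 (tsupport_comp_subset_preimage ψ (continuous_shift s) hz)).2

lemma HasWeakGrad.comp_shift_neg {u : ℝ × Sp m → Val n} {Du : Fin (m + 1) → ℝ × Sp m → Val n}
    (hu : HasWeakGrad T u Du) {s : ℝ} (hs : 0 ≤ s) :
    HasWeakGrad T (fun z => u (shift m (-s) z)) fun i z => Du i (shift m (-s) z) := by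
  intro i ψ hψ
  have h1 := hu i _ (hψ.shift_cyl hs)
  have hψT := hψ.shift_cyl hs
  rw [setIntegral_eq_integral_of_forall_compl_eq_zero (fun t ht => by
      rw [show dx i (ψ ∘ shift m s) t = 0 from hψT.fderiv_apply_eq_zero _ ht, zero_smul]),
    setIntegral_eq_integral_of_forall_compl_eq_zero (fun t ht => by
      rw [hψT.eq_zero_of_notMem ht, zero_smul])] at h1
  rw [setIntegral_eq_integral_of_forall_compl_eq_zero (fun t ht => by
      rw [show dx i ψ t = 0 from hψ.fderiv_apply_eq_zero _ ht, zero_smul]),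
    setIntegral_eq_integral_of_forall_compl_eq_zero (fun t ht => by
      rw [hψ.eq_zero_of_notMem ht, zero_smul])]
  rw [← integral_add_right_eq_self (fun z => dx i ψ z • u (shift m (-s) z)) ((s, 0) : ℝ × Sp m),
    ← integral_add_right_eq_self (fun z => ψ z • Du i (shift m (-s) z)) ((s, 0) : ℝ × Sp m)]
  simpa only [← shift_eq_add, shift_shift_neg, dx_comp_shift, Function.comp_apply] using h1

/-- A delay by `s ≥ 0` uses only past values. The same `a₀` serves since it is independent of `t`;
`A` and `C₀` enter only through `L`, so their dependence on time does no harm. -/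
lemma EnergyData.comp_shift_neg (hd : EnergyData α T a₀ w L) {s : ℝ} (hs : 0 ≤ s) :
    EnergyData α T a₀ (fun z => w (shift m (-s) z)) fun z => L (shift m (-s) z) where
  memLp := memLp_comp_shift_neg hs hd.memLp
  memLp' := memLp_comp_shift_neg hs hd.memLp'
  weakGrad := hd.weakGrad.comp_shift_neg hs
  timeDeriv φ hφ := by
    have hφs := hφ.shift hs
    have h1 := hd.timeDeriv _ hφs
    rw [← integral_muCyl_eq (T := T) fun z hz => by rw [hφs.dt_eq_zero hz, mdot_zero_right],
      ← integral_muCyl_eq (T := T) fun z hz => by rw [hφs.jet_eq_zero hz, inner_zero_right]] at h1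
    rw [← integral_muCyl_eq (T := T) fun z hz => by rw [hφ.dt_eq_zero hz, mdot_zero_right],
      ← integral_muCyl_eq (T := T) fun z hz => by rw [hφ.jet_eq_zero hz, inner_zero_right],
      ← integral_comp_shift s, ← integral_comp_shift s (fun z => inner ℝ (L (shift m (-s) z)) (jet φ z))]
    simpa only [shift_shift_neg, shift_snd, dt_comp_shift, jet_comp_shift, Function.comp_apply] using h1

end Translates

/-! ### A modulus of continuity in time. -/

section Modulus

variable {m n : ℕ} {α κ : ℝ} {T : EReal} {a₀ : Sp m → Matrix (Fin n) (Fin n) ℝ}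
  {w L : ℝ × Sp m → Jet m n}

lemma ae_memLp_slice {E : Type*} [NormedAddCommGroup E] {f : ℝ × Sp m → E}
    (hf : MemLp f 2 (muCyl m α T)) :
    ∀ᵐ t : ℝ, t ∈ timeRay T → MemLp (fun x => f (t, x)) 2 (muSpace m α) := by
  rw [← ae_restrict_iff' (isOpen_timeRay T).measurableSet]
  have hf' := hf
  rw [muCyl_eq_prod] at hf
  have h2 := lintegral_sq_lt_top hf
  rw [lintegral_prod _ (hf.1.enorm.pow_const 2)] at h2
  filter_upwards [hf.1.prodMk_left, ae_lt_top' (hf.1.enorm.pow_const 2).lintegral_prod_right' h2.ne]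
    with t h3 h4
  refine ⟨h3, ?_⟩
  rw [eLpNorm_two_eq]
  exact ENNReal.rpow_lt_top_of_nonneg (by norm_num) h4.ne

lemma SymCoeff.eLpNorm_le (ha : SymCoeff α κ a₀) (hκ : 0 < κ) {v : Sp m → Val n}
    (hv : MemLp v 2 (muSpace m α)) {R : ℝ}
    (hR : ∫ x, mdot (a₀ x) (v x) (v x) ∂(muSpace m α) ≤ R) :
    eLpNorm v 2 (muSpace m α) ≤ ENNReal.ofReal (√(R / κ)) := by
  have h1 : Integrable (fun x => mdot (a₀ x) (v x) (v x)) (muSpace m α) := by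
    simp_rw [mdot_eq_inner]
    exact integrable_inner_of_memLp (WeightedParabolic.memLp_mv ha.meas ha.bounded hv) hv
  have h2 : κ * ∫ x, ‖v x‖ ^ 2 ∂(muSpace m α) ≤ R := by
    rw [← integral_const_mul]
    refine (integral_mono_ae ?_ h1 ?_).trans hR
    · exact (hv.integrable_norm_pow (by simp)).const_mul κ
    · filter_upwards [ha.posdef] with x hx using hx _
  rw [← norm_sq_toLp hv] at h2
  have h3 : ‖hv.toLp v‖ ≤ √(R / κ) := by
    refine Real.le_sqrt_of_sq_le ?_
    rw [le_div_iff₀ hκ]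
    linarith
  rw [Lp.norm_toLp] at h3
  rw [← ENNReal.ofReal_toReal hv.2.ne]
  exact ENNReal.ofReal_le_ofReal h3

variable [IsLocallyFiniteMeasure (muCyl m α ⊤)]

/-- Time increments are uniformly small in `L_2(ℝ^d_+, μ)`. -/
theorem EnergyData.exists_modulus (hd : EnergyData α T a₀ w L) (ha : SymCoeff α κ a₀)
    (hκ : 0 < κ) :
    ∃ ρ : ℝ → ℝ, Continuous ρ ∧ ρ 0 = 0 ∧ ∀ h ≥ 0, ∀ᵐ τ : ℝ, τ ∈ timeRay T →
      eLpNorm (fun x => w (τ, x) none - w (τ - h, x) none) 2 (muSpace m α)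
        ≤ ENNReal.ofReal (ρ h) := by
  set W := (memLp_extZero hd.memLp).toLp _ with hW
  set Λ := (memLp_extZero hd.memLp').toLp _ with hΛ
  have hcont : ∀ v : JetL2 m n α, Continuous fun h : ℝ => ‖v - shiftL2 m n α (-h) v‖ := by
    intro v
    have h1 : Continuous fun h : ℝ => shiftL2 m n α (-h) v :=
      continuous_shiftL2.comp (by fun_prop : Continuous fun h : ℝ => (v, -h))
    exact (continuous_const.sub h1).norm
  -- The energy inequality for the increment and Cauchy–Schwarz give `κ ‖u(τ) - u(τ - h)‖² ≤ 2 ‖ΔΛ‖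
  -- ‖ΔW‖`, uniformly in `τ`. The right-hand side tends to `0` by continuity of translations in
  -- `L_2`.
  refine ⟨fun h => √(2 * (‖Λ - shiftL2 m n α (-h) Λ‖ * ‖W - shiftL2 m n α (-h) W‖) / κ), ?_, ?_, ?_⟩
  · exact (((continuous_const.mul ((hcont Λ).mul (hcont W)))).div_const κ).sqrt
  · simp [shiftL2_zero]
  intro h hh
  have hd' := hd.sub ha (hd.comp_shift_neg hh)
  have hsl := ae_memLp_slice (memLp_jet_apply hd'.memLp none)
  filter_upwards [hd'.ae_energy_le ha hκ.le, hsl] with τ h1 h2 hτ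
  have e : ∀ x, shift m (-h) (τ, x) = (τ - h, x) := fun x => by simp [shift, sub_eq_add_neg]
  have h3 := h2 hτ
  have h4 := h1 hτ
  simp only [e, PiLp.sub_apply] at h3 h4
  refine ha.eLpNorm_le hκ h3 (h4.trans ?_)
  have hτT : (τ : EReal) ≤ T := le_of_lt hτ
  have hdτ := hd'.restrict hτT
  -- Cutting the increment off at `τ` only decreases its norm; the increment of the extension past
  -- `T` only adds mass.
  have key : ∀ f : ℝ × Sp m → Jet m n, ∀ hf : MemLp f 2 (muCyl m α T),
      ∀ hfτ : MemLp (fun z => f z - f (shift m (-h) z)) 2 (muCyl m α (τ : EReal)),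
      ‖(memLp_extZero hfτ).toLp _‖
        ≤ ‖(memLp_extZero hf).toLp _ - shiftL2 m n α (-h) ((memLp_extZero hf).toLp _)‖ := by
    intro f hf hfτ
    rw [shiftL2_toLp, ← MemLp.toLp_sub, Lp.norm_toLp, Lp.norm_toLp]
    refine ENNReal.toReal_mono ?_ (eLpNorm_mono fun z => ?_)
    · exact ((memLp_extZero hf).sub ((memLp_extZero hf).comp_measurePreserving
        (measurePreserving_shift α (-h)))).2.ne
    · by_cases hz : z.1 ∈ timeRay (τ : EReal)
      · have hzT := timeRay_mono hτT hz
        rw [extZero_of_mem hz, Pi.sub_apply, Function.comp_apply, extZero_of_mem hzT,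
          extZero_of_mem (shift_neg_mem hh hzT)]
      · rw [extZero_of_notMem hz]; simp
  have h5 : ∫ z, inner ℝ (L z - L (shift m (-h) z)) (w z - w (shift m (-h) z))
      ∂(muCyl m α (τ : EReal)) = inner ℝ ((memLp_extZero hdτ.memLp').toLp _)
        ((memLp_extZero hdτ.memLp).toLp _) := by
    rw [inner_toLp, integral_inner_extZero]
    refine integral_congr_ae ?_
    filter_upwards [extZero_ae_eq (α := α) (T := τ) fun z => w z - w (shift m (-h) z)] with z hz
    rw [hz]
  rw [h5]
  gcongr
  refine (real_inner_le_norm _ _).trans ?_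
  exact mul_le_mul (key L hd.memLp' hdτ.memLp') (key w hd.memLp hdτ.memLp) (norm_nonneg _)
    (norm_nonneg _)

end Modulus

/-! ### The continuous version -/

section Version

variable {m n : ℕ} {α : ℝ} {T : EReal}

lemma measurable_eLpNorm_slice_sub {E : Type*} [NormedAddCommGroup E] {v : ℝ × Sp m → E}
    (hv : StronglyMeasurable v) :
    Measurable fun p : ℝ × ℝ =>
      eLpNorm (fun x => v (p.1, x) - v (p.1 - p.2, x)) 2 (muSpace m α) := by
  simp_rw [eLpNorm_two_eq]
  refine Measurable.pow_const (Measurable.lintegral_prod_right' (f := fun q : (ℝ × ℝ) × Sp m =>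
    ‖v (q.1.1, q.2) - v (q.1.1 - q.1.2, q.2)‖ₑ ^ 2) ?_) _
  refine Measurable.pow_const (StronglyMeasurable.enorm ?_) 2
  exact (hv.comp_measurable (by fun_prop)).sub (hv.comp_measurable (by fun_prop))

/-- A function whose time increments are uniformly small in `L_2(ℝ^d_+, μ)`, and which is bounded
with values in that space, has a bounded continuous version. -/
theorem exists_isVersion {v : ℝ × Sp m → Val n} (hv : MemLp v 2 (muCyl m α T))
    {ρ : ℝ → ℝ} (hρ : Continuous ρ) (hρ0 : ρ 0 = 0)
    (hmod : ∀ h ≥ 0, ∀ᵐ τ : ℝ, τ ∈ timeRay T →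
      eLpNorm (fun x => v (τ, x) - v (τ - h, x)) 2 (muSpace m α) ≤ ENNReal.ofReal (ρ h))
    {R : ℝ} (hR : 0 ≤ R) (hbound : ∀ᵐ τ : ℝ, τ ∈ timeRay T →
      eLpNorm (fun x => v (τ, x)) 2 (muSpace m α) ≤ ENNReal.ofReal R) :
    ∃ U : closure (timeRay T) →ᵇ Lp (Val n) 2 (muSpace m α), IsVersion α T v U ∧
      ∀ t, ‖U t‖ ≤ R := by
  obtain ⟨u, hum, hvu⟩ := hv.1
  have hslice : ∀ᵐ t : ℝ, t ∈ timeRay T → (fun x => v (t, x)) =ᵐ[muSpace m α] fun x => u (t, x) := by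
    rw [← ae_restrict_iff' (isOpen_timeRay T).measurableSet]
    rw [muCyl_eq_prod] at hvu
    exact Measure.ae_ae_of_ae_prod hvu
  -- In `hmod` the null set of times depends on `h`. Tonelli exchanges the quantifiers, at the price
  -- of controlling only almost every `h` for a given `τ`.
  have hmod' : ∀ᵐ τ : ℝ, ∀ᵐ h : ℝ, τ ∈ timeRay T → 0 ≤ h →
      eLpNorm (fun x => u (τ, x) - u (τ - h, x)) 2 (muSpace m α) ≤ ENNReal.ofReal (ρ h) := by
    refine (Measure.ae_ae_comm (μ := (volume : Measure ℝ)) (ν := (volume : Measure ℝ))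
      (p := fun τ h => τ ∈ timeRay T → 0 ≤ h →
        eLpNorm (fun x => u (τ, x) - u (τ - h, x)) 2 (muSpace m α) ≤ ENNReal.ofReal (ρ h)) ?_).2 ?_
    · have h1 : MeasurableSet {p : ℝ × ℝ | p.1 ∈ timeRay T} :=
        (isOpen_timeRay T).measurableSet.preimage measurable_fst
      have h2 : MeasurableSet {p : ℝ × ℝ | 0 ≤ p.2} := measurableSet_le measurable_const measurable_snd
      have h3 : MeasurableSet {p : ℝ × ℝ | eLpNorm (fun x => u (p.1, x) - u (p.1 - p.2, x)) 2
          (muSpace m α) ≤ ENNReal.ofReal (ρ p.2)} :=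
        measurableSet_le (measurable_eLpNorm_slice_sub hum)
          (hρ.measurable.comp measurable_snd).ennreal_ofReal
      exact h1.imp (h2.imp h3)
    · refine .of_forall fun h => ?_
      by_cases hh : 0 ≤ h
      swap
      · exact .of_forall fun τ _ h' => absurd h' hh
      have hshift : ∀ᵐ τ : ℝ, τ - h ∈ timeRay T →
          (fun x => v (τ - h, x)) =ᵐ[muSpace m α] fun x => u (τ - h, x) :=
        (measurePreserving_sub_right volume h).quasiMeasurePreserving.ae hslice
      filter_upwards [hmod h hh, hslice, hshift] with τ h1 h2 h3 hτ _
      have hτh : τ - h ∈ timeRay T :=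
        lt_of_le_of_lt (EReal.coe_le_coe_iff.2 (by linarith)) hτ
      exact (eLpNorm_congr_ae ((h2 hτ).sub (h3 hτh))).symm.le.trans (h1 hτ)
  set 𝒯 : Set ℝ := {t | t ∈ timeRay T ∧ MemLp (fun x => u (t, x)) 2 (muSpace m α) ∧
    (∀ᵐ h : ℝ, 0 ≤ h →
      eLpNorm (fun x => u (t, x) - u (t - h, x)) 2 (muSpace m α) ≤ ENNReal.ofReal (ρ h)) ∧
    eLpNorm (fun x => u (t, x)) 2 (muSpace m α) ≤ ENNReal.ofReal R ∧
    (fun x => v (t, x)) =ᵐ[muSpace m α] fun x => u (t, x)} with h𝒯_def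
  have h𝒯 : ∀ᵐ t : ℝ, t ∈ timeRay T → t ∈ 𝒯 := by
    filter_upwards [hmod', hslice, ae_memLp_slice hv, hbound] with t h1 h2 h3 h4 ht
    refine ⟨ht, (h3 ht).ae_eq (h2 ht), ?_, ?_, h2 ht⟩
    · filter_upwards [h1] with h h5 using h5 ht
    · rw [← eLpNorm_congr_ae (h2 ht)]; exact h4 ht
  have hclosure : closure (timeRay T) ⊆ closure 𝒯 := by
    refine closure_minimal ?_ isClosed_closure
    have hdense : Dense {t | t ∈ timeRay T → t ∈ 𝒯} := Measure.dense_of_ae h𝒯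
    refine (hdense.open_subset_closure_inter (isOpen_timeRay T)).trans (closure_mono ?_)
    rintro t ⟨h1, h2⟩
    exact h2 h1
  let f : ℝ → Lp (Val n) 2 (muSpace m α) := fun t =>
    open Classical in if h : MemLp (fun x => u (t, x)) 2 (muSpace m α) then h.toLp _ else 0
  have hf : ∀ t (ht : t ∈ 𝒯), f t = ht.2.1.toLp _ := fun t ht => dif_pos ht.2.1
  -- The increment `t - t'` may be exceptional, so both times are compared with an earlier `s ∈ (t'
  -- - δ, t')` that is generic for each of them.
  have hedist : ∀ t ∈ 𝒯, ∀ t' ∈ 𝒯, t' ≤ t → ∀ δ > 0, t - t' < δ →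
      ∃ h h', 0 ≤ h ∧ h < 2 * δ ∧ 0 ≤ h' ∧ h' < 2 * δ ∧
        edist (f t) (f t') ≤ ENNReal.ofReal (ρ h) + ENNReal.ofReal (ρ h') := by
    intro t ht t' ht' htt' δ hδ htδ
    have h1 : ∀ᵐ s : ℝ, 0 ≤ t - s → eLpNorm (fun x => u (t, x) - u (t - (t - s), x)) 2
        (muSpace m α) ≤ ENNReal.ofReal (ρ (t - s)) :=
      (Measure.measurePreserving_sub_left volume t).quasiMeasurePreserving.ae ht.2.2.1
    have h2 : ∀ᵐ s : ℝ, 0 ≤ t' - s → eLpNorm (fun x => u (t', x) - u (t' - (t' - s), x)) 2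
        (muSpace m α) ≤ ENNReal.ofReal (ρ (t' - s)) :=
      (Measure.measurePreserving_sub_left volume t').quasiMeasurePreserving.ae ht'.2.2.1
    obtain ⟨s, ⟨hs1, hs2⟩, hs3, hs4⟩ : ∃ s ∈ Ioo (t' - δ) t',
        (0 ≤ t - s → eLpNorm (fun x => u (t, x) - u (t - (t - s), x)) 2
          (muSpace m α) ≤ ENNReal.ofReal (ρ (t - s))) ∧
        (0 ≤ t' - s → eLpNorm (fun x => u (t', x) - u (t' - (t' - s), x)) 2
          (muSpace m α) ≤ ENNReal.ofReal (ρ (t' - s))) := by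
      obtain ⟨s, h3, h4⟩ := (Measure.dense_of_ae (h1.and h2)).exists_mem_open isOpen_Ioo
        (nonempty_Ioo.2 (by linarith : t' - δ < t'))
      exact ⟨s, h4, h3⟩
    refine ⟨t - s, t' - s, by linarith, by linarith, by linarith, by linarith, ?_⟩
    have h5 := hs3 (by linarith)
    have h6 := hs4 (by linarith)
    rw [sub_sub_cancel] at h5 h6
    rw [hf t ht, hf t' ht', Lp.edist_toLp_toLp]
    have hm : ∀ r, AEStronglyMeasurable (fun x => u (r, x)) (muSpace m α) := fun r =>
      (hum.comp_measurable (by fun_prop)).aestronglyMeasurable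
    calc eLpNorm ((fun x => u (t, x)) - fun x => u (t', x)) 2 (muSpace m α)
        = eLpNorm ((fun x => u (t, x) - u (s, x)) - fun x => u (t', x) - u (s, x)) 2
            (muSpace m α) := by
          congr 1; ext1 x; simp
      _ ≤ _ := (eLpNorm_sub_le ((hm t).sub (hm s)) ((hm t').sub (hm s)) (by norm_num)).trans
          (add_le_add h5 h6)
  have hunif : UniformContinuousOn f 𝒯 := by
    rw [EMetric.uniformContinuousOn_iff]
    intro ε hε
    have hε2 : 0 < ε / 2 := ENNReal.half_pos hε.ne'
    have hlim : Tendsto (fun h => ENNReal.ofReal (ρ h)) (𝓝 0) (𝓝 0) := by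
      have := (ENNReal.continuous_ofReal.comp hρ).tendsto 0
      simpa [hρ0, Function.comp_def] using this
    obtain ⟨δ, hδ, hδε⟩ := Metric.eventually_nhds_iff.1 (hlim.eventually (gt_mem_nhds hε2))
    have hsmall : ∀ t ∈ 𝒯, ∀ t' ∈ 𝒯, t' ≤ t → t - t' < δ / 2 → edist (f t) (f t') < ε := by
      intro t ht t' ht' h1 h2
      obtain ⟨h, h', a1, a2, a3, a4, a5⟩ := hedist t ht t' ht' h1 (δ / 2) (by positivity) h2
      refine a5.trans_lt ?_
      have b1 : ENNReal.ofReal (ρ h) < ε / 2 := hδε (by rw [Real.dist_0_eq_abs, abs_of_nonneg a1]; linarith)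
      have b2 : ENNReal.ofReal (ρ h') < ε / 2 := hδε (by rw [Real.dist_0_eq_abs, abs_of_nonneg a3]; linarith)
      calc _ < ε / 2 + ε / 2 := ENNReal.add_lt_add b1 b2
        _ = ε := ENNReal.add_halves ε
    refine ⟨ENNReal.ofReal (δ / 2), by simpa using hδ, ?_⟩
    intro t ht t' ht' htt'
    rw [edist_dist, ENNReal.ofReal_lt_ofReal_iff (by positivity), Real.dist_eq, abs_lt] at htt'
    rcases le_total t' t with h | h
    · exact hsmall t ht t' ht' h (by linarith)
    · rw [edist_comm]; exact hsmall t' ht' t ht h (by linarith)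
  -- Uniform continuity on the dense set of good times and completeness of `L_2` give limits on the
  -- whole closure, including `t = T` when `T` is finite.
  have hlim : ∀ x ∈ closure (timeRay T), ∃ y, Tendsto f (𝓝[𝒯] x) (𝓝 y) := by
    intro x hx
    have : (𝓝[𝒯] x).NeBot := mem_closure_iff_nhdsWithin_neBot.1 (hclosure hx)
    have h1 : Cauchy (𝓝[𝒯] x) := cauchy_nhds.mono nhdsWithin_le_nhds
    exact cauchy_iff_exists_le_nhds.1 (h1.map_of_le hunif (le_principal_iff.2 self_mem_nhdsWithin))
  have hcont : ContinuousOn (extendFrom 𝒯 f) (closure (timeRay T)) :=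
    continuousOn_extendFrom hclosure hlim
  have hnorm : ∀ x ∈ closure (timeRay T), ‖extendFrom 𝒯 f x‖ ≤ R := by
    intro x hx
    obtain ⟨y, hy⟩ := hlim x hx
    rw [extendFrom_eq (hclosure hx) hy]
    have : (𝓝[𝒯] x).NeBot := mem_closure_iff_nhdsWithin_neBot.1 (hclosure hx)
    refine le_of_tendsto hy.norm ?_
    filter_upwards [self_mem_nhdsWithin] with t ht
    rw [hf t ht, Lp.norm_toLp]
    exact ENNReal.toReal_le_of_le_ofReal hR ht.2.2.2.1
  refine ⟨BoundedContinuousFunction.ofNormedAddCommGroup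
    (fun t : closure (timeRay T) => extendFrom 𝒯 f t) (continuousOn_iff_continuous_domRestrict.1 hcont)
    R fun t => hnorm t t.2, ?_, fun t => hnorm t t.2⟩
  filter_upwards [h𝒯] with t ht htT
  have ht𝒯 := ht htT
  change (extendFrom 𝒯 f t : Lp (Val n) 2 (muSpace m α)) =ᵐ[muSpace m α] _
  rw [extendFrom_eq (subset_closure ht𝒯) (hunif.continuousOn t ht𝒯), hf t ht𝒯]
  exact (ht𝒯.2.1.coeFn_toLp).trans ht𝒯.2.2.2.2.symm

end Version

/-! ### The coefficient field -/

/-- The field `(λ C₀ u, A^{ij} D_j u)` at a jet `(u, Du)`. -/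
def co {m n : ℕ} (lam : ℝ)
    (A : Fin (m + 1) → Fin (m + 1) → ℝ × Sp m → Matrix (Fin n) (Fin n) ℝ)
    (C₀ : ℝ × Sp m → Matrix (Fin n) (Fin n) ℝ) (z : ℝ × Sp m) (y : Jet m n) : Jet m n :=
  WithLp.toLp 2 fun o => o.elim (lam • mv (C₀ z) (y none)) fun i => ∑ j, mv (A i j z) (y (some j))

/-- Measurability and boundedness of all the coefficients, up to null sets of the weighted
measure. -/
structure BddCoeff {m n : ℕ} (α K : ℝ) (T : EReal)
    (A : Fin (m + 1) → Fin (m + 1) → ℝ × Sp m → Matrix (Fin n) (Fin n) ℝ)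
    (C₀ : ℝ × Sp m → Matrix (Fin n) (Fin n) ℝ) : Prop where
  measA : ∀ i j k l, AEMeasurable (fun z => A i j z k l) (muCyl m α T)
  measC : ∀ k l, AEMeasurable (fun z => C₀ z k l) (muCyl m α T)
  bddA : ∀ i j, ∀ᵐ z ∂(muCyl m α T), matAbs (A i j z) ≤ K
  bddC : ∀ᵐ z ∂(muCyl m α T), matAbs (C₀ z) ≤ K

section Coefficients

variable {m n : ℕ} {α κ K lam : ℝ} {T : EReal}
  {A : Fin (m + 1) → Fin (m + 1) → ℝ × Sp m → Matrix (Fin n) (Fin n) ℝ}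
  {C₀ : ℝ × Sp m → Matrix (Fin n) (Fin n) ℝ}

lemma EllipticCoeff.bddCoeff (hA : EllipticCoeff κ T A) (hC : NondegCoeff κ (cyl m T) C₀) :
    BddCoeff α κ⁻¹ T A C₀ where
  measA i j k l := (hA.meas i j k l).mono_ac (muCyl_absolutelyContinuous m α T)
  measC k l := (hC.meas k l).mono_ac (muCyl_absolutelyContinuous m α T)
  bddA i j := by
    filter_upwards [(muCyl_absolutelyContinuous m α T).ae_le hA.bounded] with z hz using hz i j
  bddC := (muCyl_absolutelyContinuous m α T).ae_le hC.bounded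

lemma matAbs_transpose (M : Matrix (Fin n) (Fin n) ℝ) : matAbs Mᵀ = matAbs M := by
  rw [matAbs, matAbs, Finset.sum_comm]
  rfl

lemma BddCoeff.transpose (h : BddCoeff α K T A C₀) :
    BddCoeff α K T (fun i j z => (A j i z)ᵀ) fun z => (C₀ z)ᵀ where
  measA i j k l := h.measA j i l k
  measC k l := h.measC l k
  bddA i j := by simpa only [matAbs_transpose] using h.bddA j i
  bddC := by simpa only [matAbs_transpose] using h.bddC

lemma BddCoeff.memLp_co (h : BddCoeff α K T A C₀) {w : ℝ × Sp m → Jet m n}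
    (hw : MemLp w 2 (muCyl m α T)) : MemLp (fun z => co lam A C₀ z (w z)) 2 (muCyl m α T) := by
  refine MemLp.of_eval_piLp fun o => ?_
  cases o with
  | none => exact (memLp_mv h.measC h.bddC (memLp_jet_apply hw none)).const_smul lam
  | some i =>
    exact memLp_finsetSum Finset.univ fun j _ =>
      memLp_mv (h.measA i j) (h.bddA i j) (memLp_jet_apply hw (some j))

lemma inner_co (z : ℝ × Sp m) (y v : Jet m n) :
    inner ℝ (co lam A C₀ z y) v
      = (∑ i, ∑ j, mdot (A i j z) (y (some j)) (v (some i))) + lam * mdot (C₀ z) (y none) (v none) := by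
  rw [jet_inner]
  simp [co, mdot_eq_inner, sum_inner, inner_smul_left]

lemma mdot_transpose (M : Matrix (Fin n) (Fin n) ℝ) (v w : Val n) : mdot Mᵀ v w = mdot M w v := by
  rw [mdot, mdot, Matrix.mulVec_transpose, ← Matrix.dotProduct_mulVec, dotProduct_comm]

lemma inner_co_transpose (z : ℝ × Sp m) (y v : Jet m n) :
    inner ℝ y (co lam (fun i j z => (A j i z)ᵀ) (fun z => (C₀ z)ᵀ) z v)
      = inner ℝ (co lam A C₀ z y) v := by
  rw [real_inner_comm, inner_co, inner_co, Finset.sum_comm]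
  simp only [mdot_transpose]

lemma co_add (z : ℝ × Sp m) (y v : Jet m n) :
    co lam A C₀ z (y + v) = co lam A C₀ z y + co lam A C₀ z v := by
  ext1 o
  cases o with
  | none => simp [co, mv_add]
  | some i => simp [co, mv_add, Finset.sum_add_distrib]

lemma co_smul (z : ℝ × Sp m) (c : ℝ) (y : Jet m n) :
    co lam A C₀ z (c • y) = c • co lam A C₀ z y := by
  ext1 o
  cases o with
  | none => simp [co, mv_smul, smul_comm c]
  | some i => simp [co, mv_smul, Finset.smul_sum]

lemma inner_co_ge (hA : EllipticCoeff κ T A) (hC : NondegCoeff κ (cyl m T) C₀) (hlam : 0 ≤ lam) :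
    ∀ᵐ z ∂(muCyl m α T), ∀ y : Jet m n,
      κ * ((∑ i : Fin (m + 1), ‖y (some i)‖ ^ 2) + lam * ‖y none‖ ^ 2)
        ≤ inner ℝ (co lam A C₀ z y) y := by
  have hac := muCyl_absolutelyContinuous m α T
  filter_upwards [hac.ae_le hA.elliptic, hac.ae_le hC.posdef] with z h1 h2 y
  rw [inner_co]
  have h3 := h1 fun i => y (some i)
  have h4 := mul_le_mul_of_nonneg_left (h2 (y none)) hlam
  linarith

end Coefficients

/-! ### Weak solutions -/

section WeakSolutions

variable {m n : ℕ} {α κ K lam : ℝ} {T : EReal} {a₀ : Sp m → Matrix (Fin n) (Fin n) ℝ}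
  {A : Fin (m + 1) → Fin (m + 1) → ℝ × Sp m → Matrix (Fin n) (Fin n) ℝ}
  {C₀ : ℝ × Sp m → Matrix (Fin n) (Fin n) ℝ}
  {F : Fin (m + 1) → ℝ × Sp m → Val n} {f : ℝ × Sp m → Val n}
  {u : ℝ × Sp m → Val n} {Du : Fin (m + 1) → ℝ × Sp m → Val n}

/-- The field `(√λ f, F)`. -/
def srcJet (lam : ℝ) (F : Fin (m + 1) → ℝ × Sp m → Val n) (f : ℝ × Sp m → Val n) :
    ℝ × Sp m → Jet m n :=
  mkJet (fun z => √lam • f z) F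

lemma memLp_srcJet (hF : ∀ i, MemLp (F i) 2 (muCyl m α T)) (hf : MemLp f 2 (muCyl m α T)) :
    MemLp (srcJet lam F f) 2 (muCyl m α T) := by
  have h : MemLp (fun z => √lam • f z) 2 (muCyl m α T) := hf.const_smul (√lam)
  exact memLp_mkJet (u := fun z => √lam • f z) (Du := F) h hF

/-- With the spatial terms moved to the right, being a weak solution says that `srcJet - co`
represents the time derivative; the energy inequalities then need no knowledge of the equation. -/
lemma isWeakSol_iff [IsLocallyFiniteMeasure (muCyl m α ⊤)] (ha : SymCoeff α κ a₀)
    (hc : BddCoeff α K T A C₀) (hF : ∀ i, MemLp (F i) 2 (muCyl m α T))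
    (hf : MemLp f 2 (muCyl m α T)) (hu : MemLp u 2 (muCyl m α T))
    (hDu : ∀ i, MemLp (Du i) 2 (muCyl m α T)) :
    IsWeakSol α T lam a₀ A C₀ F f u Du ↔
      ∀ φ : ℝ × Sp m → Val n, IsTest (timeRay T ×ˢ univ) φ →
        - ∫ z, mdot (a₀ z.2) (u z) (dt φ z) ∂(muCyl m α T)
          = ∫ z, inner ℝ (srcJet lam F f z - co lam A C₀ z (mkJet u Du z)) (jet φ z)
            ∂(muCyl m α T) := by
  refine forall₂_congr fun φ hφ => ?_
  have hw := memLp_mkJet hu hDu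
  have hdt : MemLp (dt φ) 2 (muCyl m α T) := hφ.memLp_fderiv_apply (muCyl m α T) (1, 0)
  have hj := hφ.memLp_jet (muCyl m α T)
  have i1 : Integrable (fun z => - mdot (a₀ z.2) (u z) (dt φ z)) (muCyl m α T) :=
    (ha.integrable_mdot hu hdt).neg
  have i2 := integrable_inner_of_memLp (hc.memLp_co (lam := lam) hw) hj
  have i3 := integrable_inner_of_memLp (memLp_srcJet (lam := lam) hF hf) hj
  have e1 : ∫ z, (- mdot (a₀ z.2) (u z) (dt φ z)
        + (∑ i, ∑ j, mdot (A i j z) (Du j z) (dx i φ z))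
        + lam * mdot (C₀ z) (u z) (φ z)) ∂(muCyl m α T)
      = - ∫ z, mdot (a₀ z.2) (u z) (dt φ z) ∂(muCyl m α T)
        + ∫ z, inner ℝ (co lam A C₀ z (mkJet u Du z)) (jet φ z) ∂(muCyl m α T) := by
    rw [← integral_neg, ← integral_add i1 i2]
    refine integral_congr_ae (.of_forall fun z => ?_)
    simp only [inner_co, mkJet_some, mkJet_none, jet_some, jet_none]
    ring
  have e2 : ∫ z, ((∑ i, inner ℝ (F i z) (dx i φ z)) + √lam * inner ℝ (f z) (φ z)) ∂(muCyl m α T)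
      = ∫ z, inner ℝ (srcJet lam F f z) (jet φ z) ∂(muCyl m α T) := by
    refine integral_congr_ae (.of_forall fun z => ?_)
    simp [jet_inner, srcJet, inner_smul_left]
  rw [e1, e2]
  simp_rw [inner_sub_left]
  rw [integral_sub i3 i2]
  constructor <;> intro h <;> linarith

lemma energyData_of_isWeakSol [IsLocallyFiniteMeasure (muCyl m α ⊤)] (ha : SymCoeff α κ a₀)
    (hc : BddCoeff α K T A C₀) (hF : ∀ i, MemLp (F i) 2 (muCyl m α T))
    (hf : MemLp f 2 (muCyl m α T)) (hu : MemH1 α T a₀ u Du)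
    (hsol : IsWeakSol α T lam a₀ A C₀ F f u Du) :
    EnergyData α T a₀ (mkJet u Du)
      fun z => srcJet lam F f z - co lam A C₀ z (mkJet u Du z) where
  memLp := memLp_mkJet hu.memLp hu.grad_memLp
  memLp' := (memLp_srcJet hF hf).sub (hc.memLp_co (memLp_mkJet hu.memLp hu.grad_memLp))
  weakGrad := hu.weakGrad
  timeDeriv := (isWeakSol_iff ha hc hF hf hu.memLp hu.grad_memLp).1 hsol

/-- The pointwise form of the energy estimate. -/
lemma ae_two_mul_inner_le (hA : EllipticCoeff κ T A) (hC : NondegCoeff κ (cyl m T) C₀)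
    (hκ : 0 < κ) (hlam : 0 ≤ lam) :
    ∀ᵐ z ∂(muCyl m α T),
      2 * inner ℝ (srcJet lam F f z - co lam A C₀ z (mkJet u Du z)) (mkJet u Du z)
        ≤ κ⁻¹ * ((∑ i, ‖F i z‖ ^ 2) + ‖f z‖ ^ 2) - κ * ((∑ i, ‖Du i z‖ ^ 2) + lam * ‖u z‖ ^ 2) := by
  -- The weight `κ` lets the source use up half of the dissipation `2 κ (|Du|² + λ |u|²)`.
  have young : ∀ v w : Val n, 2 * inner ℝ v w ≤ κ⁻¹ * ‖v‖ ^ 2 + κ * ‖w‖ ^ 2 := by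
    intro v w
    have h1 := real_inner_le_norm v w
    have h2 : κ⁻¹ * ‖v‖ ^ 2 + κ * ‖w‖ ^ 2 - 2 * (‖v‖ * ‖w‖) = κ⁻¹ * (‖v‖ - κ * ‖w‖) ^ 2 := by
      field_simp; ring
    have h3 : 0 ≤ κ⁻¹ * (‖v‖ - κ * ‖w‖) ^ 2 := by positivity
    linarith
  filter_upwards [inner_co_ge (α := α) hA hC hlam] with z hz
  have h1 := hz (mkJet u Du z)
  simp only [mkJet_some, mkJet_none] at h1
  rw [inner_sub_left, mul_sub]
  have h2 : 2 * inner ℝ (srcJet lam F f z) (mkJet u Du z)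
      ≤ (∑ i, (κ⁻¹ * ‖F i z‖ ^ 2 + κ * ‖Du i z‖ ^ 2))
        + (κ⁻¹ * ‖f z‖ ^ 2 + κ * (lam * ‖u z‖ ^ 2)) := by
    rw [jet_inner, mul_add, Finset.mul_sum]
    refine add_le_add (Finset.sum_le_sum fun i _ => young _ _) ?_
    -- Attaching `√λ` to `u` instead of `f` keeps the constant independent of `λ`.
    have h3 := young (f z) (√lam • u z)
    rw [norm_smul, Real.norm_of_nonneg (Real.sqrt_nonneg _), mul_pow, Real.sq_sqrt hlam] at h3
    simpa [srcJet, inner_smul_left, inner_smul_right] using h3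
  rw [Finset.sum_add_distrib, ← Finset.mul_sum, ← Finset.mul_sum] at h2
  linarith

end WeakSolutions

/-! ### The energy estimate and uniqueness -/

section Estimate

variable {m n : ℕ} {α κ lam : ℝ} {T : EReal} {a₀ : Sp m → Matrix (Fin n) (Fin n) ℝ}
  {A : Fin (m + 1) → Fin (m + 1) → ℝ × Sp m → Matrix (Fin n) (Fin n) ℝ}
  {C₀ : ℝ × Sp m → Matrix (Fin n) (Fin n) ℝ}
  {F : Fin (m + 1) → ℝ × Sp m → Val n} {f : ℝ × Sp m → Val n}
  {u v : ℝ × Sp m → Val n} {Du Dv : Fin (m + 1) → ℝ × Sp m → Val n}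

lemma integrable_sum_norm_sq {μ : Measure (ℝ × Sp m)} (hF : ∀ i, MemLp (F i) 2 μ) :
    Integrable (fun z => ∑ i, ‖F i z‖ ^ 2) μ :=
  integrable_finsetSum _ fun i _ => (hF i).integrable_norm_pow two_ne_zero

lemma nonempty_timeRay (hT : ⊥ < T) : (timeRay T).Nonempty := by
  obtain ⟨t, -, ht⟩ := EReal.lt_iff_exists_real_btwn.1 hT
  exact ⟨t, ht⟩

/-- The energy inequality integrated up to a time `S ≤ T`. -/
lemma two_mul_integral_inner_le (hA : EllipticCoeff κ T A) (hC : NondegCoeff κ (cyl m T) C₀)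
    (hκ : 0 < κ) (hlam : 0 ≤ lam) (hF : ∀ i, MemLp (F i) 2 (muCyl m α T))
    (hf : MemLp f 2 (muCyl m α T)) (hu : MemLp u 2 (muCyl m α T))
    (hDu : ∀ i, MemLp (Du i) 2 (muCyl m α T)) {S : EReal} (hS : S ≤ T) :
    2 * ∫ z, inner ℝ (srcJet lam F f z - co lam A C₀ z (mkJet u Du z)) (mkJet u Du z)
        ∂(muCyl m α S)
      ≤ κ⁻¹ * (∫ z, (∑ i, ‖F i z‖ ^ 2) ∂(muCyl m α T) + ∫ z, ‖f z‖ ^ 2 ∂(muCyl m α T))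
        - κ * (∫ z, (∑ i, ‖Du i z‖ ^ 2) ∂(muCyl m α S) + lam * ∫ z, ‖u z‖ ^ 2 ∂(muCyl m α S)) := by
  have hle := muCyl_mono (m := m) (α := α) hS
  have hw := memLp_mkJet hu hDu
  have hL := (memLp_srcJet (lam := lam) hF hf).sub
    ((hA.bddCoeff hC).memLp_co (lam := lam) hw)
  have iF := integrable_sum_norm_sq hF
  have iD := integrable_sum_norm_sq hDu
  have i_f := hf.integrable_norm_pow two_ne_zero
  have iu := hu.integrable_norm_pow two_ne_zero
  have i1 : Integrable (fun z => κ⁻¹ * ((∑ i, ‖F i z‖ ^ 2) + ‖f z‖ ^ 2)) (muCyl m α T) :=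
    (iF.add i_f).const_mul _
  have i2 : Integrable (fun z => κ * ((∑ i, ‖Du i z‖ ^ 2) + lam * ‖u z‖ ^ 2)) (muCyl m α T) :=
    (iD.add (iu.const_mul lam)).const_mul _
  have h1 := integral_mono_ae
    (((integrable_inner_of_memLp hL hw).const_mul 2).mono_measure hle)
    ((i1.mono_measure hle).sub (i2.mono_measure hle))
    (ae_mono hle (ae_two_mul_inner_le (α := α) (F := F) (f := f) (u := u) (Du := Du) hA hC hκ hlam))
  have e1 : ∫ z, κ * ((∑ i, ‖Du i z‖ ^ 2) + lam * ‖u z‖ ^ 2) ∂(muCyl m α S)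
      = κ * (∫ z, (∑ i, ‖Du i z‖ ^ 2) ∂(muCyl m α S) + lam * ∫ z, ‖u z‖ ^ 2 ∂(muCyl m α S)) := by
    rw [integral_const_mul, integral_add (iD.mono_measure hle) ((iu.const_mul lam).mono_measure hle),
      integral_const_mul]
  have e2 : ∫ z, κ⁻¹ * ((∑ i, ‖F i z‖ ^ 2) + ‖f z‖ ^ 2) ∂(muCyl m α T)
      = κ⁻¹ * (∫ z, (∑ i, ‖F i z‖ ^ 2) ∂(muCyl m α T) + ∫ z, ‖f z‖ ^ 2 ∂(muCyl m α T)) := by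
    rw [integral_const_mul, integral_add iF i_f]
  have h2 : ∫ z, κ⁻¹ * ((∑ i, ‖F i z‖ ^ 2) + ‖f z‖ ^ 2) ∂(muCyl m α S)
      ≤ ∫ z, κ⁻¹ * ((∑ i, ‖F i z‖ ^ 2) + ‖f z‖ ^ 2) ∂(muCyl m α T) :=
    integral_mono_measure hle (.of_forall fun z => by positivity) i1
  rw [integral_const_mul] at h1
  refine h1.trans ?_
  simp only [Pi.sub_apply]
  rw [integral_sub (i1.mono_measure hle) (i2.mono_measure hle), e1, ← e2]
  linarith

variable [IsLocallyFiniteMeasure (muCyl m α ⊤)]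

/-- A weak solution has a version in `C_b(closure ℝ_T; L_2)`, and satisfies the energy estimate. -/
theorem exists_isVersion_energy_le (ha : SymCoeff α κ a₀) (hA : EllipticCoeff κ T A)
    (hC : NondegCoeff κ (cyl m T) C₀) (hκ : 0 < κ) (hT : ⊥ < T) (hlam : 0 ≤ lam)
    (hF : ∀ i, MemLp (F i) 2 (muCyl m α T)) (hf : MemLp f 2 (muCyl m α T))
    (hu : MemH1 α T a₀ u Du) (hsol : IsWeakSol α T lam a₀ A C₀ F f u Du) :
    ∃ U : closure (timeRay T) →ᵇ Lp (Val n) 2 (muSpace m α),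
      IsVersion α T u U ∧
      (⨆ t : timeRay T, ‖U ⟨t, subset_closure t.2⟩‖ ^ 2)
          + ∫ z, (∑ i, ‖Du i z‖ ^ 2) ∂(muCyl m α T)
          + lam * ∫ z, ‖u z‖ ^ 2 ∂(muCyl m α T)
        ≤ 2 / κ ^ 2 * ∫ z, (∑ i, ‖F i z‖ ^ 2) ∂(muCyl m α T)
          + 2 / κ ^ 2 * ∫ z, ‖f z‖ ^ 2 ∂(muCyl m α T) := by
  have hd := energyData_of_isWeakSol ha (hA.bddCoeff hC) hF hf hu hsol
  set E := ∫ z, (∑ i, ‖F i z‖ ^ 2) ∂(muCyl m α T) + ∫ z, ‖f z‖ ^ 2 ∂(muCyl m α T) with hE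
  have hE0 : 0 ≤ E := add_nonneg (integral_nonneg fun z => by positivity)
    (integral_nonneg fun z => by positivity)
  have hbound : ∀ᵐ τ : ℝ, τ ∈ timeRay T →
      eLpNorm (fun x => u (τ, x)) 2 (muSpace m α) ≤ ENNReal.ofReal (√(κ⁻¹ * E / κ)) := by
    filter_upwards [hd.ae_energy_le ha hκ.le, ae_memLp_slice hu.memLp] with τ h1 h2 hτ
    refine ha.eLpNorm_le hκ (h2 hτ) ((h1 hτ).trans ?_)
    refine (two_mul_integral_inner_le hA hC hκ hlam hF hf hu.memLp hu.grad_memLp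
      (le_of_lt hτ : (τ : EReal) ≤ T)).trans ?_
    have h3 : 0 ≤ ∫ z, (∑ i, ‖Du i z‖ ^ 2) ∂(muCyl m α (τ : EReal)) :=
      integral_nonneg fun z => by positivity
    have h4 : 0 ≤ ∫ z, ‖u z‖ ^ 2 ∂(muCyl m α (τ : EReal)) :=
      integral_nonneg fun z => by positivity
    have h5 : 0 ≤ κ * (∫ z, (∑ i, ‖Du i z‖ ^ 2) ∂(muCyl m α (τ : EReal))
        + lam * ∫ z, ‖u z‖ ^ 2 ∂(muCyl m α (τ : EReal))) := by positivity
    linarith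
  obtain ⟨ρ, hρ, hρ0, hmod⟩ := hd.exists_modulus ha hκ
  obtain ⟨U, hU, hUR⟩ := exists_isVersion hu.memLp hρ hρ0 hmod (Real.sqrt_nonneg _) hbound
  refine ⟨U, hU, ?_⟩
  have : Nonempty (timeRay T) := (nonempty_timeRay hT).to_subtype
  have hsup : (⨆ t : timeRay T, ‖U ⟨t, subset_closure t.2⟩‖ ^ 2) ≤ κ⁻¹ * E / κ := by
    refine ciSup_le fun t => ?_
    exact (Real.le_sqrt (norm_nonneg _) (by positivity)).1 (hUR _)
  -- A nonnegative left-hand side lets the dissipation be bounded by the source.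
  have h1 := hd.integral_nonneg ha hκ.le hT
  have h2 := two_mul_integral_inner_le hA hC hκ hlam hF hf hu.memLp hu.grad_memLp le_rfl
  rw [← hE] at h2
  have h3 : ∫ z, (∑ i, ‖Du i z‖ ^ 2) ∂(muCyl m α T) + lam * ∫ z, ‖u z‖ ^ 2 ∂(muCyl m α T)
      ≤ κ⁻¹ * E / κ := by
    rw [le_div_iff₀ hκ]
    linarith
  -- The supremum and the dissipation are each at most `E / κ²`, whence the constant `2 / κ²`.
  have h4 : 2 / κ ^ 2 * ∫ z, (∑ i, ‖F i z‖ ^ 2) ∂(muCyl m α T)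
      + 2 / κ ^ 2 * ∫ z, ‖f z‖ ^ 2 ∂(muCyl m α T) = κ⁻¹ * E / κ + κ⁻¹ * E / κ := by
    rw [hE]; field_simp; ring
  linarith

/-- Weak solutions are unique for `λ > 0`. -/
theorem IsWeakSol.ae_eq (ha : SymCoeff α κ a₀) (hA : EllipticCoeff κ T A)
    (hC : NondegCoeff κ (cyl m T) C₀) (hκ : 0 < κ) (hT : ⊥ < T) (hlam : 0 < lam)
    (hF : ∀ i, MemLp (F i) 2 (muCyl m α T)) (hf : MemLp f 2 (muCyl m α T))
    (hu : MemH1 α T a₀ u Du) (hsol : IsWeakSol α T lam a₀ A C₀ F f u Du)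
    (hv : MemH1 α T a₀ v Dv) (hsol' : IsWeakSol α T lam a₀ A C₀ F f v Dv) :
    v =ᵐ[muCyl m α T] u := by
  have hd := (energyData_of_isWeakSol ha (hA.bddCoeff hC) hF hf hv hsol').sub ha
    (energyData_of_isWeakSol ha (hA.bddCoeff hC) hF hf hu hsol)
  -- For the difference of two solutions the sources cancel and the same integrand is at most `-κ λ
  -- |v - u|²`; both signs can hold only if `v = u`.
  have h1 := hd.integral_nonneg ha hκ.le hT
  have hi := integrable_inner_of_memLp hd.memLp' hd.memLp
  have hvu : Integrable (fun z => ‖v z - u z‖ ^ 2) (muCyl m α T) :=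
    (hv.memLp.sub hu.memLp).integrable_norm_pow two_ne_zero
  have h2 : ∫ z, inner ℝ (srcJet lam F f z - co lam A C₀ z (mkJet v Dv z)
        - (srcJet lam F f z - co lam A C₀ z (mkJet u Du z))) (mkJet v Dv z - mkJet u Du z)
        ∂(muCyl m α T)
      ≤ ∫ z, -(κ * lam) * ‖v z - u z‖ ^ 2 ∂(muCyl m α T) := by
    refine integral_mono_ae hi (hvu.const_mul _) ?_
    filter_upwards [inner_co_ge (α := α) hA hC hlam.le] with z hz
    have h3 := hz (mkJet v Dv z - mkJet u Du z)
    have h4 : co lam A C₀ z (mkJet v Dv z)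
        = co lam A C₀ z (mkJet v Dv z - mkJet u Du z) + co lam A C₀ z (mkJet u Du z) := by
      rw [← co_add, sub_add_cancel]
    have h5 : srcJet lam F f z - co lam A C₀ z (mkJet v Dv z)
        - (srcJet lam F f z - co lam A C₀ z (mkJet u Du z))
        = - co lam A C₀ z (mkJet v Dv z - mkJet u Du z) := by
      rw [h4]; abel
    have h6 : 0 ≤ κ * ∑ i : Fin (m + 1), ‖(mkJet v Dv z - mkJet u Du z) (some i)‖ ^ 2 := by
      positivity
    simp only [h5, inner_neg_left]
    have h7 : (mkJet v Dv z - mkJet u Du z) none = v z - u z := rfl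
    rw [h7] at h3
    linarith
  rw [integral_const_mul] at h2
  have h3 : 0 ≤ ∫ z, ‖v z - u z‖ ^ 2 ∂(muCyl m α T) := integral_nonneg fun z => by positivity
  have h4 : ∫ z, ‖v z - u z‖ ^ 2 ∂(muCyl m α T) = 0 := by
    have := mul_pos hκ hlam
    nlinarith
  have h5 := (integral_eq_zero_iff_of_nonneg (fun z => by positivity) hvu).1 h4
  filter_upwards [h5] with z hz
  simpa [sub_eq_zero] using hz

end Estimate

/-! ### Existence -/

/-- J.-L. Lions' variant of the Lax–Milgram lemma. -/
theorem exists_forall_inner_eq {Φ H : Type*} [AddCommGroup Φ] [Module ℝ Φ] [NormedAddCommGroup H]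
    [InnerProductSpace ℝ H] [CompleteSpace H] (j k : Φ →ₗ[ℝ] H) {c : ℝ} (hc : 0 < c)
    (hjk : ∀ φ, c * ‖j φ‖ ^ 2 ≤ inner ℝ (j φ) (k φ)) (l : H) :
    ∃ y ∈ closure (range j), ∀ φ, inner ℝ y (k φ) = inner ℝ l (j φ) := by
  -- Projecting `k` onto this closure forces the representing vector to lie in it.
  let V : Submodule ℝ H := (LinearMap.range j).topologicalClosure
  have : CompleteSpace V := (Submodule.isClosed_topologicalClosure _).completeSpace_coe
  have hV : ∀ φ, j φ ∈ V := fun φ => Submodule.le_topologicalClosure _ ⟨φ, rfl⟩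
  let K : Φ →ₗ[ℝ] V := V.orthogonalProjectionOnto.toLinearMap ∘ₗ k
  have hK : ∀ (v : V) φ, inner ℝ v (K φ) = inner ℝ (v : H) (k φ) := fun v φ =>
    Submodule.inner_orthogonalProjectionOnto_eq_of_mem_left v (k φ)
  -- Coercivity and Cauchy–Schwarz: `j φ` is controlled by `K φ`, so `K φ ↦ ⟨l, j φ⟩` is a bounded
  -- functional on the range of `K`. Hahn–Banach and Riesz then produce `y`.
  have hlow : ∀ φ, ‖j φ‖ ≤ c⁻¹ * ‖K φ‖ := by
    intro φ
    rcases (norm_nonneg (j φ)).eq_or_lt with h0 | h0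
    · rw [← h0]; positivity
    have h1 := (hjk φ).trans_eq (hK ⟨j φ, hV φ⟩ φ).symm
    have h2 : inner ℝ (⟨j φ, hV φ⟩ : V) (K φ) ≤ ‖j φ‖ * ‖K φ‖ :=
      real_inner_le_norm (⟨j φ, hV φ⟩ : V) (K φ)
    rw [inv_mul_eq_div, le_div_iff₀ hc]
    nlinarith
  obtain ⟨σ, hσ⟩ := LinearMap.exists_rightInverse_of_surjective K.rangeRestrict
    (LinearMap.range_rangeRestrict K)
  have hσ' : ∀ r : LinearMap.range K, K (σ r) = r := fun r =>
    congrArg Subtype.val (LinearMap.congr_fun hσ r)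
  let g : LinearMap.range K →L[ℝ] ℝ :=
    LinearMap.mkContinuous ((innerₛₗ ℝ l) ∘ₗ j ∘ₗ σ) (‖l‖ * c⁻¹) fun r => by
      have h1 := hlow (σ r)
      rw [hσ'] at h1
      refine (norm_inner_le_norm l (j (σ r))).trans ?_
      rw [mul_assoc]
      exact mul_le_mul_of_nonneg_left h1 (norm_nonneg _)
  obtain ⟨G, hG, -⟩ := exists_extension_norm_eq (LinearMap.range K) g
  let y : V := (InnerProductSpace.toDual ℝ V).symm G
  refine ⟨y, y.2, fun φ => ?_⟩
  rw [← hK, show inner ℝ y (K φ) = G (K φ) from InnerProductSpace.toDual_symm_apply]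
  have h1 := hG ⟨K φ, ⟨φ, rfl⟩⟩
  rw [h1]
  -- `K` need not be injective, but by the lower bound `j φ` depends on `K φ` alone, so the choice
  -- of right inverse does not matter.
  have h2 : j (σ ⟨K φ, ⟨φ, rfl⟩⟩) = j φ := by
    have h3 := hlow (σ ⟨K φ, ⟨φ, rfl⟩⟩ - φ)
    rw [map_sub K, hσ', sub_self, norm_zero, mul_zero, map_sub] at h3
    exact sub_eq_zero.1 (norm_le_zero_iff.1 h3)
  change inner ℝ l (j (σ ⟨K φ, ⟨φ, rfl⟩⟩)) = _
  rw [h2]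

/-- The jet with the single nonzero component `v`, at the index `o`. -/
def singleJet {m n : ℕ} (o : Option (Fin (m + 1))) (v : Val n) : Jet m n :=
  WithLp.toLp 2 (Pi.single o v)

lemma inner_singleJet {m n : ℕ} (o : Option (Fin (m + 1))) (v : Val n) (w : Jet m n) :
    inner ℝ (singleJet o v) w = inner ℝ v (w o) := by
  rw [PiLp.inner_apply, Finset.sum_eq_single o]
  · simp [singleJet]
  · intro o' _ h
    simp [singleJet, h]
  · simp

lemma memLp_singleJet {m n : ℕ} {μ : Measure (ℝ × Sp m)} (o : Option (Fin (m + 1))) (e : Val n)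
    {g : ℝ × Sp m → ℝ} (hg : MemLp g 2 μ) :
    MemLp (fun z => (singleJet o (g z • e) : Jet m n)) 2 μ := by
  refine MemLp.of_eval_piLp fun o' => ?_
  by_cases h : o' = o
  · subst h
    simp only [singleJet, Pi.single_eq_same]
    exact (ContinuousLinearMap.toSpanSingleton ℝ e).comp_memLp' hg
  · simp only [singleJet, Pi.single_eq_of_ne h]
    exact MemLp.zero

/-! ### Closedness of the weak gradient. -/

section WeakGradient

variable {m n : ℕ} {α : ℝ} {T : EReal}

lemma hasWeakGrad_of_isTest {O : Set (ℝ × Sp m)} {φ : ℝ × Sp m → Val n} (hφ : IsTest O φ) :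
    HasWeakGrad T φ fun i => dx i φ := by
  intro i ψ hψ
  rw [setIntegral_eq_integral_of_forall_compl_eq_zero (fun t ht => by
      rw [show dx i ψ t = 0 from hψ.fderiv_apply_eq_zero _ ht, zero_smul]),
    setIntegral_eq_integral_of_forall_compl_eq_zero (fun t ht => by
      rw [hψ.eq_zero_of_notMem ht, zero_smul])]
  have hcψ := hψ.continuous_fderiv_apply (0, EuclideanSpace.single i 1)
  have hcφ := hφ.continuous_fderiv_apply (0, EuclideanSpace.single i 1)
  have h := integral_smul_fderiv_eq_neg_fderiv_smul_of_integrable (μ := volume) (𝕜 := ℝ)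
    (f := ψ) (g := φ) (v := (0, EuclideanSpace.single i 1))
    ((hcψ.smul hφ.1.continuous).integrable_of_hasCompactSupport hφ.2.1.smul_left)
    ((hψ.1.continuous.smul hcφ).integrable_of_hasCompactSupport hψ.2.1.smul_right)
    ((hψ.1.continuous.smul hφ.1.continuous).integrable_of_hasCompactSupport hψ.2.1.smul_right)
    (fun z _ => hψ.differentiable z) (fun z _ => hφ.differentiable z)
  exact (neg_eq_iff_eq_neg.2 h).symm

variable [IsLocallyFiniteMeasure (muCyl m α ⊤)]

/-- Lebesgue pairings with such `g` are bounded functionals on `L_2(μ)`, so the identity that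
defines the weak gradient is a closed condition. -/
lemma exists_inner_eq_setIntegral {g : ℝ × Sp m → ℝ} (hg : Continuous g)
    (hgc : HasCompactSupport g) (hgT : tsupport g ⊆ cyl m T) (o : Option (Fin (m + 1)))
    (e : Val n) : ∃ Ψ : JetL2 m n α, ∀ y : JetL2 m n α,
      inner ℝ Ψ y = inner ℝ e (∫ z in cyl m T, g z • y z o) := by
  have hgw := memLp_invWeight_mul (α := α) hg hgc hgT
  have hΨ := memLp_singleJet o e hgw
  refine ⟨(memLp_extZero hΨ).toLp _, fun y => ?_⟩
  have hy : MemLp (fun z => y z o) 2 (muCyl m α T) :=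
    (memLp_jet_apply (Lp.memLp y) o).mono_measure (muCyl_mono le_top)
  have hi : Integrable (fun z => (invWeight m α z * g z) • y z o) (muCyl m α T) :=
    integrable_invWeight_smul (y := fun z => y z o) hg hgc hgT hy
  have h1 := inner_toLp (memLp_extZero hΨ) (Lp.memLp y)
  rw [Lp.toLp_coeFn] at h1
  rw [h1, integral_inner_extZero, setIntegral_smul_eq (α := α), ← integral_inner hi]
  refine integral_congr_ae (.of_forall fun z => ?_)
  simp only [inner_singleJet, inner_smul_left, inner_smul_right, conj_trivial]

/-- The weak gradient is closed: it is inherited by `L_2` limits of jets of test functions. -/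
lemma hasWeakGrad_of_mem_closure {y : JetL2 m n α} (hy : y ∈ closure (range (testJet m n α T))) :
    HasWeakGrad T (fun z => y z none) fun i z => y z (some i) := by
  intro i ψ hψ
  refine ext_inner_left ℝ fun e => ?_
  have hψ' : tsupport (dx i ψ) ⊆ cyl m T :=
    (closure_minimal (support_fderiv_apply_subset _) (isClosed_tsupport ψ)).trans hψ.2.2
  obtain ⟨Ψ₁, h₁⟩ := exists_inner_eq_setIntegral (α := α)
    (hψ.continuous_fderiv_apply (0, EuclideanSpace.single i 1))
    (hψ.hasCompactSupport_fderiv_apply (0, EuclideanSpace.single i 1)) hψ' none e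
  obtain ⟨Ψ₂, h₂⟩ := exists_inner_eq_setIntegral (α := α) hψ.1.continuous hψ.2.1 hψ.2.2 (some i) e
  have hclosed : IsClosed {y : JetL2 m n α | inner ℝ Ψ₁ y = - inner ℝ Ψ₂ y} :=
    isClosed_eq (innerSL ℝ Ψ₁).continuous (innerSL ℝ Ψ₂).continuous.neg
  have key : inner ℝ Ψ₁ y = - inner ℝ Ψ₂ y := by
    refine closure_minimal ?_ hclosed hy
    rintro _ ⟨φ, rfl⟩
    have hφ : IsTest (timeRay T ×ˢ univ) (φ : ℝ × Sp m → Val n) := φ.2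
    have hae : ∀ᵐ z ∂(volume.restrict (cyl m T)), testJet m n α T φ z = jet φ z := by
      refine (volume_absolutelyContinuous_muCyl m α T).ae_le ?_
      exact ae_mono (muCyl_mono le_top) (IsTest.memLp_jet φ.2 (muCyl m α ⊤)).coeFn_toLp
    rw [mem_ofPred_eq, h₁, h₂, ← inner_neg_right]
    congr 1
    have e1 : ∫ z in cyl m T, fderiv ℝ ψ z (0, EuclideanSpace.single i 1) • testJet m n α T φ z none
        = ∫ z in cyl m T, dx i ψ z • (φ : ℝ × Sp m → Val n) z := by
      refine integral_congr_ae ?_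
      filter_upwards [hae] with z hz
      rw [hz]; rfl
    have e2 : ∫ z in cyl m T, ψ z • testJet m n α T φ z (some i)
        = ∫ z in cyl m T, ψ z • dx i (φ : ℝ × Sp m → Val n) z := by
      refine integral_congr_ae ?_
      filter_upwards [hae] with z hz
      rw [hz]; rfl
    rw [e1, e2]
    exact hasWeakGrad_of_isTest hφ i ψ hψ
  rw [h₁, h₂, ← inner_neg_right] at key
  exact key

end WeakGradient

section Existence

variable {m n : ℕ} {α κ K lam : ℝ} {T : EReal} {a₀ : Sp m → Matrix (Fin n) (Fin n) ℝ}
  {A : Fin (m + 1) → Fin (m + 1) → ℝ × Sp m → Matrix (Fin n) (Fin n) ℝ}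
  {C₀ : ℝ × Sp m → Matrix (Fin n) (Fin n) ℝ}
  {F : Fin (m + 1) → ℝ × Sp m → Val n} {f : ℝ × Sp m → Val n}

lemma hasDerivAt_even_eq_zero {r : ℝ → ℝ} {d : ℝ} (hr : ∀ s, r (-s) = r s)
    (hd : HasDerivAt r d 0) : d = 0 := by
  have h1 : HasDerivAt (fun s => r (-s)) (-d) 0 := by
    have h2 : HasDerivAt r d (-0) := by rwa [neg_zero]
    have h3 := h2.comp 0 (hasDerivAt_neg (0 : ℝ))
    rwa [mul_neg_one] at h3
  have h2 : (fun s => r (-s)) = r := funext hr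
  rw [h2] at h1
  linarith [h1.unique hd]

/-- The jet field `φ ↦ (λ C₀ᵀ φ - a₀ φ_t, (A^{ji})ᵀ D_j φ)` of the formal adjoint operator. -/
def dualField (lam : ℝ) (a₀ : Sp m → Matrix (Fin n) (Fin n) ℝ)
    (A : Fin (m + 1) → Fin (m + 1) → ℝ × Sp m → Matrix (Fin n) (Fin n) ℝ)
    (C₀ : ℝ × Sp m → Matrix (Fin n) (Fin n) ℝ) (φ : ℝ × Sp m → Val n) (z : ℝ × Sp m) : Jet m n :=
  co lam (fun i j z => (A j i z)ᵀ) (fun z => (C₀ z)ᵀ) z (jet φ z)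
    - liftJet (fun z => mv (a₀ z.2) (dt φ z)) z

lemma liftJet_add (b c : ℝ × Sp m → Val n) (z : ℝ × Sp m) :
    liftJet (fun z => b z + c z) z = liftJet b z + liftJet c z := by
  ext1 o
  cases o <;> simp [liftJet]

lemma liftJet_smul (r : ℝ) (b : ℝ × Sp m → Val n) (z : ℝ × Sp m) :
    liftJet (fun z => r • b z) z = r • liftJet b z := by
  ext1 o
  cases o <;> simp [liftJet]

lemma dualField_add {φ ψ : ℝ × Sp m → Val n} (hφ : Differentiable ℝ φ) (hψ : Differentiable ℝ ψ)
    (z : ℝ × Sp m) :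
    dualField lam a₀ A C₀ (φ + ψ) z = dualField lam a₀ A C₀ φ z + dualField lam a₀ A C₀ ψ z := by
  have h : ∀ z, dt (φ + ψ) z = dt φ z + dt ψ z := fun z => by
    simp [dt, fderiv_add (hφ z) (hψ z)]
  simp only [dualField, h, mv_add, liftJet_add, jet_add hφ hψ, Pi.add_apply, co_add]
  abel

lemma dualField_smul {φ : ℝ × Sp m → Val n} (hφ : Differentiable ℝ φ) (c : ℝ) (z : ℝ × Sp m) :
    dualField lam a₀ A C₀ (c • φ) z = c • dualField lam a₀ A C₀ φ z := by
  have h : ∀ z, dt (c • φ) z = c • dt φ z := fun z => by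
    simp [dt, fderiv_const_smul (hφ z)]
  simp only [dualField, h, mv_smul, liftJet_smul, jet_const_smul hφ, Pi.smul_apply, co_smul, smul_sub]

lemma extZero_add (w w' : ℝ × Sp m → Jet m n) :
    extZero T (fun z => w z + w' z) = extZero T w + extZero T w' :=
  indicator_add _ w w'

lemma extZero_smul (c : ℝ) (w : ℝ × Sp m → Jet m n) :
    extZero T (fun z => c • w z) = c • extZero T w :=
  indicator_const_smul _ c w

variable [IsLocallyFiniteMeasure (muCyl m α ⊤)]

lemma memLp_dualField (ha : SymCoeff α κ a₀) (hc : BddCoeff α K T A C₀) {O : Set (ℝ × Sp m)}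
    {φ : ℝ × Sp m → Val n} (hφ : IsTest O φ) :
    MemLp (dualField lam a₀ A C₀ φ) 2 (muCyl m α T) :=
  (hc.transpose.memLp_co (hφ.memLp_jet _)).sub
    (memLp_liftJet (ha.memLp_mv (hφ.memLp_fderiv_apply _ _)))

/-- The formal adjoint operator as a linear map from test functions to `L_2`. -/
def testDual (lam : ℝ) (ha : SymCoeff α κ a₀) (hc : BddCoeff α K T A C₀) :
    testSpace m n T →ₗ[ℝ] JetL2 m n α where
  toFun φ := (memLp_extZero (memLp_dualField (lam := lam) ha hc φ.2)).toLp _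
  map_add' φ ψ := by
    rw [← MemLp.toLp_add]
    refine MemLp.toLp_congr _ _ (.of_eq ?_)
    rw [← extZero_add]
    congr 1
    exact funext (dualField_add (IsTest.differentiable φ.2) (IsTest.differentiable ψ.2))
  map_smul' c φ := by
    rw [RingHom.id_apply, ← MemLp.toLp_const_smul]
    refine MemLp.toLp_congr _ _ (.of_eq ?_)
    rw [← extZero_smul]
    congr 1
    exact funext (dualField_smul (IsTest.differentiable φ.2) c)

/-- Green's formula for the adjoint operator. -/
lemma integral_inner_dualField (ha : SymCoeff α κ a₀) (hc : BddCoeff α K T A C₀)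
    {w : ℝ × Sp m → Jet m n} (hw : MemLp w 2 (muCyl m α T)) {O : Set (ℝ × Sp m)}
    {φ : ℝ × Sp m → Val n} (hφ : IsTest O φ) :
    ∫ z, inner ℝ (dualField lam a₀ A C₀ φ z) (w z) ∂(muCyl m α T)
      = ∫ z, inner ℝ (co lam A C₀ z (w z)) (jet φ z) ∂(muCyl m α T)
        - ∫ z, mdot (a₀ z.2) (w z none) (dt φ z) ∂(muCyl m α T) := by
  have hdt : MemLp (dt φ) 2 (muCyl m α T) := hφ.memLp_fderiv_apply (muCyl m α T) (1, 0)
  rw [← integral_sub (integrable_inner_of_memLp (hc.memLp_co hw) (hφ.memLp_jet _))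
    (ha.integrable_mdot (memLp_jet_apply hw none) hdt)]
  refine integral_congr_ae ?_
  filter_upwards [ha.symm_cyl] with z hz
  rw [dualField, inner_sub_left, inner_liftJet, real_inner_comm, inner_co_transpose,
    ← mdot_eq_inner, mdot_comm _ _ _ hz]

/-- `s ↦ ∫ a₀ φ · φ(t + s)` is even, by symmetry of `a₀` and invariance of `μ`, so its derivative at
`0` vanishes. This replaces the integration of `(a₀ φ · φ)_t / 2`. -/
lemma SymCoeff.integral_mdot_dt_eq_zero (ha : SymCoeff α κ a₀) {O : Set (ℝ × Sp m)}
    {φ : ℝ × Sp m → Val n} (hφ : IsTest O φ) :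
    ∫ z, mdot (a₀ z.2) (φ z) (dt φ z) ∂(muCyl m α ⊤) = 0 := by
  have hb := ha.memLp_mv (hφ.memLp (muCyl m α ⊤))
  have hder := hasDerivAt_integral_shift hb hφ 0
  have h0 := hasDerivAt_even_eq_zero (fun s => ?_) hder
  · have : shift m 0 = id := by ext z <;> simp [shift]
    simpa only [this, id, ← mdot_eq_inner] using h0
  · rw [← integral_comp_shift s]
    refine integral_congr_ae ?_
    filter_upwards [ha.symm_cyl] with z hz
    rw [shift_shift_neg, shift_snd, ← mdot_eq_inner, ← mdot_eq_inner, mdot_comm _ _ _ hz]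

/-- Weak solutions exist for `λ > 0`. -/
theorem exists_isWeakSol (ha : SymCoeff α κ a₀) (hA : EllipticCoeff κ T A)
    (hC : NondegCoeff κ (cyl m T) C₀) (hκ : 0 < κ) (hlam : 0 < lam)
    (hF : ∀ i, MemLp (F i) 2 (muCyl m α T)) (hf : MemLp f 2 (muCyl m α T)) :
    ∃ (u : ℝ × Sp m → Val n) (Du : Fin (m + 1) → ℝ × Sp m → Val n),
      MemH1 α T a₀ u Du ∧ IsWeakSol α T lam a₀ A C₀ F f u Du := by
  have hc : BddCoeff α κ⁻¹ T A C₀ := hA.bddCoeff hC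
  have hsrc := memLp_srcJet (lam := lam) hF hf
  have hdual : ∀ (y : JetL2 m n α) (φ : testSpace m n T),
      inner ℝ y (testDual lam ha hc φ)
        = ∫ z, inner ℝ (co lam A C₀ z (y z)) (jet φ z) ∂(muCyl m α T)
          - ∫ z, mdot (a₀ z.2) (y z none) (dt φ z) ∂(muCyl m α T) := by
    intro y φ
    have h1 := inner_toLp (memLp_extZero (memLp_dualField (lam := lam) ha hc φ.2)) (Lp.memLp y)
    rw [Lp.toLp_coeFn, integral_inner_extZero, integral_inner_dualField ha hc
      ((Lp.memLp y).mono_measure (muCyl_mono le_top)) φ.2, real_inner_comm] at h1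
    exact h1
  -- The time term integrates to zero. Ellipticity controls `|Dφ|² + λ |φ|²`, whereas the jet norm
  -- is `|Dφ|² + |φ|²`; hence the factor `min 1 lam`, positive only for `λ > 0`.
  have hcoer : ∀ φ : testSpace m n T, κ * min 1 lam * ‖testJet m n α T φ‖ ^ 2
      ≤ inner ℝ (testJet m n α T φ) (testDual lam ha hc φ) := by
    intro φ
    have hφ : IsTest (timeRay T ×ˢ univ) (φ : ℝ × Sp m → Val n) := φ.2
    have hj := hφ.memLp_jet (muCyl m α T)
    have h1 := inner_toLp (memLp_extZero (memLp_dualField (lam := lam) ha hc hφ))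
      (hφ.memLp_jet (muCyl m α ⊤))
    rw [integral_inner_extZero, integral_inner_dualField ha hc hj hφ, real_inner_comm] at h1
    have h2 := ha.integral_mdot_dt_eq_zero hφ
    rw [integral_muCyl_eq (T := T) fun z hz => by rw [hφ.dt_eq_zero hz, mdot_zero_right]] at h2
    simp only [jet_none, h2, sub_zero] at h1
    refine le_of_le_of_eq ?_ h1.symm
    rw [testJet_apply, norm_sq_toLp, integral_muCyl_eq (T := T) fun z hz => by
      rw [hφ.jet_eq_zero hz]; simp, ← integral_const_mul]
    refine integral_mono_ae ((hj.integrable_norm_pow two_ne_zero).const_mul _)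
      (integrable_inner_of_memLp (hc.memLp_co hj) hj) ?_
    filter_upwards [inner_co_ge (α := α) hA hC hlam.le] with z hz
    refine le_trans ?_ (hz (jet φ z))
    rw [jet_norm_sq, mul_assoc, mul_add]
    gcongr
    · exact mul_le_of_le_one_left (by positivity) (min_le_left _ _)
    · exact min_le_right _ _
  -- The orthogonality relation is the weak formulation, and membership in the closure supplies the
  -- weak gradient.
  obtain ⟨y, hy, hyl⟩ := exists_forall_inner_eq (testJet m n α T) (testDual lam ha hc)
    (c := κ * min 1 lam) (by positivity) hcoer ((memLp_extZero hsrc).toLp _)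
  have hyT : MemLp y 2 (muCyl m α T) := (Lp.memLp y).mono_measure (muCyl_mono le_top)
  have hu : MemLp (fun z => y z none) 2 (muCyl m α T) := memLp_jet_apply hyT none
  have hDu : ∀ i : Fin (m + 1), MemLp (fun z => y z (some i)) 2 (muCyl m α T) := fun i =>
    memLp_jet_apply hyT (some i)
  have heq : mkJet (fun z => y z none) (fun i z => y z (some i)) = y := by
    ext z o
    cases o <;> rfl
  have hL := hsrc.sub (hc.memLp_co (lam := lam) hyT)
  have hid : ∀ φ : ℝ × Sp m → Val n, IsTest (timeRay T ×ˢ univ) φ →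
      - ∫ z, mdot (a₀ z.2) (y z none) (dt φ z) ∂(muCyl m α T)
        = ∫ z, inner ℝ (srcJet lam F f z - co lam A C₀ z (y z)) (jet φ z) ∂(muCyl m α T) := by
    intro φ hφ
    have h1 := hyl ⟨φ, hφ⟩
    rw [hdual, testJet_apply, inner_toLp, integral_inner_extZero] at h1
    simp_rw [inner_sub_left]
    rw [integral_sub (integrable_inner_of_memLp hsrc (hφ.memLp_jet _))
      (integrable_inner_of_memLp (hc.memLp_co hyT) (hφ.memLp_jet _)), ← h1]
    ring
  refine ⟨fun z => y z none, fun i z => y z (some i),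
    ⟨hu, hDu, hasWeakGrad_of_mem_closure hy, ?_⟩, ?_⟩
  · refine ⟨fun i z => (srcJet lam F f z - co lam A C₀ z (y z)) (some i),
      fun z => (srcJet lam F f z - co lam A C₀ z (y z)) none,
      fun i => memLp_jet_apply hL (some i), memLp_jet_apply hL none, fun φ hφ => ?_⟩
    rw [hid φ hφ]
    simp_rw [jet_inner]
    rfl
  · rw [isWeakSol_iff ha hc hF hf hu hDu, heq]
    exact hid

end Existence

end WeightedParabolic

end

/-! ### The theorem. -/

open WeightedParabolic in
theorem theorem3p1 (m n : ℕ) (α : ℝ) (hα : -1 < α) (κ : ℝ) (hκ : 0 < κ) (hκ' : κ ≤ 1) :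
    ∃ N : ℝ, 0 < N ∧
      ∀ (T : EReal) (_ : ⊥ < T) (lam : ℝ) (_ : 0 ≤ lam)
        (a₀ : Sp m → Matrix (Fin n) (Fin n) ℝ)
        (A : Fin (m + 1) → Fin (m + 1) → ℝ × Sp m → Matrix (Fin n) (Fin n) ℝ)
        (C₀ : ℝ × Sp m → Matrix (Fin n) (Fin n) ℝ)
        (_ : EllipticCoeff κ T A)
        (_ : NondegCoeff κ (halfSpace m) a₀)
        (_ : ∀ᵐ x ∂(volume.restrict (halfSpace m)), (a₀ x)ᵀ = a₀ x)
        (_ : NondegCoeff κ (cyl m T) C₀)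
        (F : Fin (m + 1) → ℝ × Sp m → Val n) (f : ℝ × Sp m → Val n)
        (_ : ∀ i, MemLp (F i) 2 (muCyl m α T)) (_ : MemLp f 2 (muCyl m α T)),
        (∀ (u : ℝ × Sp m → Val n) (Du : Fin (m + 1) → ℝ × Sp m → Val n),
          MemH1 α T a₀ u Du → IsWeakSol α T lam a₀ A C₀ F f u Du →
          ∃ U : closure (timeRay T) →ᵇ Lp (Val n) 2 (muSpace m α),
            IsVersion α T u U ∧
            (⨆ t : timeRay T, ‖U ⟨t, subset_closure t.2⟩‖ ^ 2)
                + ∫ z, (∑ i, ‖Du i z‖ ^ 2) ∂(muCyl m α T)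
                + lam * ∫ z, ‖u z‖ ^ 2 ∂(muCyl m α T)
              ≤ N * ∫ z, (∑ i, ‖F i z‖ ^ 2) ∂(muCyl m α T)
                + N * ∫ z, ‖f z‖ ^ 2 ∂(muCyl m α T)) ∧
        (0 < lam →
          ∃ (u : ℝ × Sp m → Val n) (Du : Fin (m + 1) → ℝ × Sp m → Val n),
            MemH1 α T a₀ u Du ∧ IsWeakSol α T lam a₀ A C₀ F f u Du ∧
            ∀ (v : ℝ × Sp m → Val n) (Dv : Fin (m + 1) → ℝ × Sp m → Val n),
              MemH1 α T a₀ v Dv → IsWeakSol α T lam a₀ A C₀ F f v Dv →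
              v =ᵐ[muCyl m α T] u) := by
  have := isLocallyFinite_muCyl (m := m) hα ⊤
  refine ⟨2 / κ ^ 2, by positivity, ?_⟩
  intro T hT lam hlam a₀ A C₀ hA ha hsymm hC F f hF hf
  have ha' : SymCoeff α κ a₀ := ha.symCoeff hsymm
  refine ⟨fun u Du hu hsol => exists_isVersion_energy_le ha' hA hC hκ hT hlam hF hf hu hsol,
    fun hlam' => ?_⟩
  obtain ⟨u, Du, hu, hsol⟩ := exists_isWeakSol ha' hA hC hκ hlam' hF hf
  exact ⟨u, Du, hu, hsol, fun v Dv hv hsol' =>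
    hsol.ae_eq ha' hA hC hκ hT hlam' hF hf hu hv hsol'⟩
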